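/- **Setting.** An instance of the $k$-median problem with non-uniform hard capacities consists of a finite set $F$ of facility locations, a finite set $C$ of clients with unit (splittable) demands, a metric $d$ on $C\cup F$ (different points may be at distance $0$), capacities $u_i\ge 0$ $(i\in F)$, and $k\in\mathbb N$. The standard linear program is $$\min \sum_{i\in F}\sum_{j\in C} d(i,j)\,x_{ij}\quad\text{s.t.}\quad \sum_{i} y_i\le k,\quad \sum_i x_{ij}=1\ (j\in C),\quad x_{ij}\le y_i,\quad \sum_j x_{ij}\le u_i y_i\ (i\in F),\quad x_{ij}\ge 0,\quad 0\le y_i\le 1 ,$$ and $\mathrm{OPT}_{LP}$ denotes its optimal value. An *integral solution with capacity violation at most $\beta$* is a pair $(\bar x,\bar y)$ with $\bar y_i\in\{0,1\}$, $\sum_i\bar y_i\le k$, $\sum_i\bar x_{ij}=1$, $0\le \bar x_{ij}\le \bar y_i$ and $\sum_j \bar x_{ij}\le \beta\, u_i\,\bar y_i$; its connection cost is $\sum_{i,j} d(i,j)\bar x_{ij}$. (The assignment $\bar x$ may be fractional, because demands are splittable.) A *rounding algorithm* is a program of a deterministic real random access machine (unit-cost field operations and comparisons of reals, no rounding operation,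 rational constants; additive integer index arithmetic). Its input is an instance, an optimal solution $(x^*,y^*)$ of the linear program, and a real number $\varepsilon>0$. It is *polynomial-time* if it always halts after at most $p(|F|+|C|)$ steps for one polynomial $p$. For given $\varepsilon$ it is an $(\alpha,\beta)$-*approximation algorithm* if on every such input it outputs an integral solution with capacity violation at most $\beta$ and connection cost at most $\alpha\cdot\mathrm{OPT}_{LP}$. **Theorem.** There are rounding algorithms $A_\ell$ ($\ell\in\mathbb N$) such that for every integer $\ell\ge 2$: 1. $A_\ell$ runs in polynomial time, and there is a constant $K_\ell$ such that for every $0<\varepsilon\le 1$, $A_\ell$ with parameter $\varepsilon$ is a $(K_\ell/\varepsilon,\ 3+3\varepsilon)$-approximation algorithm for the $k$-median problem with non-uniform hard capacities. 2. For $\ell=2$ and every $\varepsilon>0$, $A_2$ with parameter $\varepsilon$ is a $(96+180/\varepsilon,\ 3+3\varepsilon)$-approximation algorithm. -/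

import Mathlib

/-! ### Capacitated k-median instances and the standard linear program -/

/-- An instance of the non-uniform hard capacitated `k`-median problem with facility locations `F`
and clients `C` of unit demand.  `dist` is a metric on the disjoint union of clients and
facilities; points at distance zero are allowed (a client may sit at a facility location). -/
structure CapMedian (F C : Type) where
  /-- the number of facilities that may be opened -/
  k : ℕ
  /-- the capacity of each facility -/
  u : F → ℝ
  /-- the metric on clients and facilities -/
  dist : C ⊕ F → C ⊕ F → ℝ
  u_nonneg : ∀ i, 0 ≤ u i
  dist_self : ∀ p, dist p p = 0
  dist_comm : ∀ p q, dist p q = dist q p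
  dist_triangle : ∀ p q r, dist p r ≤ dist p q + dist q r

namespace CapMedian

variable {F C : Type} [Fintype F] [Fintype C]

/-- The distance between a facility and a client. -/
def d (I : CapMedian F C) (i : F) (j : C) : ℝ := I.dist (Sum.inr i) (Sum.inl j)

/-- The connection cost of an assignment; `x i j` is the fraction of client `j` served by `i`. -/
def cost (I : CapMedian F C) (x : F → C → ℝ) : ℝ := ∑ i, ∑ j, I.d i j * x i j

/-- The constraints of the standard linear program, with the capacities scaled by `β`
(`β = 1` gives the linear program itself).  The bound `y i ≤ 1` is the hard capacity condition:
at most one facility may be opened per location. -/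
structure Feasible (I : CapMedian F C) (β : ℝ) (x : F → C → ℝ) (y : F → ℝ) : Prop where
  sum_open : ∑ i, y i ≤ I.k
  served : ∀ j, ∑ i, x i j = 1
  assign_le : ∀ i j, x i j ≤ y i
  capacity : ∀ i, ∑ j, x i j ≤ β * I.u i * y i
  x_nonneg : ∀ i j, 0 ≤ x i j
  y_nonneg : ∀ i, 0 ≤ y i
  y_le_one : ∀ i, y i ≤ 1

/-- `(x, y)` is an optimal (fractional) solution of the standard linear program. -/
def IsLPOptimal (I : CapMedian F C) (x : F → C → ℝ) (y : F → ℝ) : Prop :=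
  I.Feasible 1 x y ∧ ∀ x' y', I.Feasible 1 x' y' → I.cost x ≤ I.cost x'

/-- `(x, y)` is an integral solution with capacity violation at most `β`: every facility is open or
closed, at most `k` are open, and every client is served completely (demands are splittable) by
open facilities `i`, each of which serves at most `β * u i`. -/
def IsIntegralSolution (I : CapMedian F C) (β : ℝ) (x : F → C → ℝ) (y : F → ℝ) : Prop :=
  I.Feasible β x y ∧ ∀ i, y i = 0 ∨ y i = 1

end CapMedian

/-! ### Programs of a real random access machine, with step count -/

namespace RealRAM

/-- The memory: two-dimensional arrays of natural numbers and two-dimensional arrays of reals;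
`ints a i j` and `reals a i j` are the entries `(i, j)` of the arrays with name `a`. -/
structure Memory where
  ints : ℕ → ℕ → ℕ → ℕ
  reals : ℕ → ℕ → ℕ → ℝ

/-- Index arithmetic: constants, array access, addition and truncated subtraction. -/
inductive IExp where
  | const (c : ℕ)
  | get (a : ℕ) (i j : IExp)
  | add (e e' : IExp)
  | sub (e e' : IExp)

/-- Real arithmetic: rational constants, array access, the cast of a natural number, and the four
field operations.  There is no rounding operation. -/
inductive RExp where
  | const (q : ℚ)
  | get (a : ℕ) (i j : IExp)
  | ofInt (e : IExp)
  | add (e e' : RExp)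
  | sub (e e' : RExp)
  | mul (e e' : RExp)
  | div (e e' : RExp)

/-- Tests: comparisons and their Boolean combinations. -/
inductive Test where
  | intLe (e e' : IExp)
  | realLe (e e' : RExp)
  | not (b : Test)
  | and (b b' : Test)

/-- Programs. -/
inductive Prog where
  | skip
  | setInt (a : ℕ) (i j : IExp) (e : IExp)
  | setReal (a : ℕ) (i j : IExp) (e : RExp)
  | seq (c c' : Prog)
  | branch (b : Test) (c c' : Prog)
  | loop (b : Test) (c : Prog)

/-- The value of an index expression. -/
def IExp.eval (s : Memory) : IExp → ℕ
  | .const c => c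
  | .get a i j => s.ints a (i.eval s) (j.eval s)
  | .add e e' => e.eval s + e'.eval s
  | .sub e e' => e.eval s - e'.eval s

/-- The value of a real expression. -/
noncomputable def RExp.eval (s : Memory) : RExp → ℝ
  | .const q => (q : ℝ)
  | .get a i j => s.reals a (i.eval s) (j.eval s)
  | .ofInt e => (e.eval s : ℝ)
  | .add e e' => e.eval s + e'.eval s
  | .sub e e' => e.eval s - e'.eval s
  | .mul e e' => e.eval s * e'.eval s
  | .div e e' => e.eval s / e'.eval s

/-- The truth of a test. -/
def Test.Holds (s : Memory) : Test → Prop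
  | .intLe e e' => e.eval s ≤ e'.eval s
  | .realLe e e' => e.eval s ≤ e'.eval s
  | .not b => ¬ b.Holds s
  | .and b b' => b.Holds s ∧ b'.Holds s

/-- Overwrite one entry of an array of natural numbers. -/
def Memory.setInt (s : Memory) (a i j v : ℕ) : Memory :=
  { s with ints := fun a' i' j' => if a' = a ∧ i' = i ∧ j' = j then v else s.ints a' i' j' }

/-- Overwrite one entry of an array of reals. -/
noncomputable def Memory.setReal (s : Memory) (a i j : ℕ) (v : ℝ) : Memory :=
  { s with reals := fun a' i' j' => if a' = a ∧ i' = i ∧ j' = j then v else s.reals a' i' j' }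

/-- `Exec c s s' t`: the program `c`, started in memory `s`, halts in memory `s'` after `t` steps.
Every assignment and every evaluation of a test is one step (the expressions in a fixed program
have bounded size, so this counts the elementary operations up to a constant factor). -/
inductive Exec : Prog → Memory → Memory → ℕ → Prop where
  | skip (s : Memory) : Exec .skip s s 1
  | setInt (a : ℕ) (i j e : IExp) (s : Memory) :
      Exec (.setInt a i j e) s (s.setInt a (i.eval s) (j.eval s) (e.eval s)) 1
  | setReal (a : ℕ) (i j : IExp) (e : RExp) (s : Memory) :
      Exec (.setReal a i j e) s (s.setReal a (i.eval s) (j.eval s) (e.eval s)) 1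
  | seq {c c' : Prog} {s s' s'' : Memory} {t t' : ℕ}
      (h : Exec c s s' t) (h' : Exec c' s' s'' t') : Exec (.seq c c') s s'' (t + t')
  | branchTrue {b : Test} {c c' : Prog} {s s' : Memory} {t : ℕ}
      (hb : b.Holds s) (h : Exec c s s' t) : Exec (.branch b c c') s s' (t + 1)
  | branchFalse {b : Test} {c c' : Prog} {s s' : Memory} {t : ℕ}
      (hb : ¬ b.Holds s) (h : Exec c' s s' t) : Exec (.branch b c c') s s' (t + 1)
  | loopTrue {b : Test} {c : Prog} {s s' s'' : Memory} {t t' : ℕ}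
      (hb : b.Holds s) (h : Exec c s s' t) (h' : Exec (.loop b c) s' s'' t') :
      Exec (.loop b c) s s'' (t + t' + 1)
  | loopFalse {b : Test} {c : Prog} {s : Memory} (hb : ¬ b.Holds s) : Exec (.loop b c) s s 1

/-- Programs are deterministic: the final memory and the number of steps are unique. -/
theorem Exec.unique {c : Prog} {s s₁ s₂ : Memory} {t₁ t₂ : ℕ}
    (h₁ : Exec c s s₁ t₁) (h₂ : Exec c s s₂ t₂) : s₁ = s₂ ∧ t₁ = t₂ := by
  induction h₁ generalizing s₂ t₂ with
  | skip => cases h₂; exact ⟨rfl, rfl⟩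
  | setInt => cases h₂; exact ⟨rfl, rfl⟩
  | setReal => cases h₂; exact ⟨rfl, rfl⟩
  | seq _ _ ih ih' =>
    cases h₂ with
    | seq k k' =>
      obtain ⟨rfl, rfl⟩ := ih k
      obtain ⟨rfl, rfl⟩ := ih' k'
      exact ⟨rfl, rfl⟩
  | branchTrue hb _ ih =>
    cases h₂ with
    | branchTrue _ k => obtain ⟨rfl, rfl⟩ := ih k; exact ⟨rfl, rfl⟩
    | branchFalse hb' _ => exact absurd hb hb'
  | branchFalse hb _ ih =>
    cases h₂ with
    | branchTrue hb' _ => exact absurd hb' hb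
    | branchFalse _ k => obtain ⟨rfl, rfl⟩ := ih k; exact ⟨rfl, rfl⟩
  | loopTrue hb _ _ ih ih' =>
    cases h₂ with
    | loopTrue _ k k' =>
      obtain ⟨rfl, rfl⟩ := ih k
      obtain ⟨rfl, rfl⟩ := ih' k'
      exact ⟨rfl, rfl⟩
    | loopFalse hb' => exact absurd hb hb'
  | loopFalse hb =>
    cases h₂ with
    | loopTrue hb' _ _ => exact absurd hb' hb
    | loopFalse => exact ⟨rfl, rfl⟩

end RealRAM

/-! ### Rounding algorithms for the capacitated k-median problem -/

namespace CapMedian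

open RealRAM

/-- The initial memory of a rounding program.  The integer arrays `0, 1, 2` hold at `(0, 0)` the
number `m` of facilities, the number `n` of clients and `k`.  The real arrays `0, 1, 2` hold the
facility-client, client-client and facility-facility distances, `3` the capacities, `4` and `5` the
fractional solution `x` and `y`, and `6` the parameter `ε` at `(0, 0)`; vectors are stored in
column `0`.  All other entries are zero. -/
noncomputable def input {m n : ℕ} (I : CapMedian (Fin m) (Fin n))
    (x : Fin m → Fin n → ℝ) (y : Fin m → ℝ) (ε : ℝ) : Memory where
  ints a i j :=
    if i = 0 ∧ j = 0 then
      match a with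
      | 0 => m
      | 1 => n
      | 2 => I.k
      | _ => 0
    else 0
  reals a i j :=
    match a with
    | 0 => if h : i < m ∧ j < n then I.dist (Sum.inr ⟨i, h.1⟩) (Sum.inl ⟨j, h.2⟩) else 0
    | 1 => if h : i < n ∧ j < n then I.dist (Sum.inl ⟨i, h.1⟩) (Sum.inl ⟨j, h.2⟩) else 0
    | 2 => if h : i < m ∧ j < m then I.dist (Sum.inr ⟨i, h.1⟩) (Sum.inr ⟨j, h.2⟩) else 0
    | 3 => if h : i < m ∧ j = 0 then I.u ⟨i, h.1⟩ else 0
    | 4 => if h : i < m ∧ j < n then x ⟨i, h.1⟩ ⟨j, h.2⟩ else 0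
    | 5 => if h : i < m ∧ j = 0 then y ⟨i, h.1⟩ else 0
    | 6 => if i = 0 ∧ j = 0 then ε else 0
    | _ => 0

/-- The assignment that a final memory represents, read from real array `7`. -/
def outputX (m n : ℕ) (s : Memory) (i : Fin m) (j : Fin n) : ℝ := s.reals 7 i j

/-- The opening vector that a final memory represents, read from real array `8`. -/
def outputY (m : ℕ) (s : Memory) (i : Fin m) : ℝ := s.reals 8 i 0

/-- The program `P` runs in polynomial time: for one polynomial `p`, it halts after at most
`p (m + n)` steps, for all `m` and `n`, on every instance with `m` facilities and `n` clients, every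
optimal fractional solution and every `ε > 0`. -/
def RunsInPolyTime (P : Prog) : Prop :=
  ∃ p : Polynomial ℕ, ∀ (m n : ℕ) (I : CapMedian (Fin m) (Fin n))
    (x : Fin m → Fin n → ℝ) (y : Fin m → ℝ) (ε : ℝ), I.IsLPOptimal x y → 0 < ε →
    ∃ s t, Exec P (I.input x y ε) s t ∧ t ≤ p.eval (m + n)

/-- With parameter `ε`, the program `P` is an `(α, β)`-approximation algorithm relative to the
standard linear program: from every instance and every optimal fractional solution it computes an
integral solution with capacity violation at most `β` and connection cost at most `α` times the
optimal value of the linear program. -/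
def IsBicriteriaApprox (P : Prog) (ε α β : ℝ) : Prop :=
  ∀ (m n : ℕ) (I : CapMedian (Fin m) (Fin n)) (x : Fin m → Fin n → ℝ) (y : Fin m → ℝ),
    I.IsLPOptimal x y →
    ∃ s t, Exec P (I.input x y ε) s t ∧
      I.IsIntegralSolution β (outputX m n s) (outputY m s) ∧
      I.cost (outputX m n s) ≤ α * I.cost x

end CapMedian

/-! A single program serves every ℓ; it attains violation 3 + 3ε and cost (93 + 15/ε) times the LP
cost.

Clustering. Clients are scanned by increasing average connection cost, and a client becomes a center
unless an earlier center lies within 4 times its average. Facilities join their nearest center. By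
Markov's inequality every cluster has volume at least 1/2 (`half_le_vol`). The average distance from
clients to the centers of the clusters serving them is paid by 6 LP costs, that from facilities to
their centers by 5.

Candidates. In a cluster only facilities within 1 + 1/ε times the average distance of the served
demand are kept; they carry at least a 1/(1+ε) fraction of it (`sum_le_mul_sum_near`). Of these, the
max(1, ⌊volume⌋) of largest capacity become candidates and share the demand of the cluster in
proportion to capacity. The overload factor is 1 + ε in a sparse cluster (volume below 1) and 2(1 +
ε) otherwise, by the threshold argument of `sum_le_mul_cap`.

Closing. There may be more than k candidates, but the excess is at most the sum of 1 - volume over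
the sparse clusters. Since 2(1 - volume) ≤ 1 there, these weights form a fractional choice of sparse
clusters; hence the 2(#candidates - k) clusters cheapest to merge with their nearest other center
cost at most 24 LP costs together (`sum_sparse`, `sum_first_le`, `sum_half_le`). They are called
half-open: every two of them must save one facility.

Grouping. A maximal matching links half-open centers that point to each other or to the same center;
unmatched ones join the group of the center they point to. Every group is then a full center, a full
and a half-open one, or two or three half-open ones (`group_fiber`). Only the largest candidate of
one cluster per group survives, chosen by load, with full clusters counted at half their load. The
load of a group is at most 3 times the surviving load, and 3/2 times if the survivor is full. Both 3
· (1 + ε) and 3/2 · 2(1 + ε) equal 3 + 3ε. Merging costs at most 3 · 24 = 72, and the final step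
from centers to facilities 3 · 5(1 + 1/ε).

Machine. The algorithm is written in a language of array assignments with bounded sums, compiled
with a polynomial step count (`compList_exec`). No array is changed by an instruction after an
earlier one assigned or read it, so the final memory satisfies one equation per instruction
(`semList_eq`). The two recursive definitions, centers and greedy matching, are iterated until they
are stable (`semList_fix`). From these equations the lemmas on `Linked` recognize the arrays as the
objects of the analysis. -/

namespace ArrayLang

/-! ### Array expressions: semantics, compilation and running time. -/

open RealRAM Finset

/-- Ranges of loop variables: facilities, clients, or the single index `0`. -/
inductive Bd where
  | fac
  | cli
  | one

/-- The size of a range, as a function of the values of the integer variables. -/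
def Bd.val (ρ : ℕ → ℕ) : Bd → ℕ
  | .fac => ρ 0
  | .cli => ρ 1
  | .one => 1

/-- The size of a range as an index expression. -/
def Bd.exp : Bd → IExp
  | .fac => .get 0 (.const 0) (.const 0)
  | .cli => .get 1 (.const 0) (.const 0)
  | .one => .const 1

/-- Array expressions: real arithmetic, tests with values `0` and `1`, and bounded sums.
Variables are numbered by nesting depth. -/
inductive Ex where
  | const (q : ℚ)
  | get (a v w : ℕ)
  | num (v : ℕ)
  | add (e e' : Ex)
  | sub (e e' : Ex)
  | mul (e e' : Ex)
  | div (e e' : Ex)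
  | le (e e' : Ex)
  | sum (b : Bd) (e : Ex)

/-- The value of an array expression at depth `t`. -/
noncomputable def Ex.eval (A : ℕ → ℕ → ℕ → ℝ) : Ex → ℕ → (ℕ → ℕ) → ℝ
  | .const q, _, _ => (q : ℝ)
  | .get a v w, t, ρ => if a < 100 ∧ v < t ∧ w < t then A a (ρ v) (ρ w) else 0
  | .num v, t, ρ => if v < t then (ρ v : ℝ) else 0
  | .add e e', t, ρ => e.eval A t ρ + e'.eval A t ρ
  | .sub e e', t, ρ => e.eval A t ρ - e'.eval A t ρ
  | .mul e e', t, ρ => e.eval A t ρ * e'.eval A t ρ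
  | .div e e', t, ρ => e.eval A t ρ / e'.eval A t ρ
  | .le e e', t, ρ => open Classical in if e.eval A t ρ ≤ e'.eval A t ρ then 1 else 0
  | .sum b e, t, ρ => ∑ x ∈ range (b.val ρ), e.eval A (t + 1) (Function.update ρ t x)

/-- The index expression reading variable `v`. -/
def varE (v : ℕ) : IExp := .get v (.const 0) (.const 0)

/-- A counting loop with counter `ints v i 0`. -/
def forP (v i : ℕ) (b : IExp) (body : Prog) : Prog :=
  .seq (.setInt v (.const i) (.const 0) (.const 0))
    (.loop (.not (.intLe b (.get v (.const i) (.const 0))))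
      (.seq body (.setInt v (.const i) (.const 0)
        (.add (.get v (.const i) (.const 0)) (.const 1)))))

/-- The cell in which the value of a subexpression is kept. -/
def cellE (τ : ℕ) : RExp := .get 100 (.const τ) (.const 0)

/-- Assign to a scratch cell. -/
def setCell (τ : ℕ) (e : RExp) : Prog := .setReal 100 (.const τ) (.const 0) e

/-- The program evaluating an expression at depth `t` into the scratch cell `τ`. -/
def Ex.comp : Ex → ℕ → ℕ → Prog
  | .const q, _, τ => setCell τ (.const q)
  | .get a v w, t, τ =>
      if a < 100 ∧ v < t ∧ w < t then setCell τ (.get a (varE v) (varE w)) else setCell τ (.const 0)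
  | .num v, t, τ => if v < t then setCell τ (.ofInt (varE v)) else setCell τ (.const 0)
  | .add e e', t, τ => .seq (e.comp t τ) (.seq (e'.comp t (τ + 1))
      (setCell τ (.add (cellE τ) (cellE (τ + 1)))))
  | .sub e e', t, τ => .seq (e.comp t τ) (.seq (e'.comp t (τ + 1))
      (setCell τ (.sub (cellE τ) (cellE (τ + 1)))))
  | .mul e e', t, τ => .seq (e.comp t τ) (.seq (e'.comp t (τ + 1))
      (setCell τ (.mul (cellE τ) (cellE (τ + 1)))))
  | .div e e', t, τ => .seq (e.comp t τ) (.seq (e'.comp t (τ + 1))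
      (setCell τ (.div (cellE τ) (cellE (τ + 1)))))
  | .le e e', t, τ => .seq (e.comp t τ) (.seq (e'.comp t (τ + 1))
      (.branch (.realLe (cellE τ) (cellE (τ + 1))) (setCell τ (.const 1)) (setCell τ (.const 0))))
  | .sum b e, t, τ => .seq (setCell τ (.const 0))
      (forP t 0 b.exp (.seq (e.comp (t + 1) (τ + 1))
        (setCell τ (.add (cellE τ) (cellE (τ + 1))))))

/-- Time bound of a counting loop whose body takes time `T`. -/
noncomputable def forTime (T : Polynomial ℕ) : Polynomial ℕ := (.X + 1) * (T + 2) + 2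

/-- Time bound of the evaluation of an expression. -/
noncomputable def Ex.time : Ex → Polynomial ℕ
  | .const _ => 1
  | .get _ _ _ => 1
  | .num _ => 1
  | .add e e' => e.time + (e'.time + 1)
  | .sub e e' => e.time + (e'.time + 1)
  | .mul e e' => e.time + (e'.time + 1)
  | .div e e' => e.time + (e'.time + 1)
  | .le e e' => e.time + (e'.time + 2)
  | .sum _ e => 1 + forTime (e.time + 1)

/-- The memory `s` holds the arrays `A` and the variables `ρ` below depth `t`. -/
structure Holds (A : ℕ → ℕ → ℕ → ℝ) (ρ : ℕ → ℕ) (t : ℕ) (s : Memory) : Prop where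
  arr : ∀ a < 100, s.reals a = A a
  var : ∀ v < t, s.ints v 0 0 = ρ v

/-- `s'` differs from `s` only in scratch cells from `τ` on and variables from depth `t` on. -/
structure Frame (t τ : ℕ) (s s' : Memory) : Prop where
  reals : ∀ a x y, (a ≠ 100 ∨ x < τ) → s'.reals a x y = s.reals a x y
  ints : ∀ v i j, (v < t ∨ i ≠ 0) → s'.ints v i j = s.ints v i j

theorem Frame.trans {t τ : ℕ} {s s' s'' : Memory} (h : Frame t τ s s') (h' : Frame t τ s' s'') :
    Frame t τ s s'' :=
  ⟨fun a x y k => (h'.reals a x y k).trans (h.reals a x y k),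
   fun a x y k => (h'.ints a x y k).trans (h.ints a x y k)⟩

theorem Frame.mono {t τ t' τ' : ℕ} {s s' : Memory} (h : Frame t' τ' s s') (ht : t ≤ t')
    (hτ : τ ≤ τ') : Frame t τ s s' :=
  ⟨fun a x y k => h.reals a x y (by omega), fun a x y k => h.ints a x y (by omega)⟩

theorem Holds.frame {A : ℕ → ℕ → ℕ → ℝ} {ρ : ℕ → ℕ} {t τ : ℕ} {s s' : Memory}
    (h : Holds A ρ t s) (hf : Frame t τ s s') : Holds A ρ t s' :=
  ⟨fun a ha => by
    rw [← h.arr a ha]; funext x y; exact hf.reals a x y (Or.inl (by omega)),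
   fun v hv => by rw [← h.var v hv]; exact hf.ints v 0 0 (Or.inl hv)⟩

theorem Frame.setCell {t τ : ℕ} (s : Memory) (v : ℝ) : Frame t τ s (s.setReal 100 τ 0 v) := by
  constructor
  · intro a x y h
    simp only [Memory.setReal]
    rw [if_neg]; omega
  · intro a x y h; rfl

theorem Bd.exp_eval {A : ℕ → ℕ → ℕ → ℝ} {ρ : ℕ → ℕ} {t : ℕ} {s : Memory} (h : Holds A ρ t s)
    (ht : 2 ≤ t) (b : Bd) : b.exp.eval s = b.val ρ := by
  cases b
  · exact h.var 0 (by omega)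
  · exact h.var 1 (by omega)
  · rfl

theorem Bd.val_le (ρ : ℕ → ℕ) (b : Bd) : b.val ρ ≤ ρ 0 + ρ 1 + 1 := by
  cases b <;> simp [Bd.val] <;> omega

/-- Induction on the number of remaining rounds. The bound is evaluated anew at each test, so the
invariant must determine its value. A round costs the body, one increment and one test. -/
theorem loop_exec {v i : ℕ} {b : IExp} {body : Prog} {N T : ℕ} (Inv : ℕ → Memory → Prop)
    (hb : ∀ k s, Inv k s → b.eval s = N) (hc : ∀ k s, Inv k s → s.ints v i 0 = k)
    (hstep : ∀ k < N, ∀ s, Inv k s → ∃ s' t, Exec body s s' t ∧ t ≤ T ∧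
      Inv (k + 1) (s'.setInt v i 0 (s'.ints v i 0 + 1))) :
    ∀ r k s, k + r = N → Inv k s → ∃ s' t,
      Exec (.loop (.not (.intLe b (.get v (.const i) (.const 0))))
        (.seq body (.setInt v (.const i) (.const 0)
          (.add (.get v (.const i) (.const 0)) (.const 1))))) s s' t ∧
      t ≤ r * (T + 2) + 1 ∧ Inv N s' := by
  intro r
  induction r with
  | zero =>
    intro k s hk hs
    refine ⟨s, 1, Exec.loopFalse ?_, by omega, ?_⟩
    · simp only [Test.Holds, IExp.eval, not_not, hb k s hs, hc k s hs]; omega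
    · have : k = N := by omega
      exact this ▸ hs
  | succ r ih =>
    intro k s hk hs
    obtain ⟨s1, t1, he, ht, hi⟩ := hstep k (by omega) s hs
    obtain ⟨s2, t2, he2, ht2, hi2⟩ := ih (k + 1) _ (by omega) hi
    refine ⟨s2, _, Exec.loopTrue ?_ (Exec.seq he (Exec.setInt _ _ _ _ _)) he2, ?_, hi2⟩
    · simp only [Test.Holds, IExp.eval, hb k s hs, hc k s hs]; omega
    · rw [Nat.add_mul]; omega

/-- The slack in `N ≤ S + 1` accommodates the one-element range when there are no facilities and no
clients. -/
theorem forP_exec {v i : ℕ} {b : IExp} {body : Prog} {N S : ℕ} {T : Polynomial ℕ}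
    (hN : N ≤ S + 1) (Inv : ℕ → Memory → Prop)
    (hb : ∀ k s, Inv k s → b.eval s = N) (hc : ∀ k s, Inv k s → s.ints v i 0 = k)
    (hstep : ∀ k < N, ∀ s, Inv k s → ∃ s' t, Exec body s s' t ∧ t ≤ T.eval S ∧
      Inv (k + 1) (s'.setInt v i 0 (s'.ints v i 0 + 1)))
    (s : Memory) (h0 : Inv 0 (s.setInt v i 0 0)) :
    ∃ s' t, Exec (forP v i b body) s s' t ∧ t ≤ (forTime T).eval S ∧ Inv N s' := by
  obtain ⟨s', t, he, ht, hi⟩ := loop_exec Inv hb hc hstep N 0 _ (by omega) h0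
  refine ⟨s', _, Exec.seq (Exec.setInt _ _ _ _ _) he, ?_, hi⟩
  simp only [forTime, Polynomial.eval_add, Polynomial.eval_mul, Polynomial.eval_X,
    Polynomial.eval_one, Polynomial.eval_ofNat]
  have := Nat.mul_le_mul_right (T.eval S + 2) hN
  omega

/-- Scratch cells are used as a stack: the second operand touches only cells from `τ + 1` on, so the
first value survives in cell `τ`. -/
theorem binary_exec {A : ℕ → ℕ → ℕ → ℝ} {ρ : ℕ → ℕ} {t τ : ℕ} {s : Memory} {c c' d : Prog}
    {T T' : ℕ} {v v' v'' : ℝ} {q : ℕ}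
    (hs : Holds A ρ t s)
    (h : ∀ s, Holds A ρ t s → ∃ s' k, Exec c s s' k ∧ k ≤ T ∧ Frame t τ s s' ∧
      s'.reals 100 τ 0 = v)
    (h' : ∀ s, Holds A ρ t s → ∃ s' k, Exec c' s s' k ∧ k ≤ T' ∧ Frame t (τ + 1) s s' ∧
      s'.reals 100 (τ + 1) 0 = v')
    (hd : ∀ s : Memory, s.reals 100 τ 0 = v → s.reals 100 (τ + 1) 0 = v' →
      ∃ k, Exec d s (s.setReal 100 τ 0 v'') k ∧ k ≤ q) :
    ∃ s' k, Exec (.seq c (.seq c' d)) s s' k ∧ k ≤ T + (T' + q) ∧ Frame t τ s s' ∧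
      s'.reals 100 τ 0 = v'' := by
  obtain ⟨s1, t1, e1, b1, f1, r1⟩ := h s hs
  obtain ⟨s2, t2, e2, b2, f2, r2⟩ := h' s1 (hs.frame f1)
  obtain ⟨t3, e3, b3⟩ := hd s2 (by rw [f2.reals _ _ _ (Or.inr (by omega)), r1]) r2
  refine ⟨_, _, Exec.seq e1 (Exec.seq e2 e3), by omega,
    f1.trans ((f2.mono le_rfl (by omega)).trans (Frame.setCell _ _)), ?_⟩
  simp [Memory.setReal]

theorem setCell_exec (τ : ℕ) (e : RExp) (s : Memory) {v : ℝ} (h : e.eval s = v) :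
    Exec (setCell τ e) s (s.setReal 100 τ 0 v) 1 := by
  subst h; exact Exec.setReal _ _ _ _ _

/-- Structural induction. Depth at least 2 protects variables 0 and 1, which hold the sizes of the
ranges, from being used as loop counters. -/
theorem Ex.comp_exec {A : ℕ → ℕ → ℕ → ℝ} (e : Ex) : ∀ {ρ : ℕ → ℕ} {t : ℕ} (τ : ℕ), 2 ≤ t →
    ∀ s, Holds A ρ t s → ∃ s' k, Exec (e.comp t τ) s s' k ∧ k ≤ e.time.eval (ρ 0 + ρ 1) ∧
      Frame t τ s s' ∧ s'.reals 100 τ 0 = e.eval A t ρ := by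
  induction e with
  | const q =>
    intro ρ t τ ht s hs
    exact ⟨_, 1, setCell_exec _ _ _ rfl, by simp [Ex.time], Frame.setCell _ _,
      by simp [Memory.setReal, RExp.eval, Ex.eval]⟩
  | get a v w =>
    intro ρ t τ ht s hs
    by_cases h : a < 100 ∧ v < t ∧ w < t
    · refine ⟨_, 1, by rw [Ex.comp, if_pos h]; exact setCell_exec _ _ _ rfl, by simp [Ex.time],
        Frame.setCell _ _, ?_⟩
      simp [Memory.setReal, RExp.eval, Ex.eval, if_pos h, varE, IExp.eval, hs.var v h.2.1,
        hs.var w h.2.2, hs.arr a h.1]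
    · refine ⟨_, 1, by rw [Ex.comp, if_neg h]; exact setCell_exec _ _ _ rfl, by simp [Ex.time],
        Frame.setCell _ _, ?_⟩
      simp [Memory.setReal, RExp.eval, Ex.eval, if_neg h]
  | num v =>
    intro ρ t τ ht s hs
    by_cases h : v < t
    · refine ⟨_, 1, by rw [Ex.comp, if_pos h]; exact setCell_exec _ _ _ rfl, by simp [Ex.time],
        Frame.setCell _ _, ?_⟩
      simp [Memory.setReal, RExp.eval, Ex.eval, if_pos h, varE, IExp.eval, hs.var v h]
    · refine ⟨_, 1, by rw [Ex.comp, if_neg h]; exact setCell_exec _ _ _ rfl, by simp [Ex.time],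
        Frame.setCell _ _, ?_⟩
      simp [Memory.setReal, RExp.eval, Ex.eval, if_neg h]
  | add e e' ih ih' =>
    intro ρ t τ ht s hs
    simp only [Ex.time, Polynomial.eval_add, Polynomial.eval_one]
    exact binary_exec hs (ih τ ht) (ih' (τ + 1) ht) fun s h h' =>
      ⟨1, setCell_exec _ _ _ (by simp [RExp.eval, cellE, IExp.eval, h, h', Ex.eval]), le_rfl⟩
  | sub e e' ih ih' =>
    intro ρ t τ ht s hs
    simp only [Ex.time, Polynomial.eval_add, Polynomial.eval_one]
    exact binary_exec hs (ih τ ht) (ih' (τ + 1) ht) fun s h h' =>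
      ⟨1, setCell_exec _ _ _ (by simp [RExp.eval, cellE, IExp.eval, h, h', Ex.eval]), le_rfl⟩
  | mul e e' ih ih' =>
    intro ρ t τ ht s hs
    simp only [Ex.time, Polynomial.eval_add, Polynomial.eval_one]
    exact binary_exec hs (ih τ ht) (ih' (τ + 1) ht) fun s h h' =>
      ⟨1, setCell_exec _ _ _ (by simp [RExp.eval, cellE, IExp.eval, h, h', Ex.eval]), le_rfl⟩
  | div e e' ih ih' =>
    intro ρ t τ ht s hs
    simp only [Ex.time, Polynomial.eval_add, Polynomial.eval_one]
    exact binary_exec hs (ih τ ht) (ih' (τ + 1) ht) fun s h h' =>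
      ⟨1, setCell_exec _ _ _ (by simp [RExp.eval, cellE, IExp.eval, h, h', Ex.eval]), le_rfl⟩
  | le e e' ih ih' =>
    intro ρ t τ ht s hs
    simp only [Ex.time, Polynomial.eval_add, Polynomial.eval_ofNat]
    refine binary_exec hs (ih τ ht) (ih' (τ + 1) ht) fun s h h' => ⟨2, ?_, le_rfl⟩
    by_cases hle : e.eval A t ρ ≤ e'.eval A t ρ
    · exact Exec.branchTrue (by simpa [Test.Holds, RExp.eval, cellE, IExp.eval, h, h'] using hle)
        (setCell_exec _ _ _ (by simp [RExp.eval, Ex.eval, hle]))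
    · exact Exec.branchFalse (by simpa [Test.Holds, RExp.eval, cellE, IExp.eval, h, h'] using hle)
        (setCell_exec _ _ _ (by simp [RExp.eval, Ex.eval, hle]))
  | sum b e ih =>
    intro ρ t τ ht s hs
    -- Variable `t` is both counter and bound variable; cell `τ` accumulates the partial sum and
    -- cell `τ + 1` receives the summand.
    have hloop := forP_exec (v := t) (i := 0) (b := b.exp)
      (body := .seq (e.comp (t + 1) (τ + 1)) (setCell τ (.add (cellE τ) (cellE (τ + 1)))))
      (T := e.time + 1) (Bd.val_le ρ b)
      (fun k s' => Frame t τ s s' ∧ s'.ints t 0 0 = k ∧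
        s'.reals 100 τ 0 = ∑ x ∈ range k, e.eval A (t + 1) (Function.update ρ t x))
      (fun k s' h => Bd.exp_eval (hs.frame h.1) ht b) (fun k s' h => h.2.1)
      (fun k hk s' h => by
        obtain ⟨hf, hc, hv⟩ := h
        have hh : Holds A (Function.update ρ t k) (t + 1) s' := by
          refine ⟨(hs.frame hf).arr, fun v hv => ?_⟩
          rcases Nat.lt_succ_iff_lt_or_eq.mp hv with h | rfl
          · rw [Function.update_of_ne (by omega), (hs.frame hf).var v h]
          · rw [Function.update_self, hc]
        obtain ⟨s1, k1, e1, b1, f1, r1⟩ := ih (τ + 1) (by omega) s' hh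
        refine ⟨_, _, Exec.seq e1 (setCell_exec _ _ _ rfl), ?_, ?_, ?_, ?_⟩
        · rw [Function.update_of_ne (by omega), Function.update_of_ne (by omega)] at b1
          simp only [Polynomial.eval_add, Polynomial.eval_one]
          omega
        · refine hf.trans ((f1.mono (by omega) (by omega)).trans
            ((Frame.setCell _ _).trans ⟨fun _ _ _ _ => rfl, fun v i j h => ?_⟩))
          simp only [Memory.setInt]
          rw [if_neg]; omega
        · simp [Memory.setInt, Memory.setReal, f1.ints t 0 0 (by omega), hc]
        · simp [Memory.setInt, Memory.setReal, RExp.eval, cellE, IExp.eval,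
            r1, f1.reals 100 τ 0 (by omega), hv, sum_range_succ])
      (s.setReal 100 τ 0 0)
      ⟨(Frame.setCell _ _).trans ⟨fun _ _ _ _ => rfl, fun v i j h => by
          simp only [Memory.setInt]
          rw [if_neg]; omega⟩, by simp [Memory.setInt], by simp [Memory.setInt, Memory.setReal]⟩
    obtain ⟨s', k, he, hk, hf, -, hv⟩ := hloop
    refine ⟨s', _, Exec.seq (setCell_exec _ _ _ (by simp [RExp.eval])) he, ?_, hf, hv⟩
    simp only [Ex.time, Polynomial.eval_add, Polynomial.eval_one]
    omega

end ArrayLang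

/-! ### Simultaneous array assignments, their repetition, and lists of them. -/

namespace ArrayLang

open RealRAM Finset

/-- An instruction of the array language: replace the entries of array `a` in the ranges `b`, `b'`
simultaneously by the values of `e`, and do this `n ^ r` times for `n` clients. -/
structure Item where
  a : ℕ
  b : Bd
  b' : Bd
  r : ℕ
  e : Ex

/-- The environment with variables `4` and `5` set to `x` and `y`. -/
def env (ρ : ℕ → ℕ) (x y : ℕ) : ℕ → ℕ := Function.update (Function.update ρ 4 x) 5 y

/-- One simultaneous update. -/
noncomputable def Item.round (it : Item) (ρ : ℕ → ℕ) (A : ℕ → ℕ → ℕ → ℝ) : ℕ → ℕ → ℕ → ℝ :=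
  Function.update A it.a fun x y =>
    if x < it.b.val ρ ∧ y < it.b'.val ρ then it.e.eval A 6 (env ρ x y) else A it.a x y

/-- The effect of an instruction. -/
noncomputable def Item.sem (it : Item) (ρ : ℕ → ℕ) (A : ℕ → ℕ → ℕ → ℝ) : ℕ → ℕ → ℕ → ℝ :=
  (it.round ρ)^[ρ 1 ^ it.r] A

/-- Two nested counting loops. -/
def for2 (b b' : Bd) (body : Prog) : Prog := forP 4 0 b.exp (forP 5 0 b'.exp body)

/-- A simultaneous update, through the buffer array `101`. -/
def Item.compRound (it : Item) : Prog :=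
  .seq (for2 it.b it.b' (.seq (it.e.comp 6 0) (.setReal 101 (varE 4) (varE 5) (cellE 0))))
    (for2 it.b it.b' (.setReal it.a (varE 4) (varE 5) (.get 101 (varE 4) (varE 5))))

/-- Repeat a program `n ^ r` times. -/
def repP (c : Prog) : ℕ → Prog
  | 0 => c
  | r + 1 => forP r 1 Bd.cli.exp (repP c r)

/-- The program of an instruction. -/
def Item.comp (it : Item) : Prog := repP it.compRound it.r

/-- The program of a list of instructions. -/
def compList : List Item → Prog
  | [] => .skip
  | it :: l => .seq it.comp (compList l)

/-- Time bound of a simultaneous update. -/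
noncomputable def Item.roundTime (it : Item) : Polynomial ℕ :=
  forTime (forTime (it.e.time + 1)) + forTime (forTime 1)

/-- Time bound of a repeated program. -/
noncomputable def repTime (T : Polynomial ℕ) : ℕ → Polynomial ℕ
  | 0 => T
  | r + 1 => forTime (repTime T r)

/-- Time bound of a list of instructions. -/
noncomputable def listTime : List Item → Polynomial ℕ
  | [] => 1
  | it :: l => repTime it.roundTime it.r + listTime l

/-- The integer memory below row `0` is unchanged, and the variables are `ρ`. -/
structure Ints (ρ : ℕ → ℕ) (t : ℕ) (s₀ s : Memory) : Prop where
  var : ∀ v < t, s.ints v 0 0 = ρ v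
  row : ∀ v i j, i ≠ 0 → s.ints v i j = s₀.ints v i j

theorem Ints.bd {ρ : ℕ → ℕ} {t : ℕ} {s₀ s : Memory} (h : Ints ρ t s₀ s) (ht : 2 ≤ t) (b : Bd) :
    b.exp.eval s = b.val ρ :=
  Bd.exp_eval (A := s.reals) ⟨fun _ _ => rfl, h.var⟩ ht b

theorem Ints.setCounter {ρ : ℕ → ℕ} {t v c : ℕ} {s₀ s : Memory} (h : Ints ρ t s₀ s) (hv : t ≤ v) :
    Ints ρ t s₀ (s.setInt v 0 0 c) := by
  refine ⟨fun w hw => ?_, fun w i j hi => ?_⟩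
  · simp only [Memory.setInt]
    rw [if_neg (by omega)]; exact h.var w hw
  · simp only [Memory.setInt]
    rw [if_neg (by omega)]; exact h.row w i j hi

theorem Ints.update {ρ : ℕ → ℕ} {t x : ℕ} {s₀ s : Memory} (h : Ints ρ t s₀ s)
    (hx : s.ints t 0 0 = x) : Ints (Function.update ρ t x) (t + 1) s₀ s := by
  refine ⟨fun w hw => ?_, h.row⟩
  rcases Nat.lt_succ_iff_lt_or_eq.mp hw with h' | rfl
  · rw [Function.update_of_ne (by omega), h.var w h']
  · rw [Function.update_self, hx]

theorem Ints.down {ρ : ℕ → ℕ} {t x : ℕ} {s₀ s : Memory}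
    (h : Ints (Function.update ρ t x) (t + 1) s₀ s) : Ints ρ t s₀ s ∧ s.ints t 0 0 = x := by
  refine ⟨⟨fun w hw => ?_, h.row⟩, ?_⟩
  · rw [h.var w (by omega), Function.update_of_ne (by omega)]
  · rw [h.var t (by omega), Function.update_self]

/-- Integer bookkeeping is separated from the real memory: `P x y` need only describe the real
arrays when entry `(x, y)` is next in row-major order, and `hrow` passes from the end of a row to
the start of the next. -/
theorem for2_exec {b b' : Bd} {body : Prog} {T : Polynomial ℕ} {ρ : ℕ → ℕ}
    (P : ℕ → ℕ → (ℕ → ℕ → ℕ → ℝ) → Prop)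
    (hstep : ∀ x < b.val ρ, ∀ y < b'.val ρ, ∀ s₀ s, Ints (env ρ x y) 6 s₀ s → P x y s.reals →
      ∃ s' k, Exec body s s' k ∧ k ≤ T.eval (ρ 0 + ρ 1) ∧ Ints (env ρ x y) 6 s₀ s' ∧
        P x (y + 1) s'.reals)
    (hrow : ∀ x < b.val ρ, ∀ R, P x (b'.val ρ) R → P (x + 1) 0 R)
    (s₀ s : Memory) (hs : Ints ρ 4 s₀ s) (h0 : P 0 0 s.reals) :
    ∃ s' k, Exec (for2 b b' body) s s' k ∧ k ≤ (forTime (forTime T)).eval (ρ 0 + ρ 1) ∧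
      Ints ρ 4 s₀ s' ∧ P (b.val ρ) 0 s'.reals := by
  have outer := forP_exec (v := 4) (i := 0) (b := b.exp) (body := forP 5 0 b'.exp body)
    (T := forTime T) (Bd.val_le ρ b)
    (fun x s => Ints ρ 4 s₀ s ∧ s.ints 4 0 0 = x ∧ P x 0 s.reals)
    (fun k s h => h.1.bd (by omega) b) (fun k s h => h.2.1)
    (fun x hx s h => by
      obtain ⟨h1, h2, h3⟩ := h
      have inner := forP_exec (v := 5) (i := 0) (b := b'.exp) (body := body)
        (T := T) (Bd.val_le ρ b')
        (fun y s => Ints (Function.update ρ 4 x) 5 s₀ s ∧ s.ints 5 0 0 = y ∧ P x y s.reals)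
        (fun k s h => h.1.down.1.bd (by omega) b') (fun k s h => h.2.1)
        (fun y hy s h => by
          obtain ⟨h1, h2, h3⟩ := h
          obtain ⟨s', k, he, hk, hi, hp⟩ := hstep x hx y hy s₀ s (h1.update h2) h3
          refine ⟨s', k, he, hk, hi.down.1.setCounter le_rfl, ?_, hp⟩
          simp [Memory.setInt, hi.down.2])
        s ⟨(h1.update h2).setCounter le_rfl, by simp [Memory.setInt], h3⟩
      obtain ⟨s', k, he, hk, hi, -, hp⟩ := inner
      refine ⟨s', k, he, hk, hi.down.1.setCounter le_rfl, ?_, hrow x hx _ hp⟩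
      simp [Memory.setInt, hi.down.2])
    s ⟨hs.setCounter le_rfl, by simp [Memory.setInt], h0⟩
  obtain ⟨s', k, he, hk, hi, -, hp⟩ := outer
  exact ⟨s', k, he, hk, hi, hp⟩

/-- The expression may read the array being assigned. All new values are therefore collected in
buffer 101 while the old array is intact, and copied only afterwards. -/
theorem Item.compRound_exec (it : Item) (ha : it.a < 100) {A : ℕ → ℕ → ℕ → ℝ} {ρ : ℕ → ℕ}
    (s₀ s : Memory) (hs : Ints ρ 4 s₀ s) (hA : ∀ a < 100, s.reals a = A a) :
    ∃ s' k, Exec it.compRound s s' k ∧ k ≤ it.roundTime.eval (ρ 0 + ρ 1) ∧ Ints ρ 4 s₀ s' ∧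
      ∀ a < 100, s'.reals a = it.round ρ A a := by
  obtain ⟨s1, k1, e1, b1, i1, p1⟩ := for2_exec (b := it.b) (b' := it.b') (T := it.e.time + 1)
    (body := .seq (it.e.comp 6 0) (.setReal 101 (varE 4) (varE 5) (cellE 0))) (ρ := ρ)
    (fun x y R => (∀ a < 100, R a = A a) ∧ ∀ x' y', y' < it.b'.val ρ →
      (x' < x ∨ x' = x ∧ y' < y) → R 101 x' y' = it.e.eval A 6 (env ρ x' y'))
    (by
      intro x hx y hy s₀ s hi ⟨hR, hv⟩
      obtain ⟨s', k, he, hk, hf, hval⟩ := it.e.comp_exec (A := A) (ρ := env ρ x y) (t := 6) 0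
        (by omega) s ⟨hR, hi.var⟩
      have hi' : Ints (env ρ x y) 6 s₀ s' :=
        ⟨fun v hv => by rw [hf.ints v 0 0 (Or.inl hv), hi.var v hv],
          fun v i j h => by rw [hf.ints v i j (Or.inr h), hi.row v i j h]⟩
      refine ⟨_, _, Exec.seq he (Exec.setReal _ _ _ _ _), ?_, ⟨hi'.var, hi'.row⟩, ?_, ?_⟩
      · simp only [Polynomial.eval_add, Polynomial.eval_one]
        simp only [env, Function.update_of_ne (show (0 : ℕ) ≠ 5 by omega),
          Function.update_of_ne (show (0 : ℕ) ≠ 4 by omega),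
          Function.update_of_ne (show (1 : ℕ) ≠ 5 by omega),
          Function.update_of_ne (show (1 : ℕ) ≠ 4 by omega)] at hk
        omega
      · intro a ha
        funext x' y'
        simp only [Memory.setReal]
        rw [if_neg (by omega), hf.reals _ _ _ (Or.inl (by omega)), hR a ha]
      · intro x' y' hy' h
        have h4 : (varE 4).eval s' = x := by simp [varE, IExp.eval, hi'.var 4, env]
        have h5 : (varE 5).eval s' = y := by simp [varE, IExp.eval, hi'.var 5, env]
        simp only [Memory.setReal, h4, h5]
        split_ifs with hc
        · obtain ⟨-, rfl, rfl⟩ := hc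
          simp [RExp.eval, cellE, IExp.eval, hval]
        · have hc' : ¬(x' = x ∧ y' = y) := by tauto
          rw [hf.reals _ _ _ (Or.inl (by omega)), hv x' y' hy' (by omega)])
    (by
      intro x hx R ⟨hR, hv⟩
      exact ⟨hR, fun x' y' hy' h => hv x' y' hy' (by omega)⟩)
    s₀ s hs ⟨hA, fun x' y' _ h => by omega⟩
  obtain ⟨s2, k2, e2, b2, i2, p2⟩ := for2_exec (b := it.b) (b' := it.b') (T := 1)
    (body := .setReal it.a (varE 4) (varE 5) (.get 101 (varE 4) (varE 5))) (ρ := ρ)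
    (fun x y R => (∀ a < 100, a ≠ it.a → R a = A a) ∧ (∀ x' y', x' < it.b.val ρ →
      y' < it.b'.val ρ → R 101 x' y' = it.e.eval A 6 (env ρ x' y')) ∧
      ∀ x' y', R it.a x' y' = if (x' < x ∨ x' = x ∧ y' < y) ∧ y' < it.b'.val ρ then
        it.e.eval A 6 (env ρ x' y') else A it.a x' y')
    (by
      intro x hx y hy s₀ s hi ⟨hR, hv, hw⟩
      have h4 : (varE 4).eval s = x := by simp [varE, IExp.eval, hi.var 4, env]
      have h5 : (varE 5).eval s = y := by simp [varE, IExp.eval, hi.var 5, env]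
      refine ⟨_, _, Exec.setReal _ _ _ _ _, by simp, ⟨hi.var, hi.row⟩, ?_, ?_, ?_⟩
      · intro a ha hne
        funext x' y'
        simp only [Memory.setReal]
        rw [if_neg (by tauto), hR a ha hne]
      · intro x' y' hx' hy'
        simp only [Memory.setReal]
        rw [if_neg (by omega), hv x' y' hx' hy']
      · intro x' y'
        simp only [Memory.setReal, h4, h5, RExp.eval, hv x y hx hy, hw x' y', true_and]
        by_cases hc : x' = x ∧ y' = y
        · obtain ⟨rfl, rfl⟩ := hc
          rw [if_pos ⟨rfl, rfl⟩, if_pos (by omega)]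
        · rw [if_neg hc]
          by_cases hd : (x' < x ∨ x' = x ∧ y' < y) ∧ y' < it.b'.val ρ
          · rw [if_pos hd, if_pos (by omega)]
          · rw [if_neg hd, if_neg (by omega)])
    (by
      intro x hx R ⟨hR, hv, hw⟩
      refine ⟨hR, hv, fun x' y' => ?_⟩
      rw [hw]
      congr 1
      apply propext
      omega)
    s₀ s1 i1 ⟨fun a ha _ => p1.1 a ha, fun x' y' hx' hy' => p1.2 x' y' hy' (Or.inl hx'),
      fun x' y' => by rw [if_neg (by omega), p1.1 _ ha]⟩
  refine ⟨s2, _, Exec.seq e1 e2, ?_, i2, ?_⟩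
  · simp only [Item.roundTime, Polynomial.eval_add]; omega
  · intro a ha'
    by_cases h : a = it.a
    · subst h
      funext x' y'
      rw [p2.2.2, Item.round, Function.update_self]
      congr 1
      apply propext
      omega
    · rw [p2.1 a ha' h, Item.round, Function.update_of_ne h]

/-- Integer memory unchanged in the variables and in the counters from `r` on. -/
structure Keep (r : ℕ) (s s' : Memory) : Prop where
  var : ∀ v < 4, s'.ints v 0 0 = s.ints v 0 0
  cnt : ∀ v, r ≤ v → s'.ints v 1 0 = s.ints v 1 0

/-- The repetition counters live in row 1 of the integer arrays, which expressions and entry loops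
never touch; the repetition at level `r` uses index `r`, and those nested in it use smaller indices.
-/
theorem repP_exec {c : Prog} {T : Polynomial ℕ} {ρ : ℕ → ℕ}
    {Φ : (ℕ → ℕ → ℕ → ℝ) → (ℕ → ℕ → ℕ → ℝ)}
    (hstep : ∀ A s, Holds A ρ 4 s → ∃ s' k, Exec c s s' k ∧ k ≤ T.eval (ρ 0 + ρ 1) ∧
      Holds (Φ A) ρ 4 s' ∧ Keep 0 s s') :
    ∀ r A s, Holds A ρ 4 s → ∃ s' k, Exec (repP c r) s s' k ∧
      k ≤ (repTime T r).eval (ρ 0 + ρ 1) ∧ Holds (Φ^[ρ 1 ^ r] A) ρ 4 s' ∧ Keep r s s' := by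
  intro r
  induction r with
  | zero => simpa [repP, repTime] using hstep
  | succ r ih =>
    intro A s hs
    obtain ⟨s', k, he, hk, hh, hc, hkeep⟩ := forP_exec (v := r) (i := 1) (b := Bd.cli.exp)
      (body := repP c r) (T := repTime T r) (Bd.val_le ρ .cli)
      (fun k s' => Holds (Φ^[ρ 1 ^ r * k] A) ρ 4 s' ∧ s'.ints r 1 0 = k ∧ Keep (r + 1) s s')
      (fun k s h => Bd.exp_eval h.1 (by omega) _) (fun k s h => h.2.1)
      (fun k hk s1 h => by
        obtain ⟨h1, h2, h3⟩ := h
        obtain ⟨s', t, he, ht, hh, hkeep⟩ := ih _ s1 h1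
        refine ⟨s', t, he, ht, ⟨?_, ?_⟩, ?_, ?_, ?_⟩
        · rw [← Function.iterate_add_apply] at hh
          have : ρ 1 ^ r * (k + 1) = ρ 1 ^ r + ρ 1 ^ r * k := by ring
          rw [this]
          exact hh.arr
        · intro v hv
          simp only [Memory.setInt]
          rw [if_neg (by omega), hh.var v hv]
        · simp [Memory.setInt, hkeep.cnt r le_rfl, h2]
        · intro v hv
          simp only [Memory.setInt]
          rw [if_neg (by omega), hkeep.var v hv, h3.var v hv]
        · intro v hv
          simp only [Memory.setInt]
          rw [if_neg (by omega), hkeep.cnt v (by omega), h3.cnt v hv])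
      s ⟨⟨by simpa [Memory.setInt] using hs.arr, fun v hv => by
          simp only [Memory.setInt]
          rw [if_neg (by omega), hs.var v hv]⟩, by simp [Memory.setInt],
        fun v hv => by
          simp only [Memory.setInt]
          rw [if_neg (by omega)],
        fun v hv => by
          simp only [Memory.setInt]
          rw [if_neg (by omega)]⟩
    exact ⟨s', k, he, hk, by simpa [Bd.val, pow_succ] using hh, hkeep⟩

theorem Item.comp_exec (it : Item) (ha : it.a < 100) {A : ℕ → ℕ → ℕ → ℝ} {ρ : ℕ → ℕ}
    (s : Memory) (hs : Holds A ρ 4 s) :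
    ∃ s' k, Exec it.comp s s' k ∧ k ≤ (repTime it.roundTime it.r).eval (ρ 0 + ρ 1) ∧
      Holds (it.sem ρ A) ρ 4 s' := by
  obtain ⟨s', k, he, hk, hh, -⟩ := repP_exec (c := it.compRound) (T := it.roundTime) (ρ := ρ)
    (Φ := it.round ρ) (fun A s hs => by
      obtain ⟨s', k, he, hk, hi, hr⟩ := it.compRound_exec ha (A := A) s s
        ⟨hs.var, fun _ _ _ _ => rfl⟩ hs.arr
      exact ⟨s', k, he, hk, ⟨hr, hi.var⟩, fun v hv => by rw [hi.var v hv, hs.var v hv],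
        fun v hv => hi.row v 1 0 (by omega)⟩) it.r A s hs
  exact ⟨s', k, he, hk, hh⟩

/-- The effect of a list of instructions. -/
noncomputable def semList (ρ : ℕ → ℕ) : List Item → (ℕ → ℕ → ℕ → ℝ) → (ℕ → ℕ → ℕ → ℝ)
  | [], A => A
  | it :: l, A => semList ρ l (it.sem ρ A)

theorem compList_exec {ρ : ℕ → ℕ} (l : List Item) (hl : ∀ it ∈ l, it.a < 100) :
    ∀ (A : ℕ → ℕ → ℕ → ℝ) (s : Memory), Holds A ρ 4 s → ∃ s' k, Exec (compList l) s s' k ∧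
      k ≤ (listTime l).eval (ρ 0 + ρ 1) ∧ Holds (semList ρ l A) ρ 4 s' := by
  induction l with
  | nil => intro A s hs; exact ⟨s, 1, Exec.skip s, by simp [listTime], hs⟩
  | cons it l ih =>
    intro A s hs
    obtain ⟨s1, k1, e1, b1, h1⟩ := it.comp_exec (hl it (by simp)) s hs
    obtain ⟨s2, k2, e2, b2, h2⟩ := ih (fun i hi => hl i (by simp [hi])) _ s1 h1
    refine ⟨s2, _, Exec.seq e1 e2, ?_, h2⟩
    simp only [listTime, Polynomial.eval_add]; omega

/-! ### Lists in which every array is assigned once -/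

/-- The arrays that an expression reads. -/
def Ex.reads : Ex → List ℕ
  | .const _ => []
  | .get a _ _ => [a]
  | .num _ => []
  | .add e e' => e.reads ++ e'.reads
  | .sub e e' => e.reads ++ e'.reads
  | .mul e e' => e.reads ++ e'.reads
  | .div e e' => e.reads ++ e'.reads
  | .le e e' => e.reads ++ e'.reads
  | .sum _ e => e.reads

theorem Ex.eval_congr {A A' : ℕ → ℕ → ℕ → ℝ} (e : Ex) : ∀ (t : ℕ) (ρ : ℕ → ℕ),
    (∀ a ∈ e.reads, A a = A' a) → e.eval A t ρ = e.eval A' t ρ := by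
  induction e with
  | const q => intro t ρ h; rfl
  | num v => intro t ρ h; rfl
  | get a v w => intro t ρ h; simp only [Ex.eval, h a (by simp [Ex.reads])]
  | sum b e ih =>
    intro t ρ h
    exact sum_congr rfl fun x _ => ih _ _ h
  | add e e' ih ih' | sub e e' ih ih' | mul e e' ih ih' | div e e' ih ih' | le e e' ih ih' =>
    intro t ρ h
    simp only [Ex.reads, List.mem_append] at h
    simp only [Ex.eval, ih t ρ fun a ha => h a (Or.inl ha), ih' t ρ fun a ha => h a (Or.inr ha)]

theorem Item.round_of_ne (it : Item) {ρ : ℕ → ℕ} {A : ℕ → ℕ → ℕ → ℝ} {a : ℕ} (h : a ≠ it.a) :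
    it.round ρ A a = A a := Function.update_of_ne h _ _

theorem Item.iterate_of_ne (it : Item) {ρ : ℕ → ℕ} {A : ℕ → ℕ → ℕ → ℝ} {a : ℕ} (h : a ≠ it.a)
    (k : ℕ) : (it.round ρ)^[k] A a = A a := by
  induction k with
  | zero => rfl
  | succ k ih => rw [Function.iterate_succ_apply', it.round_of_ne h, ih]

theorem semList_of_not_mem {ρ : ℕ → ℕ} {a : ℕ} : ∀ (l : List Item) (A : ℕ → ℕ → ℕ → ℝ),
    (∀ it ∈ l, it.a ≠ a) → semList ρ l A a = A a
  | [], _, _ => rfl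
  | it :: l, A, h => by
    rw [semList, semList_of_not_mem l _ fun i hi => h i (by simp [hi])]
    exact it.iterate_of_ne (fun h' => h it (by simp) h'.symm) _

/-- No instruction assigns an array that an earlier one assigns or reads. -/
def SSA (l : List Item) : Prop :=
  l.Pairwise fun it it' => it'.a ≠ it.a ∧ it'.a ∉ it.e.reads

/-- Neither the assigned array nor the arrays it was computed from change later, so an assignment
executed once remains true as an equation between the final arrays. The order of execution can then
be forgotten. -/
theorem semList_eq {ρ : ℕ → ℕ} : ∀ (l : List Item) (A : ℕ → ℕ → ℕ → ℝ), SSA l →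
    ∀ it ∈ l, it.r = 0 → it.a ∉ it.e.reads → ∀ x < it.b.val ρ, ∀ y < it.b'.val ρ,
      semList ρ l A it.a x y = it.e.eval (semList ρ l A) 6 (env ρ x y)
  | [], _, _, _, hit, _, _ => by simp at hit
  | i :: l, A, hl, it, hit, hr, ha => by
    intro x hx y hy
    rw [SSA, List.pairwise_cons] at hl
    rcases List.mem_cons.mp hit with rfl | hmem
    · rw [semList, semList_of_not_mem l _ fun i hi => (hl.1 i hi).1]
      have h1 : it.sem ρ A = it.round ρ A := by simp [Item.sem, hr]
      rw [h1]
      conv_lhs => rw [Item.round, Function.update_self, if_pos ⟨hx, hy⟩]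
      refine Ex.eval_congr _ _ _ fun a' ha' => ?_
      rw [semList_of_not_mem l _ fun i hi h => (hl.1 i hi).2 (h ▸ ha'),
        it.round_of_ne fun h => ha (h ▸ ha')]
    · exact semList_eq l _ hl.2 it hmem hr ha x hx y hy

/-- An iterated assignment in which every entry depends only on entries of lower rank reaches
a fixed point. -/
theorem semList_fix {ρ : ℕ → ℕ} (rank : ℕ → ℕ → ℕ) : ∀ (l : List Item) (A : ℕ → ℕ → ℕ → ℝ), SSA l →
    ∀ it ∈ l, (∀ x < it.b.val ρ, ∀ y < it.b'.val ρ, rank x y < ρ 1 ^ it.r) →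
    (∀ B B' : ℕ → ℕ → ℕ → ℝ, (∀ a ∈ it.e.reads, a ≠ it.a → B a = semList ρ l A a) →
      (∀ a ∈ it.e.reads, a ≠ it.a → B' a = semList ρ l A a) →
      ∀ x < it.b.val ρ, ∀ y < it.b'.val ρ,
      (∀ x' < it.b.val ρ, ∀ y' < it.b'.val ρ, rank x' y' < rank x y → B it.a x' y' = B' it.a x' y') →
      it.e.eval B 6 (env ρ x y) = it.e.eval B' 6 (env ρ x y)) →
    ∀ x < it.b.val ρ, ∀ y < it.b'.val ρ,
      semList ρ l A it.a x y = it.e.eval (semList ρ l A) 6 (env ρ x y)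
  | [], _, _, _, hit, _, _ => by simp at hit
  | i :: l, A, hl, it, hit, hr, hdep => by
    intro x hx y hy
    rw [SSA, List.pairwise_cons] at hl
    rcases List.mem_cons.mp hit with rfl | hmem
    · have hread : ∀ k, ∀ a ∈ it.e.reads, a ≠ it.a →
          (it.round ρ)^[k] A a = semList ρ (it :: l) A a := by
        intro k a ha hne
        rw [semList, semList_of_not_mem l _ fun i hi h => (hl.1 i hi).2 (h ▸ ha), Item.sem,
          it.iterate_of_ne hne, it.iterate_of_ne hne]
      have hone : ∀ k, ∀ x < it.b.val ρ, ∀ y < it.b'.val ρ, (it.round ρ)^[k + 1] A it.a x y =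
          it.e.eval ((it.round ρ)^[k] A) 6 (env ρ x y) := by
        intro k x hx y hy
        rw [Function.iterate_succ_apply', Item.round, Function.update_self, if_pos ⟨hx, hy⟩]
      -- After `k` rounds all entries of rank below `k` have settled, whatever the initial contents;
      -- the number of rounds exceeds every rank.
      have key : ∀ k, ∀ x < it.b.val ρ, ∀ y < it.b'.val ρ, rank x y < k →
          (it.round ρ)^[k + 1] A it.a x y = (it.round ρ)^[k] A it.a x y := by
        intro k
        induction k with
        | zero => intro x _ y _ h; omega
        | succ k ih =>
          intro x hx y hy h
          rw [hone (k + 1) x hx y hy, hone k x hx y hy]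
          exact hdep _ _ (hread _) (hread _) x hx y hy fun x' hx' y' hy' h' =>
            ih x' hx' y' hy' (by omega)
      have hfin : semList ρ (it :: l) A it.a = (it.round ρ)^[ρ 1 ^ it.r] A it.a := by
        rw [semList, semList_of_not_mem l _ fun i hi => (hl.1 i hi).1, Item.sem]
      rw [hfin, ← key _ x hx y hy (hr x hx y hy), hone _ x hx y hy]
      refine Ex.eval_congr _ _ _ fun a ha => ?_
      by_cases hne : a = it.a
      · rw [hne, hfin]
      · exact hread _ a ha hne
    · exact semList_fix rank l _ hl.2 it hmem hr hdep x hx y hy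

end ArrayLang

open Finset

/-! ### Selection by a key with ties broken by the index -/

section Order

variable {α : Type} [LinearOrder α]

/-- `a` precedes `b` in the order by key, ties being broken by the index. -/
def Bef (key : α → ℝ) (a b : α) : Prop := toLex (key a, a) < toLex (key b, b)

theorem bef_iff {key : α → ℝ} {a b : α} :
    Bef key a b ↔ key a < key b ∨ key a = key b ∧ a < b := Prod.Lex.toLex_lt_toLex

theorem Bef.le {key : α → ℝ} {a b : α} (h : Bef key a b) : key a ≤ key b := by
  rcases bef_iff.mp h with h | h
  · exact h.le
  · exact h.1.le

theorem le_of_not_bef {key : α → ℝ} {a b : α} (h : ¬ Bef key a b) : key b ≤ key a := by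
  rw [bef_iff] at h
  by_contra! hlt
  exact h (Or.inl hlt)

theorem Bef.trans {key : α → ℝ} {a b c : α} (h : Bef key a b) (h' : Bef key b c) : Bef key a c :=
  lt_trans (a := toLex (key a, a)) h h'

theorem not_bef_self {key : α → ℝ} {a : α} : ¬ Bef key a a := lt_irrefl (toLex (key a, a))

theorem bef_or_bef {key : α → ℝ} {a b : α} (h : a ≠ b) : Bef key a b ∨ Bef key b a := by
  apply lt_or_gt_of_ne
  intro h'
  exact h (congrArg (fun p => (ofLex p).2) h')

/-- The set of first elements: those of `s` with no element of `s` before them. -/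
theorem exists_first (key : α → ℝ) {s : Finset α} (hs : s.Nonempty) :
    ∃ a ∈ s, ∀ b ∈ s, ¬ Bef key b a := by
  obtain ⟨a, ha, h⟩ := s.exists_min_image (fun a => toLex (key a, a)) hs
  exact ⟨a, ha, fun b hb => not_lt.mpr (h b hb)⟩

open Classical in
/-- The number of elements of `s` before `a`. -/
noncomputable def rk (key : α → ℝ) (s : Finset α) (a : α) : ℕ := #{b ∈ s | Bef key b a}

theorem rk_lt_rk {key : α → ℝ} {s : Finset α} {a b : α} (ha : a ∈ s) (h : Bef key a b) :
    rk key s a < rk key s b := by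
  classical
  refine card_lt_card ⟨fun c hc => ?_, fun hsub => ?_⟩
  · simp only [mem_filter] at hc ⊢
    exact ⟨hc.1, hc.2.trans h⟩
  · have := hsub (mem_filter.mpr ⟨ha, h⟩)
    exact not_bef_self (mem_filter.mp this).2

theorem rk_lt_card {key : α → ℝ} {s : Finset α} {a : α} (ha : a ∈ s) : rk key s a < #s := by
  classical
  refine card_lt_card ⟨filter_subset _ _, fun hsub => ?_⟩
  exact not_bef_self (mem_filter.mp (hsub ha)).2

theorem rk_injOn (key : α → ℝ) (s : Finset α) : Set.InjOn (rk key s) s := by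
  intro a ha b hb h
  by_contra hne
  rcases bef_or_bef (key := key) hne with h' | h'
  · exact (rk_lt_rk ha h').ne h
  · exact (rk_lt_rk hb h').ne h.symm

/-- Breaking ties makes ranks injective, and they are all below `#s`, so they fill the whole range.
This is why selecting by rank yields exact counts. -/
theorem image_rk (key : α → ℝ) (s : Finset α) : s.image (rk key s) = range #s := by
  apply eq_of_subset_of_card_le
  · intro r hr
    obtain ⟨a, ha, rfl⟩ := mem_image.mp hr
    exact mem_range.mpr (rk_lt_card ha)
  · rw [card_range, card_image_of_injOn (rk_injOn key s)]

theorem card_rk_lt (key : α → ℝ) (s : Finset α) (M : ℕ) :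
    #{a ∈ s | rk key s a < M} = min M #s := by
  rw [← card_image_of_injOn ((rk_injOn key s).mono fun a ha => (mem_filter.mp ha).1), ← filter_image (p := fun r => r < M),
    image_rk]
  have : (range #s).filter (fun r => r < M) = range (min M #s) := by
    ext r; simp; omega
  rw [this, card_range]

theorem key_le_of_rk {key : α → ℝ} {s : Finset α} {M : ℕ} {a b : α} (ha : a ∈ s)
    (hM : rk key s b < M) (hM' : M ≤ rk key s a) : key b ≤ key a := by
  apply le_of_not_bef
  intro h
  have := rk_lt_rk ha h
  omega

theorem rk_eq_zero {key : α → ℝ} {s : Finset α} {a : α} :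
    rk key s a = 0 ↔ ∀ b ∈ s, ¬ Bef key b a := by
  classical
  simp [rk, filter_eq_empty_iff]

end Order

/-! ### Clustering -/

namespace CapMedian

variable {F C : Type}

/-- The distance between two clients. -/
def cc (I : CapMedian F C) (j j' : C) : ℝ := I.dist (Sum.inl j) (Sum.inl j')

theorem dist_nonneg (I : CapMedian F C) (p q : C ⊕ F) : 0 ≤ I.dist p q := by
  have h := I.dist_triangle p q p
  rw [I.dist_self, I.dist_comm q p] at h
  linarith

theorem d_nonneg (I : CapMedian F C) (i : F) (j : C) : 0 ≤ I.d i j := I.dist_nonneg _ _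

theorem cc_nonneg (I : CapMedian F C) (j j' : C) : 0 ≤ I.cc j j' := I.dist_nonneg _ _

theorem cc_comm (I : CapMedian F C) (j j' : C) : I.cc j j' = I.cc j' j := I.dist_comm _ _

theorem cc_triangle (I : CapMedian F C) (a b c : C) : I.cc a c ≤ I.cc a b + I.cc b c :=
  I.dist_triangle _ _ _

theorem d_le_d_add_cc (I : CapMedian F C) (i : F) (a b : C) : I.d i b ≤ I.d i a + I.cc a b :=
  I.dist_triangle _ _ _

theorem cc_le_d_add_d (I : CapMedian F C) (i : F) (a b : C) : I.cc a b ≤ I.d i a + I.d i b := by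
  have := I.dist_triangle (Sum.inl a) (Sum.inr i) (Sum.inl b)
  rw [I.dist_comm (Sum.inl a) (Sum.inr i)] at this
  exact this

/-- The average connection cost of a client. -/
noncomputable def dav [Fintype F] (I : CapMedian F C) (x : F → C → ℝ) (j : C) : ℝ :=
  ∑ i, I.d i j * x i j

/-- A clustering: centers `Z` that are far apart and cover all clients, and an assignment of the
facilities to nearest centers. -/
structure IsClustering [Fintype F] (I : CapMedian F C) (x : F → C → ℝ) (Z : Finset C)
    (cl : F → C) : Prop where
  far : ∀ j ∈ Z, ∀ j' ∈ Z, j ≠ j' → 4 * I.dav x j < I.cc j j'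
  cover : ∀ j, ∃ j' ∈ Z, I.cc j j' ≤ 4 * I.dav x j
  mem : ∀ i, cl i ∈ Z
  near : ∀ i, ∀ j ∈ Z, I.d i (cl i) ≤ I.d i j

/-- The part of the demand of client `c` that is served in the cluster of `j`. -/
def part [Fintype F] [DecidableEq C] (x : F → C → ℝ) (cl : F → C) (j c : C) : ℝ :=
  ∑ i, if cl i = j then x i c else 0

/-- The opening in the cluster of `j`. -/
def vol [Fintype F] [DecidableEq C] (y : F → ℝ) (cl : F → C) (j : C) : ℝ :=
  ∑ i, if cl i = j then y i else 0

/-- The demand served in the cluster of `j`. -/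
def dem [Fintype F] [Fintype C] [DecidableEq C] (x : F → C → ℝ) (cl : F → C) (j : C) : ℝ :=
  ∑ c, part x cl j c

/-- The cost of moving the demand served in the cluster of `j` to `j`. -/
def mov [Fintype F] [Fintype C] [DecidableEq C] (I : CapMedian F C) (x : F → C → ℝ)
    (cl : F → C) (j : C) : ℝ :=
  ∑ i, if cl i = j then I.d i j * ∑ c, x i c else 0

theorem sum_part_mul [Fintype F] [Fintype C] [DecidableEq C] (x : F → C → ℝ) (cl : F → C)
    (φ : C → ℝ) (c : C) : ∑ j, part x cl j c * φ j = ∑ i, x i c * φ (cl i) := by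
  simp only [part, sum_mul]
  rw [sum_comm]
  refine sum_congr rfl fun i _ => ?_
  simp only [ite_mul, zero_mul]
  rw [sum_ite_eq]; simp

section

set_option linter.unusedSectionVars false

variable [Fintype F] [Fintype C] {I : CapMedian F C} {x : F → C → ℝ} {y : F → ℝ}
  {Z : Finset C} {cl : F → C}

theorem dav_nonneg (hx : I.Feasible 1 x y) (j : C) : 0 ≤ I.dav x j :=
  sum_nonneg fun i _ => mul_nonneg (I.d_nonneg i j) (hx.x_nonneg i j)

theorem sum_dav (I : CapMedian F C) (x : F → C → ℝ) : ∑ j, I.dav x j = I.cost x := by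
  simp only [dav, cost]; exact sum_comm

/-- Client `c` has a center within 4 times its average cost, and the center of `i` is no farther
from `i` than that one. -/
theorem d_cl_le (hc : I.IsClustering x Z cl) (i : F) (c : C) :
    I.d i (cl i) ≤ I.d i c + 4 * I.dav x c := by
  obtain ⟨j, hj, h⟩ := hc.cover c
  linarith [hc.near i j hj, I.d_le_d_add_cc i c j]

theorem sum_x_mul_dav (hx : I.Feasible 1 x y) :
    ∑ i, ∑ c, x i c * I.dav x c = I.cost x := by
  rw [sum_comm, ← sum_dav]
  refine sum_congr rfl fun c _ => ?_
  rw [← sum_mul, hx.served c, one_mul]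

theorem sum_x_mul_d (I : CapMedian F C) (x : F → C → ℝ) : ∑ i, ∑ c, x i c * I.d i c = I.cost x := by
  simp only [cost, mul_comm]

theorem cost_nonneg (hx : I.Feasible 1 x y) : 0 ≤ I.cost x :=
  sum_nonneg fun i _ => sum_nonneg fun j _ => mul_nonneg (I.d_nonneg i j) (hx.x_nonneg i j)

variable [DecidableEq C]

theorem part_nonneg (hx : I.Feasible 1 x y) (cl : F → C) (j c : C) : 0 ≤ part x cl j c :=
  sum_nonneg fun i _ => by split_ifs; exacts [hx.x_nonneg i c, le_rfl]

theorem part_le_vol (hx : I.Feasible 1 x y) (cl : F → C) (j c : C) :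
    part x cl j c ≤ vol y cl j :=
  sum_le_sum fun i _ => by split_ifs; exacts [hx.assign_le i c, le_rfl]

theorem sum_part (hx : I.Feasible 1 x y) (cl : F → C) (c : C) : ∑ j, part x cl j c = 1 := by
  have := sum_part_mul x cl (fun _ => 1) c
  simpa [hx.served c] using this

theorem part_eq_zero (hc : I.IsClustering x Z cl) {j : C} (hj : j ∉ Z) (c : C) :
    part x cl j c = 0 :=
  sum_eq_zero fun i _ => by
    rw [if_neg]; rintro rfl; exact hj (hc.mem i)

theorem dem_nonneg (hx : I.Feasible 1 x y) (cl : F → C) (j : C) : 0 ≤ dem x cl j :=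
  sum_nonneg fun c _ => part_nonneg hx cl j c

theorem dem_eq (x : F → C → ℝ) (cl : F → C) (j : C) :
    dem x cl j = ∑ i, if cl i = j then ∑ c, x i c else 0 := by
  simp only [dem, part]
  rw [sum_comm]
  refine sum_congr rfl fun i _ => ?_
  split_ifs <;> simp

theorem mov_nonneg (hx : I.Feasible 1 x y) (cl : F → C) (j : C) : 0 ≤ I.mov x cl j :=
  sum_nonneg fun i _ => by
    split_ifs
    · exact mul_nonneg (I.d_nonneg i j) (sum_nonneg fun c _ => hx.x_nonneg i c)
    · exact le_rfl

theorem sum_vol (y : F → ℝ) (cl : F → C) : ∑ j, vol y cl j = ∑ i, y i := by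
  simp only [vol]
  rw [sum_comm]
  simp

theorem vol_eq_zero (hc : I.IsClustering x Z cl) {j : C} (hj : j ∉ Z) : vol y cl j = 0 :=
  sum_eq_zero fun i _ => by
    rw [if_neg]; rintro rfl; exact hj (hc.mem i)

/-- For facility `i` serving `c`, passing through `i` gives distance at most `2 d(i,c) + 4 dav(c)`
from its center to `c`. Weighted by `x`, the two terms contribute 2 and 4 LP costs. -/
theorem sum_part_mul_cc (hx : I.Feasible 1 x y) (hc : I.IsClustering x Z cl) :
    ∑ c, ∑ j, part x cl j c * I.cc j c ≤ 6 * I.cost x := by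
  have h : ∀ c, ∑ j, part x cl j c * I.cc j c ≤ ∑ i, (2 * (x i c * I.d i c) +
      4 * (x i c * I.dav x c)) := by
    intro c
    rw [sum_part_mul]
    refine sum_le_sum fun i _ => ?_
    have h1 := I.cc_le_d_add_d i (cl i) c
    have h2 := d_cl_le hc i c
    nlinarith [hx.x_nonneg i c]
  refine (sum_le_sum fun c _ => h c).trans (le_of_eq ?_)
  rw [sum_comm]
  simp only [sum_add_distrib, ← mul_sum]
  rw [sum_x_mul_d, sum_x_mul_dav hx]; ring

/-- Here `d_cl_le` enters once, so the contributions are 1 and 4 LP costs. -/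
theorem sum_mov (hx : I.Feasible 1 x y) (hc : I.IsClustering x Z cl) :
    ∑ j, I.mov x cl j ≤ 5 * I.cost x := by
  have h1 : ∑ j, I.mov x cl j = ∑ i, I.d i (cl i) * ∑ c, x i c := by
    simp only [mov]
    rw [sum_comm]
    refine sum_congr rfl fun i _ => ?_
    rw [sum_ite_eq]; simp
  rw [h1]
  calc ∑ i, I.d i (cl i) * ∑ c, x i c
      ≤ ∑ i, ∑ c, (x i c * I.d i c + 4 * (x i c * I.dav x c)) := by
        refine sum_le_sum fun i _ => ?_
        rw [mul_sum]
        refine sum_le_sum fun c _ => ?_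
        have h2 := d_cl_le hc i c
        nlinarith [hx.x_nonneg i c]
    _ = 5 * I.cost x := by
        simp only [sum_add_distrib, ← mul_sum]
        rw [sum_x_mul_d, sum_x_mul_dav hx]; ring

/-- A facility in another cluster is at least as close to its own center as to `j`, while the two
centers are more than `4 dav(j)` apart; so it is farther than `2 dav(j)` from `j`. By Markov at most
half of the demand of `j` is served there, and the rest is bounded by the volume through `x ≤ y`. -/
theorem half_le_vol (hx : I.Feasible 1 x y) (hc : I.IsClustering x Z cl) {j : C} (hj : j ∈ Z) :
    1 / 2 ≤ vol y cl j := by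
  refine le_trans ?_ (part_le_vol hx cl j j)
  have hfar : ∀ i, cl i ≠ j → 2 * I.dav x j < I.d i j := by
    intro i hi
    have h1 := hc.far j hj (cl i) (hc.mem i) hi.symm
    have h2 := I.cc_le_d_add_d i j (cl i)
    have h3 := hc.near i j hj
    linarith
  have hsplit : part x cl j j + ∑ i, (if cl i = j then 0 else x i j) = 1 := by
    rw [part, ← sum_add_distrib, ← hx.served j]
    refine sum_congr rfl fun i _ => ?_
    split_ifs <;> simp
  have hle : 2 * I.dav x j * ∑ i, (if cl i = j then 0 else x i j) ≤ I.dav x j := by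
    rw [mul_sum]
    conv_rhs => rw [dav]
    refine sum_le_sum fun i _ => ?_
    split_ifs with h
    · rw [mul_zero]; exact mul_nonneg (I.d_nonneg i j) (hx.x_nonneg i j)
    · exact mul_le_mul_of_nonneg_right (hfar i h).le (hx.x_nonneg i j)
  -- Markov's inequality would divide by the average. If the average is 0, facilities outside the
  -- cluster have positive distance and hence serve nothing of `j`.
  rcases (dav_nonneg hx j).eq_or_lt with h0 | h0
  · have : ∑ i, (if cl i = j then 0 else x i j) = 0 := by
      refine sum_eq_zero fun i _ => ?_
      split_ifs with h
      · rfl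
      · have h1 := hfar i h
        rw [← h0, mul_zero] at h1
        have h2 := (sum_eq_zero_iff_of_nonneg fun i _ =>
          mul_nonneg (I.d_nonneg i j) (hx.x_nonneg i j)).mp h0.symm i (mem_univ i)
        exact (mul_eq_zero.mp h2).resolve_left h1.ne'
    linarith
  · have : ∑ i, (if cl i = j then 0 else x i j) ≤ 1 / 2 := by
      by_contra! hlt
      nlinarith
    linarith

/-- Moving the demand of sparse clusters to other clusters is cheap. -/
theorem sum_sparse (hx : I.Feasible 1 x y) (hc : I.IsClustering x Z cl) {e : C → ℝ}
    {P : Finset C} (he : ∀ j ∈ P, 0 ≤ e j)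
    (he' : ∀ j ∈ P, ∀ j' ∈ Z, j' ≠ j → e j ≤ I.cc j j') :
    ∑ j ∈ P, (1 - vol y cl j) * (dem x cl j * e j) ≤ 12 * I.cost x := by
  have hnn : ∀ j c j', 0 ≤ part x cl j c * part x cl j' c * (I.cc j c + I.cc j' c) :=
    fun j c j' => mul_nonneg (mul_nonneg (part_nonneg hx _ _ _) (part_nonneg hx _ _ _))
      (add_nonneg (I.cc_nonneg _ _) (I.cc_nonneg _ _))
  have h1 : ∀ j ∈ P, (1 - vol y cl j) * (dem x cl j * e j) ≤
      ∑ c, ∑ j', part x cl j c * part x cl j' c * (I.cc j c + I.cc j' c) := by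
    intro j hj
    rw [dem, sum_mul, mul_sum]
    refine sum_le_sum fun c _ => ?_
    -- The factor `1 - vol` is at most the fraction of `c` served in other clusters, and `e j` is at
    -- most the detour from `j` through `c` to any of their centers.
    calc (1 - vol y cl j) * (part x cl j c * e j)
        ≤ (1 - part x cl j c) * (part x cl j c * e j) :=
          mul_le_mul_of_nonneg_right (by linarith [part_le_vol hx cl j c])
            (mul_nonneg (part_nonneg hx _ _ _) (he j hj))
      _ = ∑ j' ∈ univ.erase j, part x cl j' c * (part x cl j c * e j) := by
          rw [← sum_mul, ← sum_part hx cl c, ← sum_erase_add _ _ (mem_univ j)]; ring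
      _ ≤ ∑ j' ∈ univ.erase j, part x cl j c * part x cl j' c * (I.cc j c + I.cc j' c) := by
          refine sum_le_sum fun j' hj' => ?_
          by_cases hz : j' ∈ Z
          · have h2 := he' j hj j' hz (ne_of_mem_erase hj')
            have h3 := I.cc_triangle j c j'
            rw [I.cc_comm c j'] at h3
            have h4 := mul_nonneg (part_nonneg hx cl j c) (part_nonneg hx cl j' c)
            nlinarith
          · rw [part_eq_zero hc hz]; simp
      _ ≤ _ := sum_le_sum_of_subset_of_nonneg (subset_univ _) fun j' _ _ => hnn j c j'
  -- The summand is symmetric up to renaming and the parts of `c` add up to 1, so the double sum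
  -- collapses; the factor 2 turns 6 into 12.
  have h2 : ∀ c, ∑ j, ∑ j', part x cl j c * part x cl j' c * (I.cc j c + I.cc j' c) =
      2 * ∑ j, part x cl j c * I.cc j c := by
    intro c
    have h3 : ∀ j j', part x cl j c * part x cl j' c * (I.cc j c + I.cc j' c) =
      part x cl j' c * (part x cl j c * I.cc j c) +
        part x cl j c * (part x cl j' c * I.cc j' c) := fun j j' => by ring
    simp only [h3, sum_add_distrib, ← sum_mul, ← mul_sum, sum_part hx]
    ring
  calc _ ≤ ∑ j ∈ P, ∑ c, ∑ j', part x cl j c * part x cl j' c * (I.cc j c + I.cc j' c) :=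
        sum_le_sum h1
    _ ≤ ∑ j, ∑ c, ∑ j', part x cl j c * part x cl j' c * (I.cc j c + I.cc j' c) :=
        sum_le_sum_of_subset_of_nonneg (subset_univ _) fun j _ _ =>
          sum_nonneg fun c _ => sum_nonneg fun j' _ => hnn j c j'
    _ = 2 * ∑ c, ∑ j, part x cl j c * I.cc j c := by
        rw [sum_comm, mul_sum]; exact sum_congr rfl fun c _ => h2 c
    _ ≤ 12 * I.cost x := by linarith [sum_part_mul_cc hx hc]

/-- A cluster of volume less than one is not the only one. -/
theorem exists_other (hx : I.Feasible 1 x y) (hc : I.IsClustering x Z cl) {j : C}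
    (hj : vol y cl j < 1) : ∃ j' ∈ Z, j' ≠ j := by
  by_contra! h
  have h1 := sum_part hx cl j
  rw [← sum_erase_add _ _ (mem_univ j), sum_eq_zero fun j' hj' => part_eq_zero hc (fun hz =>
    ne_of_mem_erase hj' (h j' hz)) j] at h1
  linarith [part_le_vol hx cl j j]

end

end CapMedian

open Finset

/-! ### Selection of facilities and of the clusters to be closed -/

/-- Most of the weight lies at a distance of at most `(1 + ε) / ε` times the average. -/
theorem sum_le_mul_sum_near {α : Type} (U : Finset α) {w d : α → ℝ} {ε : ℝ} (hε : 0 < ε)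
    (hw : ∀ i ∈ U, 0 ≤ w i) (hd : ∀ i ∈ U, 0 ≤ d i) :
    ∑ i ∈ U, w i ≤ (1 + ε) * ∑ i ∈ U with
      d i * (∑ i ∈ U, w i) * ε ≤ (∑ i ∈ U, d i * w i) * (1 + ε), w i := by
  set D := ∑ i ∈ U, w i with hD
  set T := ∑ i ∈ U, d i * w i with hT
  have hD0 : 0 ≤ D := sum_nonneg hw
  have hT0 : 0 ≤ T := sum_nonneg fun i hi => mul_nonneg (hd i hi) (hw i hi)
  have hsplit := sum_filter_add_sum_filter_not U (fun i => d i * D * ε ≤ T * (1 + ε)) w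
  rw [← hD] at hsplit
  set Fr := U.filter (fun i => ¬ d i * D * ε ≤ T * (1 + ε)) with hFr
  -- It is enough that the far elements carry at most a fraction `ε / (1 + ε)` of the weight, which
  -- is Markov's inequality; zero total cost is separate since the argument cancels `T`.
  suffices h : (1 + ε) * ∑ i ∈ Fr, w i ≤ ε * D by nlinarith
  rcases hT0.eq_or_lt with h0 | h0
  · have : ∑ i ∈ Fr, w i = 0 := by
      refine sum_eq_zero fun i hi => ?_
      obtain ⟨hiU, hlt⟩ := mem_filter.mp hi
      rw [← h0, zero_mul, not_le] at hlt
      have h2 := (sum_eq_zero_iff_of_nonneg fun i hi =>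
        mul_nonneg (hd i hi) (hw i hi)).mp h0.symm i hiU
      refine (mul_eq_zero.mp h2).resolve_left fun hz => ?_
      rw [hz] at hlt; simp at hlt
    rw [this]
    simpa using mul_nonneg hε.le hD0
  · have h1 : (1 + ε) * (∑ i ∈ Fr, w i) * T ≤ ε * D * T := by
      calc (1 + ε) * (∑ i ∈ Fr, w i) * T = ∑ i ∈ Fr, w i * (T * (1 + ε)) := by
            rw [← sum_mul]; ring
        _ ≤ ∑ i ∈ Fr, w i * (d i * D * ε) := by
            refine sum_le_sum fun i hi => ?_
            obtain ⟨hiU, hlt⟩ := mem_filter.mp hi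
            exact mul_le_mul_of_nonneg_left (not_le.mp hlt).le (hw i hiU)
        _ ≤ ∑ i ∈ U, w i * (d i * D * ε) :=
            sum_le_sum_of_subset_of_nonneg (filter_subset _ _) fun i hi _ =>
              mul_nonneg (hw i hi) (mul_nonneg (mul_nonneg (hd i hi) hD0) hε.le)
        _ = ε * D * T := by
            rw [hT, mul_sum]; exact sum_congr rfl fun i _ => by ring
    exact le_of_mul_le_mul_right h1 h0

section

variable {α : Type} [LinearOrder α]

open Classical in
/-- The facilities of largest capacity dominate a fractional opening. -/
theorem sum_le_mul_cap {N : Finset α} {w u y : α → ℝ} {M : ℕ} {Y κ : ℝ} (hM : 1 ≤ M)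
    (hu : ∀ i ∈ N, 0 ≤ u i) (hw : ∀ i ∈ N, w i ≤ u i * y i)
    (hy1 : ∀ i ∈ N, y i ≤ 1) (hy0 : ∀ i ∈ N, 0 ≤ y i)
    (hY : ∑ i ∈ N, y i ≤ Y) (hκ : 1 ≤ κ) (hYM : Y ≤ κ * M) :
    ∑ i ∈ N, w i ≤ κ * ∑ i ∈ N with rk (fun i => - u i) N i < M, u i := by
  set S := N.filter (fun i => rk (fun i => - u i) N i < M) with hS
  have hSN : S ⊆ N := filter_subset _ _
  have hcap : 0 ≤ ∑ i ∈ S, u i := sum_nonneg fun i hi => hu i (hSN hi)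
  have hle : ∑ i ∈ N, w i ≤ ∑ i ∈ N, u i * y i := sum_le_sum hw
  refine hle.trans ?_
  by_cases hNS : N ⊆ S
  · rw [← hNS.antisymm hSN] at hcap ⊢
    have : ∑ i ∈ N, u i * y i ≤ ∑ i ∈ N, u i :=
      sum_le_sum fun i hi => mul_le_of_le_one_right (hu i hi) (hy1 i hi)
    nlinarith
  · obtain ⟨i₀, hi₀, hi₀S⟩ := not_subset.mp hNS
    have hrk : ∀ i ∈ N, i ∉ S → M ≤ rk (fun i => - u i) N i := fun i hi h => by
      by_contra! h'; exact h (mem_filter.mpr ⟨hi, h'⟩)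
    have hcard : #S = M := by
      rw [hS, card_rk_lt]
      have := rk_lt_card (key := fun i => - u i) hi₀
      have := hrk i₀ hi₀ hi₀S
      omega
    have hSne : S.Nonempty := card_pos.mp (by omega)
    -- Threshold `θ`, the smallest selected capacity. The excess `u - θ` is nonpositive outside `S`,
    -- so its fractional sum is at most its sum over `S`; the remaining `θ * Y ≤ κ * M * θ` is
    -- absorbed because `M * θ` is at most the selected capacity and `κ ≥ 1`.
    obtain ⟨s, hs, hmin⟩ := S.exists_min_image u hSne
    set θ := u s
    have hθ : 0 ≤ θ := hu s (hSN hs)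
    have hout : ∀ i ∈ N, i ∉ S → u i ≤ θ := fun i hi h => by
      have := key_le_of_rk hi (mem_filter.mp hs).2 (hrk i hi h)
      simpa using this
    have hsum : ∑ i ∈ N, (u i - θ) * y i ≤ ∑ i ∈ S, (u i - θ) := by
      rw [← sum_sdiff hSN]
      have h1 : ∑ i ∈ N \ S, (u i - θ) * y i ≤ 0 := sum_nonpos fun i hi => by
        obtain ⟨hi, hi'⟩ := mem_sdiff.mp hi
        exact mul_nonpos_of_nonpos_of_nonneg (by linarith [hout i hi hi']) (hy0 i hi)
      have h2 : ∑ i ∈ S, (u i - θ) * y i ≤ ∑ i ∈ S, (u i - θ) := sum_le_sum fun i hi =>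
        mul_le_of_le_one_right (by linarith [hmin i hi]) (hy1 i (hSN hi))
      linarith
    have hMθ : M * θ ≤ ∑ i ∈ S, u i := by
      have := card_nsmul_le_sum S u θ hmin
      rwa [hcard, nsmul_eq_mul] at this
    simp only [sub_mul, sum_sub_distrib, ← mul_sum, sum_const, hcard, nsmul_eq_mul] at hsum
    nlinarith

open Classical in
/-- The cheapest elements are dominated by a fractional choice of the same size. -/
theorem sum_first_le {P : Finset α} {key a : α → ℝ} {K : ℕ} (hkey : ∀ j ∈ P, 0 ≤ key j)
    (ha0 : ∀ j ∈ P, 0 ≤ a j) (ha1 : ∀ j ∈ P, a j ≤ 1) (hK : (K : ℝ) ≤ ∑ j ∈ P, a j) :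
    ∑ j ∈ P with rk key P j < K, key j ≤ ∑ j ∈ P, a j * key j := by
  set H := P.filter (fun j => rk key P j < K) with hH
  have hHP : H ⊆ P := filter_subset _ _
  rcases H.eq_empty_or_nonempty with h0 | hne
  · rw [h0, sum_empty]
    exact sum_nonneg fun j hj => mul_nonneg (ha0 j hj) (hkey j hj)
  -- Exchange at the price of the dearest chosen element: the weight `1 - a` missing inside `H` is
  -- at most the weight `a` outside, where every key is at least that of `h`.
  obtain ⟨h, hh, hmax⟩ := H.exists_max_image key hne
  have hcard : (#H : ℝ) ≤ K := by
    rw [hH, card_rk_lt]; exact_mod_cast min_le_left _ _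
  rw [← sum_sdiff hHP] at hK ⊢
  have h1 : ∑ j ∈ H, (1 - a j) * key j ≤ ∑ j ∈ H, (1 - a j) * key h := sum_le_sum fun j hj =>
    mul_le_mul_of_nonneg_left (hmax j hj) (by linarith [ha1 j (hHP hj)])
  have h2 : ∑ j ∈ P \ H, a j * key h ≤ ∑ j ∈ P \ H, a j * key j := sum_le_sum fun j hj => by
    obtain ⟨hj, hj'⟩ := mem_sdiff.mp hj
    refine mul_le_mul_of_nonneg_left ?_ (ha0 j hj)
    refine key_le_of_rk hj (mem_filter.mp hh).2 ?_
    by_contra! h'; exact hj' (mem_filter.mpr ⟨hj, h'⟩)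
  have h3 := hkey h (hHP hh)
  simp only [sub_mul, one_mul, sum_sub_distrib, ← sum_mul, sum_const, nsmul_eq_mul] at h1 h2
  nlinarith

end

open Finset

/-! ### Grouping of the half-open clusters -/

/-- `M` is an inclusion-maximal set of pairwise disjoint edges of `E`. -/
structure IsMaxMatching {α : Type} (E M : α → α → Prop) : Prop where
  sub : ∀ a b, M a b → E a b
  disj : ∀ a b a' b', M a b → M a' b' → (a = a' ∨ a = b' ∨ b = a' ∨ b = b') → a = a' ∧ b = b'
  max : ∀ a b, E a b → ∃ a' b', M a' b' ∧ (a = a' ∨ a = b' ∨ b = a' ∨ b = b')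

/-- Centers `Z`, some of them half-open, with a map `σ` from half-open centers to nearest other
centers. -/
structure Halves (α : Type) where
  Z : Finset α
  H : Finset α
  δ : α → α → ℝ
  e : α → ℝ
  σ : α → α
  sub : H ⊆ Z
  δ_nonneg : ∀ a b, 0 ≤ δ a b
  δ_self : ∀ a, δ a a = 0
  δ_comm : ∀ a b, δ a b = δ b a
  δ_tri : ∀ a b c, δ a c ≤ δ a b + δ b c
  σ_mem : ∀ h ∈ H, σ h ∈ Z
  σ_ne : ∀ h ∈ H, σ h ≠ h
  δ_σ : ∀ h ∈ H, δ h (σ h) = e h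
  e_le : ∀ h ∈ H, ∀ j ∈ Z, j ≠ h → e h ≤ δ h j

namespace Halves

variable {α : Type} [LinearOrder α] (S : Halves α) (M : α → α → Prop)

/-- Half-open centers that may be paired. -/
def Edge (a b : α) : Prop :=
  a ∈ S.H ∧ b ∈ S.H ∧ a < b ∧ (S.σ a = b ∨ S.σ b = a ∨ S.σ a = S.σ b)

/-- `a` is an end of an edge of `M`. -/
def Matched (a : α) : Prop := ∃ b, M a b ∨ M b a

/-- A matched center which is nearest to an unmatched one. -/
def Att (a : α) : Prop := Matched M a ∧ ∃ h ∈ S.H, ¬ Matched M h ∧ S.σ h = a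

/-- A matched center that names a group. -/
def Lab (a : α) : Prop := S.Att M a ∨ ∃ b, M a b ∧ ¬ S.Att M b

open Classical in
/-- The name of the group of a center. -/
noncomputable def g (j : α) : α :=
  if j ∈ S.H then
    if h : Matched M j then
      if S.Lab M j then j else h.choose
    else S.σ j
  else j

/-- The possible groups. -/
inductive Group : Finset α → Prop where
  | single (p : α) (hp : p ∉ S.H) : Group {p}
  | full (p h : α) (hp : p ∉ S.H) (hh : h ∈ S.H) (hd : S.δ h p ≤ S.e h) : Group {p, h}
  | pair (p q : α) (hpq : p ≠ q) (hp : p ∈ S.H) (hq : q ∈ S.H) (hd : S.δ p q ≤ S.e p + S.e q) :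
      Group {p, q}
  | triple (p q h : α) (hpq : p ≠ q) (hph : p ≠ h) (hqh : q ≠ h) (hp : p ∈ S.H) (hq : q ∈ S.H)
      (hh : h ∈ S.H) (hd : S.δ p q ≤ S.e p + S.e q) (hd' : S.δ h p ≤ S.e h) (he : S.e p ≤ S.e h) :
      Group {p, q, h}

set_option linter.unusedSectionVars false

variable {S M}

theorem e_nonneg {h : α} (hh : h ∈ S.H) : 0 ≤ S.e h := by
  rw [← S.δ_σ h hh]; exact S.δ_nonneg _ _

/-- Either one center is the nearest to the other, or both point to the same center and the triangle
inequality through it applies. -/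
theorem edge_dist {a b : α} (h : S.Edge a b) : S.δ a b ≤ S.e a + S.e b := by
  obtain ⟨ha, hb, -, h | h | h⟩ := h
  · rw [← h, S.δ_σ a ha, h]; linarith [e_nonneg hb]
  · rw [S.δ_comm, ← h, S.δ_σ b hb, h]; linarith [e_nonneg ha]
  · have := S.δ_tri a (S.σ a) b
    rw [S.δ_σ a ha, h, S.δ_comm (S.σ b) b, S.δ_σ b hb] at this
    exact this

theorem mate_unique (hM : IsMaxMatching S.Edge M) {a b b' : α} (h : M a b ∨ M b a)
    (h' : M a b' ∨ M b' a) : b = b' := by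
  rcases h with h | h <;> rcases h' with h' | h'
  · exact (hM.disj _ _ _ _ h h' (by simp)).2
  · have := hM.disj _ _ _ _ h h' (by simp)
    exact absurd (hM.sub _ _ h).2.2.1 (by rw [this.2]; exact lt_irrefl _)
  · have := hM.disj _ _ _ _ h h' (by simp)
    exact absurd (hM.sub _ _ h).2.2.1 (by rw [this.1]; exact lt_irrefl _)
  · exact (hM.disj _ _ _ _ h h' (by simp)).1

theorem not_both (hM : IsMaxMatching S.Edge M) {a b c : α} (h : M a b) : ¬ M b c := fun h' => by
  have := hM.disj _ _ _ _ h h' (by simp)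
  exact absurd (hM.sub _ _ h).2.2.1 (by rw [this.1]; exact lt_irrefl _)

theorem matched_mem (hM : IsMaxMatching S.Edge M) {a : α} (h : Matched M a) : a ∈ S.H := by
  obtain ⟨b, h | h⟩ := h
  · exact (hM.sub _ _ h).1
  · exact (hM.sub _ _ h).2.1

theorem matched_of_adj (hM : IsMaxMatching S.Edge M) {a b : α} (ha : a ∈ S.H) (hb : b ∈ S.H)
    (hab : a ≠ b) (h : S.σ a = b ∨ S.σ b = a ∨ S.σ a = S.σ b) : Matched M a ∨ Matched M b := by
  have key : ∀ a b, S.Edge a b → Matched M a ∨ Matched M b := by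
    intro a b hE
    obtain ⟨a', b', hm, h | h | h | h⟩ := hM.max a b hE
    · exact Or.inl ⟨b', by rw [h]; exact Or.inl hm⟩
    · exact Or.inl ⟨a', by rw [h]; exact Or.inr hm⟩
    · exact Or.inr ⟨b', by rw [h]; exact Or.inl hm⟩
    · exact Or.inr ⟨a', by rw [h]; exact Or.inr hm⟩
  rcases lt_or_gt_of_ne hab with hlt | hlt
  · exact key a b ⟨ha, hb, hlt, h⟩
  · exact (key b a ⟨hb, ha, hlt, by
      rcases h with h | h | h
      · exact Or.inr (Or.inl h)
      · exact Or.inl h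
      · exact Or.inr (Or.inr h.symm)⟩).symm

/-- Two such centers would form an edge disjoint from the matching. Hence each center attracts at
most one unmatched half-open center, which keeps groups small. -/
theorem unmatched_eq (hM : IsMaxMatching S.Edge M) {h h' : α} (hh : h ∈ S.H) (hh' : h' ∈ S.H)
    (hn : ¬ Matched M h) (hn' : ¬ Matched M h') (hσ : S.σ h = S.σ h') : h = h' := by
  by_contra hne
  rcases matched_of_adj hM hh hh' hne (Or.inr (Or.inr hσ)) with h1 | h1 <;> contradiction

theorem mate_dist (hM : IsMaxMatching S.Edge M) {a b : α} (h : M a b ∨ M b a) :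
    S.δ a b ≤ S.e a + S.e b := by
  rcases h with h | h
  · exact edge_dist (hM.sub _ _ h)
  · rw [S.δ_comm, add_comm]; exact edge_dist (hM.sub _ _ h)

theorem mate_ne (hM : IsMaxMatching S.Edge M) {a b : α} (h : M a b ∨ M b a) : a ≠ b := by
  rcases h with h | h
  · exact (hM.sub _ _ h).2.2.1.ne
  · exact (hM.sub _ _ h).2.2.1.ne'

theorem g_full {j : α} (hj : j ∉ S.H) : S.g M j = j := by rw [g, if_neg hj]

theorem g_unmatched {j : α} (hj : j ∈ S.H) (h : ¬ Matched M j) : S.g M j = S.σ j := by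
  rw [g, if_pos hj, dif_neg h]

theorem g_lab (hM : IsMaxMatching S.Edge M) {j : α} (h : Matched M j) (hl : S.Lab M j) :
    S.g M j = j := by
  rw [g, if_pos (matched_mem hM h), dif_pos h, if_pos hl]

theorem g_mate (hM : IsMaxMatching S.Edge M) {j q : α} (h : M j q ∨ M q j) (hl : ¬ S.Lab M j) :
    S.g M j = q := by
  have hm : Matched M j := ⟨q, h⟩
  rw [g, if_pos (matched_mem hM hm), dif_pos hm, if_neg hl]
  exact mate_unique hM hm.choose_spec h

/-- The relation that the array program computes. -/
theorem g_eq_iff (hM : IsMaxMatching S.Edge M) {j l : α} : S.g M j = l ↔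
    (j ∉ S.H ∧ j = l) ∨ (j ∈ S.H ∧ ¬ Matched M j ∧ S.σ j = l) ∨
      (Matched M j ∧ S.Lab M j ∧ j = l) ∨ (¬ S.Lab M j ∧ (M j l ∨ M l j)) := by
  by_cases hj : j ∈ S.H
  · by_cases hm : Matched M j
    · by_cases hl : S.Lab M j
      · rw [g_lab hM hm hl]; tauto
      · obtain ⟨q, hq⟩ := hm
        rw [g_mate hM hq hl]
        constructor
        · rintro rfl; exact Or.inr (Or.inr (Or.inr ⟨hl, hq⟩))
        · rintro (h | h | h | h)
          · exact absurd hj h.1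
          · exact absurd ⟨q, hq⟩ h.2.1
          · exact absurd h.2.1 hl
          · exact mate_unique hM hq h.2
    · rw [g_unmatched hj hm]
      constructor
      · intro h; exact Or.inr (Or.inl ⟨hj, hm, h⟩)
      · rintro (h | h | h | h)
        · exact absurd hj h.1
        · exact h.2.2
        · exact absurd h.1 hm
        · exact absurd ⟨l, h.2⟩ hm
  · rw [g_full hj]
    constructor
    · intro h; exact Or.inl ⟨hj, h⟩
    · rintro (h | h | h | h)
      · exact h.2
      · exact absurd h.1 hj
      · exact h.2.2
      · exact absurd (matched_mem hM ⟨l, h.2⟩) hj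

/-- The pair `h`, `l` is an edge, so by maximality one of its ends is matched, and it is not `h`. -/
theorem att_of_unmatched (hM : IsMaxMatching S.Edge M) {h l : α} (hh : h ∈ S.H)
    (hn : ¬ Matched M h) (hσ : S.σ h = l) (hl : l ∈ S.H) : S.Att M l := by
  refine ⟨?_, h, hh, hn, hσ⟩
  have hne : h ≠ l := by rintro rfl; exact S.σ_ne h hh hσ
  exact (matched_of_adj hM hh hl hne (Or.inl hσ)).resolve_left hn

-- Cases on the name `l` of the group. A full center has with it at most one unmatched half-open
-- center pointing to it. A half-open name is matched, and its group can contain only itself, its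
-- mate `q`, and the unique unmatched center pointing to it. If both ends of a matched edge attract,
-- both are names and the edge splits into two pairs; if one attracts, a triple arises; if none
-- does, the smaller end names the pair.
open Classical in
theorem group_fiber (hM : IsMaxMatching S.Edge M) {j₀ : α} (hj₀ : j₀ ∈ S.Z) :
    S.Group (S.Z.filter fun j => S.g M j = S.g M j₀) := by
  obtain ⟨l, hl₀⟩ : ∃ l, S.g M j₀ = l := ⟨_, rfl⟩
  rw [hl₀]
  by_cases hl : l ∈ S.H
  · have hlm : Matched M l := by
      rcases (g_eq_iff hM).mp hl₀ with h | h | h | h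
      · exact absurd (h.2 ▸ hl) h.1
      · exact (att_of_unmatched hM h.1 h.2.1 h.2.2 hl).1
      · exact h.2.2 ▸ h.1
      · exact ⟨j₀, h.2.symm⟩
    obtain ⟨q, hq⟩ := hlm
    have hlq : l ≠ q := mate_ne hM hq
    have hqH : q ∈ S.H := matched_mem hM ⟨l, hq.symm⟩
    have hqg : S.g M q = l ↔ ¬ S.Lab M q := by
      constructor
      · intro h hlab
        rw [g_lab hM ⟨l, hq.symm⟩ hlab] at h
        exact hlq h.symm
      · exact g_mate hM hq.symm
    by_cases hatt : S.Att M l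
    · obtain ⟨-, h, hh, hn, hσ⟩ := id hatt
      have hlg : S.g M l = l := g_lab hM ⟨q, hq⟩ (Or.inl hatt)
      have hhl : h ≠ l := by rintro rfl; exact hn ⟨q, hq⟩
      have hhq : h ≠ q := by rintro rfl; exact hn ⟨l, hq.symm⟩
      have hd : S.δ h l = S.e h := by rw [← hσ]; exact S.δ_σ h hh
      have hmem : ∀ j, S.g M j = l → j = l ∨ j = h ∨ j = q := by
        intro j hj
        rcases (g_eq_iff hM).mp hj with h' | h' | h' | h'
        · exact Or.inl h'.2
        · exact Or.inr (Or.inl (unmatched_eq hM h'.1 hh h'.2.1 hn (h'.2.2.trans hσ.symm)))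
        · exact Or.inl h'.2.2
        · exact Or.inr (Or.inr (mate_unique hM h'.2.symm hq))
      have hhg : S.g M h = l := (g_unmatched hh hn).trans hσ
      -- Since `l` attracts, its mate can be a name only by attracting a center of its own.
      by_cases hlab : S.Lab M q
      · have : S.Z.filter (fun j => S.g M j = l) = {l, h} := by
          ext j
          simp only [mem_filter, mem_insert, mem_singleton]
          constructor
          · rintro ⟨-, hj⟩
            rcases hmem j hj with rfl | rfl | rfl
            · exact Or.inl rfl
            · exact Or.inr rfl
            · exact absurd hlab (hqg.mp hj)
          · rintro (rfl | rfl)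
            · exact ⟨S.sub hl, hlg⟩
            · exact ⟨S.sub hh, hhg⟩
        rw [this]
        refine Group.pair l h hhl.symm hl hh ?_
        rw [S.δ_comm, hd]; linarith [e_nonneg hl]
      · have : S.Z.filter (fun j => S.g M j = l) = {l, q, h} := by
          ext j
          simp only [mem_filter, mem_insert, mem_singleton]
          constructor
          · rintro ⟨-, hj⟩
            rcases hmem j hj with rfl | rfl | rfl <;> simp
          · rintro (rfl | rfl | rfl)
            · exact ⟨S.sub hl, hlg⟩
            · exact ⟨S.sub hqH, hqg.mpr hlab⟩
            · exact ⟨S.sub hh, hhg⟩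
        rw [this]
        -- The final inequality: `h` is a center other than `l`, so the nearest-center distance of
        -- `l` is at most its distance `e h` to `h`.
        refine Group.triple l q h hlq hhl.symm hhq.symm hl hqH hh (mate_dist hM hq) hd.le ?_
        rw [← hd, S.δ_comm]; exact S.e_le l hl h (S.sub hh) hhl
    · have hmem : ∀ j, S.g M j = l → j = l ∨ j = q := by
        intro j hj
        rcases (g_eq_iff hM).mp hj with h' | h' | h' | h'
        · exact Or.inl h'.2
        · exact absurd (att_of_unmatched hM h'.1 h'.2.1 h'.2.2 hl) hatt
        · exact Or.inl h'.2.2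
        · exact Or.inr (mate_unique hM h'.2.symm hq)
      have hboth : S.Lab M l ∧ ¬ S.Lab M q := by
        rcases hmem j₀ hl₀ with rfl | rfl
        · have h1 : S.Lab M j₀ := by
            by_contra h
            rw [g_mate hM hq h] at hl₀
            exact hlq hl₀.symm
          refine ⟨h1, ?_⟩
          obtain ⟨b, hb, hb'⟩ := h1.resolve_left hatt
          rw [← mate_unique hM (Or.inl hb) hq]
          rintro (h | ⟨c, hc, -⟩)
          · exact hb' h
          · exact not_both hM hb hc
        · have h1 := hqg.mp hl₀
          refine ⟨?_, h1⟩
          rcases hq with hq | hq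
          · exact Or.inr ⟨_, hq, fun h => h1 (Or.inl h)⟩
          · exact absurd (Or.inr ⟨_, hq, hatt⟩) h1
      have : S.Z.filter (fun j => S.g M j = l) = {l, q} := by
        ext j
        simp only [mem_filter, mem_insert, mem_singleton]
        constructor
        · rintro ⟨-, hj⟩; exact hmem j hj
        · rintro (rfl | rfl)
          · exact ⟨S.sub hl, g_lab hM ⟨q, hq⟩ hboth.1⟩
          · exact ⟨S.sub hqH, hqg.mpr hboth.2⟩
      rw [this]
      exact Group.pair l q hlq hl hqH (mate_dist hM hq)
  · have hlZ : l ∈ S.Z := by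
      rcases (g_eq_iff hM).mp hl₀ with h | h | h | h
      · exact h.2 ▸ hj₀
      · exact h.2.2 ▸ S.σ_mem _ h.1
      · exact h.2.2 ▸ hj₀
      · exact absurd (matched_mem hM ⟨_, h.2.symm⟩) hl
    have hmem : ∀ j, S.g M j = l ↔ j = l ∨ (j ∈ S.H ∧ ¬ Matched M j ∧ S.σ j = l) := by
      intro j
      rw [g_eq_iff hM]
      constructor
      · rintro (h | h | h | h)
        · exact Or.inl h.2
        · exact Or.inr h
        · exact Or.inl h.2.2
        · exact absurd (matched_mem hM ⟨_, h.2.symm⟩) hl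
      · rintro (rfl | h)
        · exact Or.inl ⟨hl, rfl⟩
        · exact Or.inr (Or.inl h)
    by_cases hex : ∃ h, h ∈ S.H ∧ ¬ Matched M h ∧ S.σ h = l
    · obtain ⟨h, hh, hn, hσ⟩ := hex
      have : S.Z.filter (fun j => S.g M j = l) = {l, h} := by
        ext j
        simp only [mem_filter, mem_insert, mem_singleton, hmem]
        constructor
        · rintro ⟨-, h' | h'⟩
          · exact Or.inl h'
          · exact Or.inr (unmatched_eq hM h'.1 hh h'.2.1 hn (h'.2.2.trans hσ.symm))
        · rintro (rfl | rfl)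
          · exact ⟨hlZ, Or.inl rfl⟩
          · exact ⟨S.sub hh, Or.inr ⟨hh, hn, hσ⟩⟩
      rw [this]
      exact Group.full l h hl hh (by rw [← hσ]; exact (S.δ_σ h hh).le)
    · have : S.Z.filter (fun j => S.g M j = l) = {l} := by
        ext j
        simp only [mem_filter, mem_singleton, hmem]
        constructor
        · rintro ⟨-, h' | h'⟩
          · exact h'
          · exact absurd ⟨j, h'⟩ hex
        · rintro rfl; exact ⟨hlZ, Or.inl rfl⟩
      rw [this]
      exact Group.single l hl

/-! ### Loads -/

open Classical in
/-- The key by which the center to be opened in a group is chosen. -/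
noncomputable def val (S : Halves α) (L : α → ℝ) (j : α) : ℝ := if j ∈ S.H then L j else L j / 2

variable {L : α → ℝ}

/-- A half-open center weighs 1 and a full one 2; weight at least 2 per group is what bounds the
number of groups. -/
theorem Group.two_le {s : Finset α} [DecidablePred (· ∈ S.H)] (hs : S.Group s) :
    2 ≤ ∑ j ∈ s, (if j ∈ S.H then 1 else 2) := by
  cases hs with
  | single p hp => simp [hp]
  | full p h hp hh hd =>
    rw [sum_pair (by rintro rfl; exact hp hh)]; simp [hp, hh]
  | pair p q hpq hp hq hd => rw [sum_pair hpq]; simp [hp, hq]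
  | triple p q h hpq hph hqh hp hq hh =>
    rw [sum_insert (by simp [hpq, hph]), sum_pair hqh]; simp [hp, hq, hh]

/-- Among half-open centers `m` has the largest load, and there are at most three. In a mixed group
the halved value of the full center decides: a surviving full center has at least twice the load of
the other, a surviving half-open one at least half, giving 3/2 and 3. -/
theorem Group.load {s : Finset α} (hs : S.Group s) (hL : ∀ j, 0 ≤ L j) {m : α} (hm : m ∈ s)
    (hmax : ∀ j ∈ s, S.val L j ≤ S.val L m) :
    ∑ j ∈ s, L j ≤ 3 * L m ∧ (m ∉ S.H → ∑ j ∈ s, L j ≤ 3 / 2 * L m) := by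
  cases hs with
  | single p hp =>
    simp only [mem_singleton] at hm; subst hm
    simp only [sum_singleton]
    constructor
    · linarith [hL m]
    · intro _; linarith [hL m]
  | full p h hp hh hd =>
    have hne : p ≠ h := by rintro rfl; exact hp hh
    have h1 := hmax p (by simp)
    have h2 := hmax h (by simp)
    rw [sum_pair hne]
    simp only [mem_insert, mem_singleton] at hm
    rcases hm with rfl | rfl
    · simp only [val, hp, hh, if_true, if_false] at h1 h2
      exact ⟨by linarith [hL m], fun _ => by linarith⟩
    · simp only [val, hp, hh, if_true, if_false] at h1 h2
      exact ⟨by linarith, fun h => absurd hh h⟩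
  | pair p q hpq hp hq hd =>
    have h1 := hmax p (by simp)
    have h2 := hmax q (by simp)
    have hmH : m ∈ S.H := by
      simp only [mem_insert, mem_singleton] at hm; rcases hm with rfl | rfl <;> assumption
    rw [sum_pair hpq]
    simp only [val, hp, hq, hmH, if_true] at h1 h2
    exact ⟨by linarith [hL m], fun h => absurd hmH h⟩
  | triple p q h hpq hph hqh hp hq hh =>
    have h1 := hmax p (by simp)
    have h2 := hmax q (by simp)
    have h3 := hmax h (by simp)
    have hmH : m ∈ S.H := by
      simp only [mem_insert, mem_singleton] at hm; rcases hm with rfl | rfl | rfl <;> assumption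
    rw [sum_insert (by simp [hpq, hph]), sum_pair hqh]
    simp only [val, hp, hq, hh, hmH, if_true] at h1 h2 h3
    exact ⟨by linarith, fun h => absurd hmH h⟩

/-- A distance `e j'` of another center on a path is charged to the center `j'` itself by replacing
the moved load with the larger load of `m` where needed. The extreme case is a triple with `m = h`,
where the term of `h` is charged three times; there `e p ≤ e h` is needed. In a mixed group only `e
h` is used, with factor at most 2. -/
theorem Group.cost {s : Finset α} [DecidablePred (· ∈ S.H)] (hs : S.Group s) (hL : ∀ j, 0 ≤ L j)
    {m : α} (hm : m ∈ s) (hmax : ∀ j ∈ s, S.val L j ≤ S.val L m) :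
    ∑ j ∈ s, L j * S.δ j m ≤ ∑ j ∈ s, (if j ∈ S.H then 3 * (L j * S.e j) else 0) := by
  cases hs with
  | single p hp =>
    simp only [mem_singleton] at hm; subst hm
    simp [hp, S.δ_self]
  | full p h hp hh hd =>
    have hne : p ≠ h := by rintro rfl; exact hp hh
    have h1 := hmax p (by simp)
    have h2 := hmax h (by simp)
    have he := e_nonneg hh
    rw [sum_pair hne, sum_pair hne]
    simp only [mem_insert, mem_singleton] at hm
    rcases hm with rfl | rfl
    · simp only [hp, hh, if_true, if_false, S.δ_self]
      nlinarith [mul_nonneg (hL h) he, mul_le_mul_of_nonneg_left hd (hL h)]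
    · simp only [val, hp, hh, if_true, if_false] at h1 h2 ⊢
      rw [S.δ_self, S.δ_comm]
      have h3 : L p * S.δ m p ≤ (2 * L m) * S.e m :=
        mul_le_mul (by linarith) hd (S.δ_nonneg _ _) (by linarith [hL m])
      nlinarith [mul_nonneg (hL m) he]
  | pair p q hpq hp hq hd =>
    have h1 := hmax p (by simp)
    have h2 := hmax q (by simp)
    have hep := mul_nonneg (hL p) (e_nonneg hp)
    have heq := mul_nonneg (hL q) (e_nonneg hq)
    rw [sum_pair hpq, sum_pair hpq]
    simp only [mem_insert, mem_singleton] at hm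
    rcases hm with rfl | rfl
    · simp only [val, hp, hq, if_true] at h1 h2 ⊢
      rw [S.δ_self, S.δ_comm]
      have h3 := mul_le_mul_of_nonneg_left hd (hL q)
      have h4 := mul_le_mul_of_nonneg_right h2 (e_nonneg hp)
      nlinarith
    · simp only [val, hp, hq, if_true] at h1 h2 ⊢
      rw [S.δ_self]
      have h3 := mul_le_mul_of_nonneg_left hd (hL p)
      have h4 := mul_le_mul_of_nonneg_right h1 (e_nonneg hq)
      nlinarith
  | triple p q h hpq hph hqh hp hq hh hd hd' he =>
    have h1 := hmax p (by simp)
    have h2 := hmax q (by simp)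
    have h3 := hmax h (by simp)
    have hep := mul_nonneg (hL p) (e_nonneg hp)
    have heq := mul_nonneg (hL q) (e_nonneg hq)
    have heh := mul_nonneg (hL h) (e_nonneg hh)
    have hpq' : p ∉ ({q, h} : Finset α) := by simp [hpq, hph]
    rw [sum_insert hpq', sum_pair hqh, sum_insert hpq', sum_pair hqh]
    simp only [mem_insert, mem_singleton] at hm
    simp only [val, hp, hq, hh, if_true] at h1 h2 h3 ⊢
    rcases hm with rfl | rfl | rfl
    · rw [S.δ_self, S.δ_comm q]
      simp only [hp, if_true] at h1 h2 h3
      have a1 := mul_le_mul_of_nonneg_left hd (hL q)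
      have a2 := mul_le_mul_of_nonneg_left hd' (hL h)
      have a3 := mul_le_mul_of_nonneg_right h2 (e_nonneg hp)
      nlinarith
    · rw [S.δ_self]
      simp only [hq, if_true] at h1 h2 h3
      have a1 := mul_le_mul_of_nonneg_left hd (hL p)
      have a2 : S.δ h m ≤ S.e h + (S.e p + S.e m) := (S.δ_tri h p m).trans (by linarith)
      have a3 := mul_le_mul_of_nonneg_left a2 (hL h)
      have a4 := mul_le_mul_of_nonneg_right h1 (e_nonneg hq)
      have a5 := mul_le_mul_of_nonneg_right h3 (e_nonneg hq)
      have a6 := mul_le_mul_of_nonneg_left he (hL h)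
      nlinarith
    · rw [S.δ_self]
      simp only [hh, if_true] at h1 h2 h3
      rw [S.δ_comm] at hd
      have a0 : S.δ p m ≤ S.e m := by rw [S.δ_comm]; exact hd'
      have a1 : S.δ q m ≤ (S.e p + S.e q) + S.e m := (S.δ_tri q p m).trans (by linarith)
      have a2 := mul_le_mul_of_nonneg_left a0 (hL p)
      have a3 := mul_le_mul_of_nonneg_left a1 (hL q)
      have a4 := mul_le_mul_of_nonneg_right h1 (e_nonneg hh)
      have a5 := mul_le_mul_of_nonneg_right h2 (e_nonneg hh)
      have a6 := mul_le_mul_of_nonneg_left he (hL q)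
      nlinarith

/-- `ρ j` is the center of largest value in the group of `j`. -/
structure IsChoice (S : Halves α) (M : α → α → Prop) (L : α → ℝ) (ρ : α → α) : Prop where
  mem : ∀ j ∈ S.Z, ρ j ∈ S.Z
  group : ∀ j ∈ S.Z, S.g M (ρ j) = S.g M j
  max : ∀ j ∈ S.Z, ∀ j' ∈ S.Z, S.g M j' = S.g M j → S.val L j' ≤ S.val L (ρ j)
  eq : ∀ j ∈ S.Z, ∀ j' ∈ S.Z, S.g M j' = S.g M j → ρ j' = ρ j

section

variable {ρ : α → α}

-- Choices are constant on groups and stay inside them, so the fibers of `ρ` on the centers are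
-- exactly the groups; this transfers the statements about groups to `ρ`.
open Classical in
theorem IsChoice.filter_eq (hρ : IsChoice S M L ρ) {j : α} (hj : j ∈ S.Z) :
    S.Z.filter (fun j' => ρ j' = ρ j) = S.Z.filter (fun j' => S.g M j' = S.g M j) := by
  ext j'
  simp only [mem_filter, and_congr_right_iff]
  intro hj'
  constructor
  · intro h; rw [← hρ.group j' hj', h, hρ.group j hj]
  · intro h; exact hρ.eq j hj j' hj' h

open Classical in
theorem IsChoice.load (hρ : IsChoice S M L ρ) (hM : IsMaxMatching S.Edge M) (hL : ∀ j, 0 ≤ L j)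
    (m : α) : ∑ j ∈ S.Z with ρ j = m, L j ≤ 3 * L m ∧
      (m ∉ S.H → ∑ j ∈ S.Z with ρ j = m, L j ≤ 3 / 2 * L m) := by
  by_cases hm : ∃ j ∈ S.Z, ρ j = m
  · obtain ⟨j, hj, rfl⟩ := hm
    rw [hρ.filter_eq hj]
    exact (group_fiber hM hj).load hL (mem_filter.mpr ⟨hρ.mem j hj, hρ.group j hj⟩)
      fun j' hj' => hρ.max j hj j' (mem_filter.mp hj').1 (mem_filter.mp hj').2
  · have : S.Z.filter (fun j => ρ j = m) = ∅ := by
      rw [filter_eq_empty_iff]; intro j hj h; exact hm ⟨j, hj, h⟩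
    rw [this, sum_empty]
    exact ⟨by linarith [hL m], fun _ => by linarith [hL m]⟩

open Classical in
theorem IsChoice.cost (hρ : IsChoice S M L ρ) (hM : IsMaxMatching S.Edge M) (hL : ∀ j, 0 ≤ L j) :
    ∑ j ∈ S.Z, L j * S.δ j (ρ j) ≤ 3 * ∑ j ∈ S.H, L j * S.e j := by
  have h1 : 3 * ∑ j ∈ S.H, L j * S.e j =
      ∑ j ∈ S.Z, (if j ∈ S.H then 3 * (L j * S.e j) else 0) := by
    rw [← sum_filter, filter_mem_eq_inter, inter_eq_right.mpr S.sub, mul_sum]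
  rw [h1, ← sum_fiberwise_of_maps_to (t := S.Z.image ρ) (g := ρ) fun j hj => mem_image_of_mem _ hj,
    ← sum_fiberwise_of_maps_to (t := S.Z.image ρ) (g := ρ) fun j hj => mem_image_of_mem _ hj]
  refine sum_le_sum fun m hm => ?_
  obtain ⟨j, hj, rfl⟩ := mem_image.mp hm
  rw [hρ.filter_eq hj]
  refine le_trans (le_of_eq ?_) ((group_fiber hM hj).cost hL
    (mem_filter.mpr ⟨hρ.mem j hj, hρ.group j hj⟩)
    fun j' hj' => hρ.max j hj j' (mem_filter.mp hj').1 (mem_filter.mp hj').2)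
  refine sum_congr rfl fun j' hj' => ?_
  rw [hρ.eq j hj j' (mem_filter.mp hj').1 (mem_filter.mp hj').2]

-- Double counting of the weights 1 and 2 over the groups: at least half as many centers disappear
-- as there are half-open ones.
open Classical in
theorem IsChoice.card (hρ : IsChoice S M L ρ) (hM : IsMaxMatching S.Edge M) :
    2 * #(S.Z.image ρ) + #S.H ≤ 2 * #S.Z := by
  have h1 : ∑ j ∈ S.Z, (if j ∈ S.H then 1 else 2) + #S.H = 2 * #S.Z := by
    have h2 : #S.H = ∑ j ∈ S.Z, (if j ∈ S.H then 1 else 0) := by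
      rw [← sum_filter, filter_mem_eq_inter, inter_eq_right.mpr S.sub, card_eq_sum_ones]
    rw [h2, ← sum_add_distrib, mul_comm, card_eq_sum_ones, sum_mul]
    refine sum_congr rfl fun j _ => ?_
    split_ifs <;> rfl
  rw [← h1, ← sum_fiberwise_of_maps_to (t := S.Z.image ρ) (g := ρ)
    fun j hj => mem_image_of_mem _ hj]
  have h3 : #(S.Z.image ρ) * 2 ≤ ∑ m ∈ S.Z.image ρ, ∑ j ∈ S.Z with ρ j = m,
      (if j ∈ S.H then 1 else 2) := by
    rw [← smul_eq_mul]
    refine card_nsmul_le_sum _ _ _ fun m hm => ?_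
    obtain ⟨j, hj, rfl⟩ := mem_image.mp hm
    rw [hρ.filter_eq hj]
    exact (group_fiber hM hj).two_le
  omega

end

end Halves

open Finset

/-! ### The rounded solution -/

namespace CapMedian

/-- A clustering together with nearest other centers. -/
structure Rounding {F C : Type} [Fintype F] [LinearOrder C] (I : CapMedian F C)
    (x : F → C → ℝ) where
  Z : Finset C
  cl : F → C
  σ : C → C
  clus : I.IsClustering x Z cl
  σ_spec : ∀ j ∈ Z, (∃ j' ∈ Z, j' ≠ j) → σ j ∈ Z ∧ σ j ≠ j ∧
    ∀ j' ∈ Z, j' ≠ j → I.cc j (σ j) ≤ I.cc j j'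

namespace Rounding

set_option linter.unusedSectionVars false

variable {F C : Type} [Fintype F] [Fintype C] [LinearOrder F] [LinearOrder C]
  {I : CapMedian F C} {x : F → C → ℝ} (R : I.Rounding x) (y : F → ℝ) (ε : ℝ)

/-- The facilities near the center `j` in its cluster. -/
noncomputable def near (j : C) : Finset F := {i ∈ univ.filter (fun i => R.cl i = j) |
  I.d i j * dem x R.cl j * ε ≤ I.mov x R.cl j * (1 + ε)}

/-- The number of near facilities of the same cluster with larger capacity. -/
noncomputable def rank (i : F) : ℕ := rk (fun i => - I.u i) (R.near ε (R.cl i)) i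

/-- The candidates to be opened. -/
noncomputable def sel : Finset F :=
  {i | i ∈ R.near ε (R.cl i) ∧ R.rank ε i < max 1 ⌊vol y R.cl (R.cl i)⌋₊}

/-- The candidates of largest capacity in each cluster. -/
noncomputable def reps : Finset F := {i | i ∈ R.near ε (R.cl i) ∧ R.rank ε i = 0}

/-- The total capacity of the candidates in a cluster. -/
noncomputable def cap (j : C) : ℝ := ∑ i ∈ R.sel y ε with R.cl i = j, I.u i

/-- The share of the demand of its cluster that a candidate serves. -/
noncomputable def share (i : F) : ℝ := I.u i / R.cap y ε (R.cl i)

/-- The load of a candidate. -/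
noncomputable def load (i : F) : ℝ := R.share y ε i * dem x R.cl (R.cl i)

/-- The load of the largest candidate in a cluster. -/
noncomputable def repLoad (j : C) : ℝ := ∑ i ∈ R.reps ε with R.cl i = j, R.load y ε i

/-- The sparse clusters. -/
noncomputable def sparse : Finset C := {j ∈ R.Z | vol y R.cl j < 1}

/-- The cost of closing a sparse cluster. -/
noncomputable def closeCost (j : C) : ℝ := dem x R.cl j * I.cc j (R.σ j)

/-- The half-open clusters. -/
noncomputable def half : Finset C :=
  {j ∈ R.sparse y | rk R.closeCost (R.sparse y) j < 2 * #(R.sel y ε) - 2 * I.k}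

variable {R y ε}

theorem mem_near {i : F} {j : C} : i ∈ R.near ε j ↔
    R.cl i = j ∧ I.d i j * dem x R.cl j * ε ≤ I.mov x R.cl j * (1 + ε) := by
  simp [near]

theorem mem_reps {i : F} : i ∈ R.reps ε ↔ i ∈ R.near ε (R.cl i) ∧ R.rank ε i = 0 := by
  simp [reps]

theorem mem_sel {i : F} : i ∈ R.sel y ε ↔
    i ∈ R.near ε (R.cl i) ∧ R.rank ε i < max 1 ⌊vol y R.cl (R.cl i)⌋₊ := by
  simp [sel]

theorem near_dem (hx : I.Feasible 1 x y) (hε : 0 < ε) (j : C) :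
    dem x R.cl j ≤ (1 + ε) * ∑ i ∈ R.near ε j, ∑ c, x i c := by
  have h := sum_le_mul_sum_near (univ.filter fun i => R.cl i = j) (w := fun i => ∑ c, x i c)
    (d := fun i => I.d i j) hε (fun i _ => sum_nonneg fun c _ => hx.x_nonneg i c)
    (fun i _ => I.d_nonneg i j)
  have h1 : ∑ i with R.cl i = j, ∑ c, x i c = dem x R.cl j := by rw [dem_eq, sum_filter]
  have h2 : ∑ i with R.cl i = j, I.d i j * ∑ c, x i c = I.mov x R.cl j := by rw [mov, sum_filter]
  rw [h1, h2] at h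
  exact h

/-- If no facility were near, the demand of the cluster would be 0. But then the test defining
nearness holds for every facility of the cluster, so the cluster would be empty, against volume at
least 1/2. -/
theorem near_nonempty (hx : I.Feasible 1 x y) (hε : 0 < ε) {j : C} (hj : j ∈ R.Z) :
    (R.near ε j).Nonempty := by
  by_contra hne
  rw [not_nonempty_iff_eq_empty] at hne
  have h1 := near_dem (R := R) hx hε j
  rw [hne, sum_empty, mul_zero] at h1
  have h2 : dem x R.cl j = 0 := le_antisymm h1 (dem_nonneg hx _ _)
  have h3 := half_le_vol hx R.clus hj
  have h4 : vol y R.cl j = 0 := by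
    refine sum_eq_zero fun i _ => ?_
    rw [if_neg]
    intro hi
    have : i ∈ R.near ε j := mem_near.mpr ⟨hi, by
      rw [h2, mul_zero, zero_mul]; exact mul_nonneg (mov_nonneg hx _ _) (by linarith)⟩
    rw [hne] at this
    simp at this
  linarith

theorem reps_subset : R.reps ε ⊆ R.sel y ε := by
  intro i hi
  rw [mem_reps] at hi
  rw [mem_sel]
  exact ⟨hi.1, by rw [hi.2]; exact lt_max_of_lt_left one_pos⟩

theorem reps_injOn : Set.InjOn R.cl (R.reps ε) := by
  intro i hi i' hi' h
  rw [mem_coe, mem_reps, rank] at hi hi'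
  rw [h] at hi
  exact rk_injOn _ _ hi.1 hi'.1 (hi.2.trans hi'.2.symm)

theorem reps_image (hx : I.Feasible 1 x y) (hε : 0 < ε) : (R.reps ε).image R.cl = R.Z := by
  ext j
  simp only [mem_image]
  constructor
  · rintro ⟨i, -, rfl⟩; exact R.clus.mem i
  · intro hj
    obtain ⟨i, hi, hmin⟩ := exists_first (fun i => - I.u i) (near_nonempty hx hε hj)
    obtain rfl := (mem_near.mp hi).1
    refine ⟨i, ?_, rfl⟩
    rw [mem_reps, rank]
    exact ⟨hi, rk_eq_zero.mpr hmin⟩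

theorem sum_reps (hx : I.Feasible 1 x y) (hε : 0 < ε) (f : C → ℝ) :
    ∑ i ∈ R.reps ε, f (R.cl i) = ∑ j ∈ R.Z, f j := by
  rw [← reps_image hx hε, sum_image reps_injOn]

theorem card_reps (hx : I.Feasible 1 x y) (hε : 0 < ε) : #(R.reps ε) = #R.Z := by
  rw [← reps_image hx hε, card_image_of_injOn reps_injOn]

theorem sum_reps_cl {i : F} (hi : i ∈ R.reps ε) (f : F → ℝ) :
    ∑ i' ∈ R.reps ε with R.cl i' = R.cl i, f i' = f i := by
  have : (R.reps ε).filter (fun i' => R.cl i' = R.cl i) = {i} := by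
    ext i'
    simp only [mem_filter, mem_singleton]
    constructor
    · rintro ⟨h, h'⟩; exact reps_injOn h hi h'
    · rintro rfl; exact ⟨hi, rfl⟩
  rw [this, sum_singleton]

theorem sel_cl (j : C) : (R.sel y ε).filter (fun i => R.cl i = j) =
    {i ∈ R.near ε j | rk (fun i => - I.u i) (R.near ε j) i < max 1 ⌊vol y R.cl j⌋₊} := by
  ext i
  simp only [mem_filter, mem_sel, rank]
  constructor
  · rintro ⟨h, rfl⟩; exact h
  · intro h
    obtain rfl := (mem_near.mp h.1).1
    exact ⟨h, rfl⟩

theorem cap_nonneg (j : C) : 0 ≤ R.cap y ε j := sum_nonneg fun i _ => I.u_nonneg i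

theorem share_nonneg (i : F) : 0 ≤ R.share y ε i := div_nonneg (I.u_nonneg i) (cap_nonneg _)

theorem load_nonneg (hx : I.Feasible 1 x y) (i : F) : 0 ≤ R.load y ε i :=
  mul_nonneg (share_nonneg _) (dem_nonneg hx _ _)

theorem repLoad_nonneg (hx : I.Feasible 1 x y) (j : C) : 0 ≤ R.repLoad y ε j :=
  sum_nonneg fun i _ => load_nonneg hx i

theorem repLoad_cl {i : F} (hi : i ∈ R.reps ε) : R.repLoad y ε (R.cl i) = R.load y ε i :=
  sum_reps_cl hi _

/-- The near facilities carry all but a factor `1 + ε` of the demand, each at most `u i * y i`, and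
their total opening is at most `κ` times the number of candidates asked for. -/
theorem dem_le_cap (hx : I.Feasible 1 x y) (hε : 0 < ε) {j : C} {κ : ℝ}
    (hκ : 1 ≤ κ) (hκ' : vol y R.cl j ≤ κ * (max 1 ⌊vol y R.cl j⌋₊ : ℕ)) :
    dem x R.cl j ≤ (1 + ε) * (κ * R.cap y ε j) := by
  refine (near_dem hx hε j).trans (mul_le_mul_of_nonneg_left ?_ (by linarith))
  have h := sum_le_mul_cap (N := R.near ε j) (w := fun i => ∑ c, x i c) (u := I.u) (y := y)
    (M := max 1 ⌊vol y R.cl j⌋₊) (Y := vol y R.cl j) (κ := κ) (le_max_left _ _)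
    (fun i _ => I.u_nonneg i) (fun i _ => by simpa using hx.capacity i)
    (fun i _ => hx.y_le_one i) (fun i _ => hx.y_nonneg i) ?_ hκ hκ'
  · rw [cap, sel_cl]
    convert h
  · rw [vol, ← sum_filter]
    exact sum_le_sum_of_subset_of_nonneg (filter_subset _ _) fun i _ _ => hx.y_nonneg i

theorem dem_le_cap_sparse (hx : I.Feasible 1 x y) (hε : 0 < ε) {j : C} (hj : vol y R.cl j < 1) :
    dem x R.cl j ≤ (1 + ε) * (1 * R.cap y ε j) := by
  refine dem_le_cap hx hε le_rfl ?_
  rw [one_mul]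
  have : (1 : ℝ) ≤ (max 1 ⌊vol y R.cl j⌋₊ : ℕ) := by exact_mod_cast le_max_left _ _
  linarith

theorem dem_le_cap_two (hx : I.Feasible 1 x y) (hε : 0 < ε) (j : C) :
    dem x R.cl j ≤ (1 + ε) * (2 * R.cap y ε j) := by
  refine dem_le_cap hx hε one_le_two ?_
  have h1 : (1 : ℝ) ≤ (max 1 ⌊vol y R.cl j⌋₊ : ℕ) := by exact_mod_cast le_max_left _ _
  have h2 : (⌊vol y R.cl j⌋₊ : ℝ) ≤ (max 1 ⌊vol y R.cl j⌋₊ : ℕ) := by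
    exact_mod_cast le_max_right _ _
  linarith [Nat.lt_floor_add_one (vol y R.cl j)]

/-- If the total capacity is 0, the share is a division by zero, hence 0, and the bound is trivial.
-/
theorem load_le {i : F} {κ : ℝ} (hκ : 0 ≤ κ)
    (h : dem x R.cl (R.cl i) ≤ κ * R.cap y ε (R.cl i)) : R.load y ε i ≤ κ * I.u i := by
  rw [load, share]
  rcases (cap_nonneg (R := R) (y := y) (ε := ε) (R.cl i)).eq_or_lt with h0 | h0
  · rw [← h0, div_zero, zero_mul]; exact mul_nonneg hκ (I.u_nonneg i)
  · rw [div_mul_eq_mul_div, div_le_iff₀ h0]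
    nlinarith [I.u_nonneg i]

theorem sum_share (j : C) (hj : R.cap y ε j ≠ 0) :
    ∑ i ∈ R.sel y ε with R.cl i = j, R.share y ε i = 1 := by
  have : ∀ i ∈ (R.sel y ε).filter (fun i => R.cl i = j), R.share y ε i = I.u i / R.cap y ε j := by
    intro i hi
    rw [share, (mem_filter.mp hi).2]
  rw [sum_congr rfl this, ← sum_div, ← cap, div_self hj]

theorem sum_share_le (j : C) : ∑ i ∈ R.sel y ε with R.cl i = j, R.share y ε i ≤ 1 := by
  by_cases hj : R.cap y ε j = 0
  · refine le_trans (le_of_eq ?_) zero_le_one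
    refine sum_eq_zero fun i hi => ?_
    rw [share, (mem_filter.mp hi).2, hj, div_zero]
  · exact (sum_share j hj).le

/-- Shares add up to 1 unless the total capacity is 0; in that case the cluster serves no demand, so
nothing is lost. -/
theorem sum_share_mul_part (hx : I.Feasible 1 x y) (hε : 0 < ε) (j c : C) :
    (∑ i ∈ R.sel y ε with R.cl i = j, R.share y ε i) * part x R.cl j c = part x R.cl j c := by
  by_cases hj : R.cap y ε j = 0
  · have h1 := dem_le_cap_two (R := R) hx hε j
    rw [hj, mul_zero, mul_zero] at h1
    have h2 : dem x R.cl j = 0 := le_antisymm h1 (dem_nonneg hx _ _)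
    rw [dem, sum_eq_zero_iff_of_nonneg fun c _ => part_nonneg hx _ _ _] at h2
    rw [h2 c (mem_univ c), mul_zero]
  · rw [sum_share j hj, one_mul]

/-- Sums over the candidates, cluster by cluster. -/
theorem sum_sel (f : F → ℝ) : ∑ i ∈ R.sel y ε, f i =
    ∑ j ∈ R.Z, ∑ i ∈ R.sel y ε with R.cl i = j, f i :=
  (sum_fiberwise_of_maps_to (fun i _ => R.clus.mem i) _).symm

theorem sum_sel_share (f : C → ℝ) : ∑ i ∈ R.sel y ε, R.share y ε i * f (R.cl i) =
    ∑ j ∈ R.Z, (∑ i ∈ R.sel y ε with R.cl i = j, R.share y ε i) * f j := by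
  rw [sum_sel]
  refine sum_congr rfl fun j _ => ?_
  rw [sum_mul]
  refine sum_congr rfl fun i hi => ?_
  rw [(mem_filter.mp hi).2]

theorem sum_sel_share_le {f : C → ℝ} (hf : ∀ j, 0 ≤ f j) :
    ∑ i ∈ R.sel y ε, R.share y ε i * f (R.cl i) ≤ ∑ j ∈ R.Z, f j := by
  rw [sum_sel_share]
  exact sum_le_sum fun j _ => mul_le_of_le_one_left (hf j) (sum_share_le j)

theorem card_sel_cl_le (j : C) :
    #((R.sel y ε).filter fun i => R.cl i = j) ≤ max 1 ⌊vol y R.cl j⌋₊ := by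
  rw [sel_cl]
  have := card_rk_lt (fun i => - I.u i) (R.near ε j) (max 1 ⌊vol y R.cl j⌋₊)
  refine le_trans (le_of_eq ?_) (this.le.trans (min_le_left _ _))
  congr!

/-- A cluster has at most `⌊vol⌋` candidates, or one if it is sparse; so only sparse clusters exceed
their volume, by at most `1 - vol`. -/
theorem two_card_sel_le (hx : I.Feasible 1 x y) :
    (2 * #(R.sel y ε) - 2 * I.k : ℝ) ≤ ∑ j ∈ R.sparse y, 2 * (1 - vol y R.cl j) := by
  have h1 : (#(R.sel y ε) : ℝ) = ∑ j ∈ R.Z, (#((R.sel y ε).filter fun i => R.cl i = j) : ℝ) := by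
    rw [card_eq_sum_card_fiberwise (fun i _ => R.clus.mem i)]; push_cast; rfl
  have h2 : ∀ j ∈ R.Z, (#((R.sel y ε).filter fun i => R.cl i = j) : ℝ) ≤
      vol y R.cl j + if vol y R.cl j < 1 then 1 - vol y R.cl j else 0 := by
    intro j _
    have h3 := card_sel_cl_le (R := R) (y := y) (ε := ε) j
    have h0 : 0 ≤ vol y R.cl j := sum_nonneg fun i _ => by
      split_ifs; exacts [hx.y_nonneg i, le_rfl]
    split_ifs with h
    · rw [Nat.floor_eq_zero.mpr h, max_eq_left zero_le_one] at h3
      have : (#((R.sel y ε).filter fun i => R.cl i = j) : ℝ) ≤ 1 := by exact_mod_cast h3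
      linarith
    · have h4 : 1 ≤ ⌊vol y R.cl j⌋₊ := Nat.le_floor (by simpa using h)
      rw [max_eq_right h4] at h3
      have h5 : (#((R.sel y ε).filter fun i => R.cl i = j) : ℝ) ≤ ⌊vol y R.cl j⌋₊ := by
        exact_mod_cast h3
      linarith [Nat.floor_le h0]
  have h3 : ∑ j ∈ R.Z, vol y R.cl j ≤ I.k := by
    refine le_trans (le_of_eq ?_) hx.sum_open
    rw [← sum_vol y R.cl]
    exact sum_subset (subset_univ _) fun j _ hj => vol_eq_zero R.clus hj
  have h4 := sum_le_sum h2
  rw [← h1, sum_add_distrib, ← sum_filter] at h4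
  rw [sparse, ← mul_sum]
  linarith

/-- The weights `2 (1 - vol)` lie in [0, 1] because volumes of clusters are at least 1/2, and their
sum is at least the number of clusters wanted. So the cheapest clusters cost no more than this
fractional choice, which is 2 · 12 LP costs, and there are enough sparse clusters to choose from. -/
theorem sum_half_le (hx : I.Feasible 1 x y) :
    ∑ j ∈ R.half y ε, R.closeCost j ≤ 24 * I.cost x ∧
      2 * #(R.sel y ε) ≤ 2 * I.k + #(R.half y ε) := by
  have h2 := two_card_sel_le (R := R) (ε := ε) hx
  have hcast : ((2 * #(R.sel y ε) - 2 * I.k : ℕ) : ℝ) ≤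
      ∑ j ∈ R.sparse y, 2 * (1 - vol y R.cl j) := by
    rcases le_total (2 * I.k) (2 * #(R.sel y ε)) with h | h
    · rw [Nat.cast_sub h]; push_cast; exact h2
    · rw [Nat.sub_eq_zero_of_le h, Nat.cast_zero]
      exact sum_nonneg fun j hj => by linarith [(mem_filter.mp hj).2]
  have ha1 : ∀ j ∈ R.sparse y, 2 * (1 - vol y R.cl j) ≤ 1 := fun j hj => by
    linarith [half_le_vol hx R.clus (mem_filter.mp hj).1]
  constructor
  · have h := sum_first_le (P := R.sparse y) (key := R.closeCost)
      (a := fun j => 2 * (1 - vol y R.cl j)) (K := 2 * #(R.sel y ε) - 2 * I.k)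
      (fun j _ => mul_nonneg (dem_nonneg hx _ _) (I.cc_nonneg _ _))
      (fun j hj => by linarith [(mem_filter.mp hj).2]) ha1 hcast
    have h3 := sum_sparse hx R.clus (P := R.sparse y) (e := fun j => I.cc j (R.σ j))
      (fun j _ => I.cc_nonneg _ _) (fun j hj j' hj' hne =>
        (R.σ_spec j (mem_filter.mp hj).1 ⟨j', hj', hne⟩).2.2 j' hj' hne)
    have h4 : ∑ j ∈ R.sparse y, 2 * (1 - vol y R.cl j) * R.closeCost j =
        2 * ∑ j ∈ R.sparse y, (1 - vol y R.cl j) * (dem x R.cl j * I.cc j (R.σ j)) := by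
      rw [mul_sum]; exact sum_congr rfl fun j _ => by rw [closeCost]; ring
    rw [h4] at h
    refine le_trans (le_of_eq ?_) (h.trans (by linarith))
    rw [half]
  · have h5 : #(R.half y ε) = min (2 * #(R.sel y ε) - 2 * I.k) #(R.sparse y) := by
      rw [half, ← card_rk_lt R.closeCost]
    have h6 : 2 * #(R.sel y ε) - 2 * I.k ≤ #(R.sparse y) := by
      have := hcast.trans (sum_le_sum ha1)
      rw [sum_const, nsmul_eq_mul, mul_one] at this
      exact_mod_cast this
    omega

/-- The half-open centers with their nearest other centers. -/
noncomputable def halves (R : I.Rounding x) (ε : ℝ) (hx : I.Feasible 1 x y) : Halves C where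
  Z := R.Z
  H := R.half y ε
  δ := I.cc
  e j := I.cc j (R.σ j)
  σ := R.σ
  sub := fun j hj => (mem_filter.mp (mem_filter.mp hj).1).1
  δ_nonneg := I.cc_nonneg
  δ_self := fun _ => I.dist_self _
  δ_comm := I.cc_comm
  δ_tri := I.cc_triangle
  σ_mem := fun j hj => by
    obtain ⟨hj, hv⟩ := mem_filter.mp (mem_filter.mp hj).1
    exact (R.σ_spec j hj (exists_other hx R.clus hv)).1
  σ_ne := fun j hj => by
    obtain ⟨hj, hv⟩ := mem_filter.mp (mem_filter.mp hj).1
    exact (R.σ_spec j hj (exists_other hx R.clus hv)).2.1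
  δ_σ := fun _ _ => rfl
  e_le := fun j hj j' hj' hne =>
    (R.σ_spec j (mem_filter.mp (mem_filter.mp hj).1).1 ⟨j', hj', hne⟩).2.2 j' hj' hne

/-- `τ` sends the largest candidate of a cluster to the one of the cluster chosen by `ρ`. -/
structure IsTarget (R : I.Rounding x) (ε : ℝ) (ρ : C → C) (τ : F → F) : Prop where
  of_mem : ∀ i ∈ R.reps ε, τ i ∈ R.reps ε ∧ R.cl (τ i) = ρ (R.cl i)
  of_not_mem : ∀ i, i ∉ R.reps ε → τ i = i

variable (R y ε) in
/-- The rounded assignment. -/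
noncomputable def xbar (τ : F → F) (i : F) (c : C) : ℝ :=
  ∑ i' ∈ R.sel y ε with τ i' = i, R.share y ε i' * part x R.cl (R.cl i') c

variable (R y ε) in
/-- The rounded opening. -/
noncomputable def ybar (τ : F → F) (i : F) : ℝ := if i ∈ (R.sel y ε).image τ then 1 else 0

variable {hx : I.Feasible 1 x y} {M : C → C → Prop} {ρ : C → C} {τ : F → F}

/-- Candidates other than the largest ones stay open, and of the largest ones at most one per group
survives. The number of closed facilities is at least half the number of half-open clusters, which
is the excess. -/
theorem sum_ybar_le (hε : 0 < ε) (hM : IsMaxMatching (R.halves ε hx).Edge M)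
    (hρ : (R.halves ε hx).IsChoice M (R.repLoad y ε) ρ) (hτ : R.IsTarget ε ρ τ) :
    ∑ i, R.ybar y ε τ i ≤ I.k := by
  classical
  have h1 : ∑ i, R.ybar y ε τ i = #((R.sel y ε).image τ) := by
    simp only [ybar]; rw [sum_boole, filter_mem_eq_inter, univ_inter]
  have h2 : (R.sel y ε).image τ ⊆ (R.sel y ε \ R.reps ε) ∪ (R.reps ε).image τ := by
    intro i hi
    obtain ⟨i', hi', rfl⟩ := mem_image.mp hi
    by_cases h : i' ∈ R.reps ε
    · exact mem_union_right _ (mem_image_of_mem _ h)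
    · rw [hτ.of_not_mem i' h]; exact mem_union_left _ (mem_sdiff.mpr ⟨hi', h⟩)
  have h3 : #((R.reps ε).image τ) ≤ #(R.Z.image ρ) := by
    have hsub : (R.reps ε).image τ ⊆ R.reps ε := by
      intro i hi
      obtain ⟨i', hi', rfl⟩ := mem_image.mp hi
      exact (hτ.of_mem i' hi').1
    rw [← card_image_of_injOn (reps_injOn.mono hsub)]
    refine card_le_card fun j hj => ?_
    obtain ⟨i, hi, rfl⟩ := mem_image.mp hj
    obtain ⟨i', hi', rfl⟩ := mem_image.mp hi
    rw [(hτ.of_mem i' hi').2]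
    exact mem_image_of_mem _ (R.clus.mem _)
  have h4 := (card_le_card h2).trans (card_union_le _ _)
  rw [card_sdiff_of_subset reps_subset, card_reps hx hε] at h4
  have h5 := (sum_half_le (R := R) (ε := ε) hx).2
  have h6 : 2 * #(R.Z.image ρ) + #(R.half y ε) ≤ 2 * #R.Z := by
    have := hρ.card hM
    simp only [halves] at this
    convert this
  have h7 : #R.Z ≤ #(R.sel y ε) := by
    rw [← card_reps hx hε]; exact card_le_card reps_subset
  rw [h1]
  have : #((R.sel y ε).image τ) ≤ I.k := by omega
  exact_mod_cast this

theorem xbar_nonneg (hx : I.Feasible 1 x y) (i : F) (c : C) : 0 ≤ R.xbar y ε τ i c :=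
  sum_nonneg fun _ _ => mul_nonneg (share_nonneg _) (part_nonneg hx _ _ _)

theorem sum_xbar_mul (f : F → C → ℝ) (c : C) : ∑ i, f i c * R.xbar y ε τ i c =
    ∑ i ∈ R.sel y ε, R.share y ε i * (part x R.cl (R.cl i) c * f (τ i) c) := by
  have h1 : ∀ i, f i c * R.xbar y ε τ i c = ∑ i' ∈ R.sel y ε with τ i' = i,
      R.share y ε i' * (part x R.cl (R.cl i') c * f (τ i') c) := by
    intro i
    rw [xbar, mul_sum]
    refine sum_congr rfl fun i' hi' => ?_
    rw [(mem_filter.mp hi').2]; ring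
  simp only [h1]
  exact sum_fiberwise _ _ _

theorem sum_xbar (hx : I.Feasible 1 x y) (hε : 0 < ε) (c : C) : ∑ i, R.xbar y ε τ i c = 1 := by
  have h := sum_xbar_mul (R := R) (y := y) (ε := ε) (τ := τ) (fun _ _ => 1) c
  simp only [one_mul, mul_one] at h
  rw [h, sum_sel_share (fun j => part x R.cl j c), ← sum_part hx R.cl c,
    sum_congr rfl fun j _ => sum_share_mul_part hx hε j c]
  exact sum_subset (subset_univ _) fun j _ hj => part_eq_zero R.clus hj c

theorem sum_xbar_cap (i : F) : ∑ c, R.xbar y ε τ i c =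
    ∑ i' ∈ R.sel y ε with τ i' = i, R.load y ε i' := by
  simp only [xbar]
  rw [sum_comm]
  refine sum_congr rfl fun i' _ => ?_
  rw [← mul_sum, load, dem]

/-- Only largest candidates are redirected, so a surviving one receives exactly the loads of those
whose cluster is sent to its own. -/
theorem sum_load_rep (hx : I.Feasible 1 x y) (hε : 0 < ε) (hτ : R.IsTarget ε ρ τ) {i : F}
    (hi : i ∈ R.reps ε) : ∑ i' ∈ R.sel y ε with τ i' = i, R.load y ε i' =
      ∑ j ∈ R.Z with ρ j = R.cl i, R.repLoad y ε j := by
  rw [sum_filter (s := R.Z), ← sum_reps hx hε, ← sum_filter]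
  have : (R.sel y ε).filter (fun i' => τ i' = i) =
      (R.reps ε).filter fun i' => ρ (R.cl i') = R.cl i := by
    ext i'
    simp only [mem_filter]
    constructor
    · rintro ⟨-, rfl⟩
      by_cases h : i' ∈ R.reps ε
      · exact ⟨h, (hτ.of_mem i' h).2.symm⟩
      · rw [hτ.of_not_mem i' h] at hi; exact absurd hi h
    · rintro ⟨h, h'⟩
      refine ⟨reps_subset h, reps_injOn (hτ.of_mem i' h).1 hi ?_⟩
      rw [(hτ.of_mem i' h).2, h']
  rw [this]
  exact sum_congr rfl fun i' hi' => (repLoad_cl (mem_filter.mp hi').1).symm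

/-- Three cases: a surviving largest candidate in a sparse cluster gets 3 times a load of at most
`(1 + ε) u`; one in a cluster of volume at least 1, which is not half-open, gets 3/2 times at most
`2 (1 + ε) u`; any other candidate keeps at most `2 (1 + ε) u`. -/
theorem sum_xbar_le (hε : 0 < ε) (hM : IsMaxMatching (R.halves ε hx).Edge M)
    (hρ : (R.halves ε hx).IsChoice M (R.repLoad y ε) ρ) (hτ : R.IsTarget ε ρ τ) (i : F) :
    ∑ c, R.xbar y ε τ i c ≤ (3 + 3 * ε) * I.u i * R.ybar y ε τ i := by
  rw [sum_xbar_cap]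
  by_cases hi : i ∈ (R.sel y ε).image τ
  · rw [ybar, if_pos hi, mul_one]
    have h2 : R.load y ε i ≤ (1 + ε) * 2 * I.u i := load_le (by linarith) (by
      rw [mul_assoc]; exact dem_le_cap_two hx hε _)
    by_cases hr : i ∈ R.reps ε
    · rw [sum_load_rep hx hε hτ hr]
      have h3 := hρ.load hM (fun j => repLoad_nonneg hx j) (R.cl i)
      rw [repLoad_cl hr] at h3
      by_cases hv : vol y R.cl (R.cl i) < 1
      · have h1 : R.load y ε i ≤ (1 + ε) * 1 * I.u i := load_le (by linarith) (by
          rw [mul_assoc]; exact dem_le_cap_sparse hx hε hv)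
        refine le_trans ?_ (h3.1.trans (by linarith))
        apply le_of_eq
        simp only [halves]
      · have hH : R.cl i ∉ (R.halves ε hx).H := fun h =>
          hv (mem_filter.mp (mem_filter.mp h).1).2
        refine le_trans ?_ ((h3.2 hH).trans (by linarith))
        apply le_of_eq
        simp only [halves]
    · have : (R.sel y ε).filter (fun i' => τ i' = i) ⊆ {i} := by
        intro i' hi'
        obtain ⟨-, h⟩ := mem_filter.mp hi'
        rw [mem_singleton]
        by_cases h' : i' ∈ R.reps ε
        · exact absurd (h ▸ (hτ.of_mem i' h').1) hr
        · rw [← h, hτ.of_not_mem i' h']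
      have h4 := sum_le_sum_of_subset_of_nonneg this fun i' _ _ =>
        load_nonneg (R := R) (ε := ε) hx i'
      rw [sum_singleton] at h4
      nlinarith [mul_nonneg hε.le (I.u_nonneg i), I.u_nonneg i]
  · rw [ybar, if_neg hi, mul_zero]
    apply le_of_eq
    refine sum_eq_zero fun i' hi' => ?_
    exact absurd (mem_image.mpr ⟨i', (mem_filter.mp hi').1, (mem_filter.mp hi').2⟩) hi

theorem isIntegralSolution (hε : 0 < ε) (hM : IsMaxMatching (R.halves ε hx).Edge M)
    (hρ : (R.halves ε hx).IsChoice M (R.repLoad y ε) ρ) (hτ : R.IsTarget ε ρ τ) :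
    I.IsIntegralSolution (3 + 3 * ε) (R.xbar y ε τ) (R.ybar y ε τ) where
  left :=
    { sum_open := sum_ybar_le hε hM hρ hτ
      served := sum_xbar hx hε
      assign_le := fun i c => by
        rw [ybar]
        split_ifs with h
        · rw [← sum_xbar (R := R) (τ := τ) hx hε c]
          exact single_le_sum (f := fun i => R.xbar y ε τ i c) (fun i _ => xbar_nonneg hx i c)
            (mem_univ i)
        · apply le_of_eq
          refine sum_eq_zero fun i' hi' => ?_
          exact absurd (mem_image.mpr ⟨i', (mem_filter.mp hi').1, (mem_filter.mp hi').2⟩) h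
      capacity := sum_xbar_le hε hM hρ hτ
      x_nonneg := xbar_nonneg hx
      y_nonneg := fun i => by rw [ybar]; split_ifs <;> norm_num
      y_le_one := fun i => by rw [ybar]; split_ifs <;> norm_num }
  right := fun i => by rw [ybar]; split_ifs <;> simp

/-- Candidates are near: their distance times the demand of the cluster is at most `(1 + 1/ε)` times
the moving cost of the cluster. The shares distribute this cost with total at most 1, and all moving
costs together are 5 LP costs. -/
theorem sum_load_mul_d_le (hx : I.Feasible 1 x y) (hε : 0 < ε) :
    ∑ i ∈ R.sel y ε, R.load y ε i * I.d i (R.cl i) ≤ (1 + 1 / ε) * (5 * I.cost x) := by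
  have h1 : ∀ i ∈ R.sel y ε, R.load y ε i * I.d i (R.cl i) ≤
      R.share y ε i * ((1 + 1 / ε) * I.mov x R.cl (R.cl i)) := by
    intro i hi
    have h := (mem_near.mp (mem_filter.mp hi).2.1).2
    rw [load, mul_assoc]
    refine mul_le_mul_of_nonneg_left ?_ (share_nonneg i)
    have h2 : (1 + 1 / ε) * I.mov x R.cl (R.cl i) = I.mov x R.cl (R.cl i) * (1 + ε) / ε := by
      field_simp; ring
    rw [h2, le_div_iff₀ hε]
    linarith
  have hε' : 0 ≤ 1 + 1 / ε := by positivity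
  refine (sum_le_sum h1).trans ((sum_sel_share_le fun j =>
    mul_nonneg hε' (mov_nonneg hx R.cl j)).trans ?_)
  rw [← mul_sum]
  refine mul_le_mul_of_nonneg_left ?_ hε'
  exact (sum_le_sum_of_subset_of_nonneg (subset_univ _) fun j _ _ => mov_nonneg hx R.cl j).trans
    (sum_mov hx R.clus)

theorem repLoad_le_dem (hx : I.Feasible 1 x y) (hε : 0 < ε) {j : C} (hj : j ∈ R.Z) :
    R.repLoad y ε j ≤ dem x R.cl j := by
  rw [← reps_image hx hε] at hj
  obtain ⟨i, hi, rfl⟩ := mem_image.mp hj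
  rw [repLoad_cl hi, load]
  refine mul_le_of_le_one_left (dem_nonneg hx _ _) ?_
  refine le_trans ?_ (sum_share_le (R := R) (y := y) (ε := ε) (R.cl i))
  exact single_le_sum (f := R.share y ε) (fun i _ => share_nonneg i)
    (mem_filter.mpr ⟨reps_subset hi, rfl⟩)

/-- Demand travels from the client to the center of the serving cluster (6), from there to the
center chosen in the group (72), and finally to the surviving facility, `3 · 5 (1 + 1/ε)`. -/
theorem cost_xbar_le (hε : 0 < ε) (hM : IsMaxMatching (R.halves ε hx).Edge M)
    (hρ : (R.halves ε hx).IsChoice M (R.repLoad y ε) ρ) (hτ : R.IsTarget ε ρ τ) :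
    I.cost (R.xbar y ε τ) ≤ (93 + 15 / ε) * I.cost x := by
  classical
  -- For a center, the distance to the largest candidate of its cluster, written as a sum with a
  -- single term.
  set dm : C → ℝ := fun j => ∑ i ∈ R.reps ε with R.cl i = j, I.d i (R.cl i) with hdm
  have hdm0 : ∀ j, 0 ≤ dm j := fun j => sum_nonneg fun i _ => I.d_nonneg _ _
  have hdmcl : ∀ i ∈ R.reps ε, dm (R.cl i) = I.d i (R.cl i) := fun i hi => sum_reps_cl hi _
  have h1 : I.cost (R.xbar y ε τ) ≤
      ∑ i ∈ R.sel y ε, R.share y ε i * ∑ c, part x R.cl (R.cl i) c * I.cc (R.cl i) c +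
      ∑ i ∈ R.sel y ε, R.load y ε i * I.d (τ i) (R.cl i) := by
    rw [cost, sum_comm, sum_congr rfl fun c _ => sum_xbar_mul (fun i c => I.d i c) c, sum_comm,
      ← sum_add_distrib]
    refine sum_le_sum fun i _ => ?_
    rw [← mul_sum, load, dem, mul_assoc, ← mul_add, sum_mul, ← sum_add_distrib]
    refine mul_le_mul_of_nonneg_left (sum_le_sum fun c _ => ?_) (share_nonneg i)
    rw [← mul_add]
    refine mul_le_mul_of_nonneg_left ?_ (part_nonneg hx _ _ _)
    linarith [I.d_le_d_add_cc (τ i) (R.cl i) c]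
  have h2 : ∑ i ∈ R.sel y ε, R.share y ε i * ∑ c, part x R.cl (R.cl i) c * I.cc (R.cl i) c ≤
      6 * I.cost x := by
    have hnn : ∀ j, 0 ≤ ∑ c, part x R.cl j c * I.cc j c := fun j =>
      sum_nonneg fun c _ => mul_nonneg (part_nonneg hx _ _ _) (I.cc_nonneg _ _)
    refine (sum_sel_share_le hnn).trans ((sum_le_sum_of_subset_of_nonneg (subset_univ _)
      fun j _ _ => hnn j).trans ?_)
    rw [sum_comm]
    exact sum_part_mul_cc hx R.clus
  have h3 : ∑ i ∈ R.reps ε, R.load y ε i * I.d (τ i) (R.cl i) ≤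
      ∑ j ∈ R.Z, R.repLoad y ε j * I.cc j (ρ j) + ∑ j ∈ R.Z, R.repLoad y ε j * dm (ρ j) := by
    rw [← sum_add_distrib, ← sum_reps hx hε]
    refine sum_le_sum fun i hi => ?_
    rw [repLoad_cl hi, ← mul_add]
    refine mul_le_mul_of_nonneg_left ?_ (load_nonneg hx i)
    obtain ⟨ht, ht'⟩ := hτ.of_mem i hi
    rw [← ht', hdmcl _ ht, I.cc_comm]
    linarith [I.d_le_d_add_cc (τ i) (R.cl (τ i)) (R.cl i)]
  have h4 : ∑ j ∈ R.Z, R.repLoad y ε j * I.cc j (ρ j) ≤ 72 * I.cost x := by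
    have h5 := hρ.cost hM fun j => repLoad_nonneg hx j
    have h6 : ∑ j ∈ R.half y ε, R.repLoad y ε j * I.cc j (R.σ j) ≤
        ∑ j ∈ R.half y ε, R.closeCost j := sum_le_sum fun j hj =>
      mul_le_mul_of_nonneg_right
        (repLoad_le_dem hx hε (mem_filter.mp (mem_filter.mp hj).1).1) (I.cc_nonneg _ _)
    simp only [halves] at h5
    linarith [(sum_half_le (R := R) (ε := ε) hx).1]
  -- The last leg is the one the surviving candidate already pays for its own load, and the load of
  -- the whole group is at most 3 times that.
  have h5 : ∑ j ∈ R.Z, R.repLoad y ε j * dm (ρ j) ≤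
      ∑ i ∈ R.reps ε, 3 * (R.load y ε i * I.d i (R.cl i)) := by
    have h6 : ∀ i ∈ R.reps ε, 3 * (R.load y ε i * I.d i (R.cl i)) =
        3 * (R.repLoad y ε (R.cl i) * dm (R.cl i)) := fun i hi => by
      rw [repLoad_cl hi, hdmcl i hi]
    rw [sum_congr rfl h6, sum_reps hx hε fun j => 3 * (R.repLoad y ε j * dm j),
      ← sum_fiberwise_of_maps_to (s := R.Z) (t := R.Z) (g := ρ) fun j hj => hρ.mem j hj]
    refine sum_le_sum fun m _ => ?_
    have h7 := (hρ.load hM (fun j => repLoad_nonneg hx j) m).1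
    simp only [halves] at h7
    calc ∑ j ∈ R.Z with ρ j = m, R.repLoad y ε j * dm (ρ j)
        = (∑ j ∈ R.Z with ρ j = m, R.repLoad y ε j) * dm m := by
          rw [sum_mul]; exact sum_congr rfl fun j hj => by rw [(mem_filter.mp hj).2]
      _ ≤ (3 * R.repLoad y ε m) * dm m := by
          refine mul_le_mul_of_nonneg_right (le_trans (le_of_eq ?_) h7) (hdm0 m)
          congr!
      _ = _ := by ring
  have h6 : ∑ i ∈ R.sel y ε \ R.reps ε, R.load y ε i * I.d (τ i) (R.cl i) ≤
      ∑ i ∈ R.sel y ε \ R.reps ε, 3 * (R.load y ε i * I.d i (R.cl i)) := by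
    refine sum_le_sum fun i hi => ?_
    rw [hτ.of_not_mem i (mem_sdiff.mp hi).2]
    linarith [mul_nonneg (load_nonneg (R := R) (ε := ε) hx i) (I.d_nonneg i (R.cl i))]
  have h7 := sum_sdiff (reps_subset (R := R) (y := y) (ε := ε))
    (f := fun i => R.load y ε i * I.d (τ i) (R.cl i))
  have h8 := sum_sdiff (reps_subset (R := R) (y := y) (ε := ε))
    (f := fun i => 3 * (R.load y ε i * I.d i (R.cl i)))
  simp only [← mul_sum] at h5 h6 h8
  have h9 := sum_load_mul_d_le (R := R) hx hε
  have h10 : (93 + 15 / ε) * I.cost x =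
      6 * I.cost x + 72 * I.cost x + 3 * ((1 + 1 / ε) * (5 * I.cost x)) := by ring
  rw [h10]
  linarith

end Rounding

end CapMedian

namespace ArrayLang

open Finset

/-! ### Boolean expressions -/

open Classical in
/-- The indicator of a proposition. -/
noncomputable def ind (p : Prop) : ℝ := if p then 1 else 0

@[simp]
theorem ind_mul (p q : Prop) : ind p * ind q = ind (p ∧ q) := by
  by_cases hp : p <;> by_cases hq : q <;> simp [ind, hp, hq]

@[simp]
theorem one_sub_ind (p : Prop) : 1 - ind p = ind ¬ p := by
  by_cases hp : p <;> simp [ind, hp]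

@[simp]
theorem one_le_ind_add_ind (p q : Prop) : 1 ≤ ind p + ind q ↔ p ∨ q := by
  by_cases hp : p <;> by_cases hq : q <;> simp [ind, hp, hq]

@[simp]
theorem sum_ind_le {ι : Type} [Fintype ι] (p : ι → Prop) :
    ∑ i, ind (p i) ≤ 0 ↔ ∀ i, ¬ p i := by
  have h0 : ∀ i, 0 ≤ ind (p i) := fun i => by by_cases h : p i <;> simp [ind, h]
  constructor
  · intro h i hi
    have := (sum_eq_zero_iff_of_nonneg fun i _ => h0 i).mp
      (le_antisymm h (sum_nonneg fun i _ => h0 i)) i (mem_univ i)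
    simp [ind, hi] at this
  · intro h
    exact (sum_eq_zero fun i _ => by simp [ind, h i]).le

@[simp]
theorem sum_ind_pos {ι : Type} [Fintype ι] (p : ι → Prop) :
    0 < ∑ i, ind (p i) ↔ ∃ i, p i := by
  rw [← not_le, sum_ind_le]
  simp

@[simp]
theorem ind_inj (p q : Prop) : ind p = ind q ↔ (p ↔ q) := by
  by_cases hp : p <;> by_cases hq : q <;> simp [ind, hp, hq]

/-- Lets an array known to have values 0 and 1 be read as a predicate, even if the proposition in
its equation refers to the array itself. -/
theorem eq_ind_of_eq {r : ℝ} {p : Prop} (h : r = ind p) : r = ind (r ≠ 0) := by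
  subst h
  by_cases hp : p <;> simp [ind, hp]

theorem ind_mul_real (p : Prop) [Decidable p] (r : ℝ) : ind p * r = if p then r else 0 := by
  by_cases hp : p <;> simp [ind, hp]

theorem sum_ind_eq {ι : Type} [Fintype ι] (a : ι) (f : ι → ℝ) :
    ∑ j, ind (a = j) * f j = f a := by
  classical
  simp only [ind_mul_real]
  simp

theorem sum_ind_eq_card {ι : Type} [Fintype ι] (p : ι → Prop) [DecidablePred p] :
    ∑ j, ind (p j) = #{j | p j} := by
  rw [← sum_boole]
  exact sum_congr rfl fun j _ => by by_cases h : p j <;> simp [ind, h]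

namespace Ex

/-- Negation. -/
def not (e : Ex) : Ex := .sub (.const 1) e

/-- Conjunction. -/
def and (e e' : Ex) : Ex := .mul e e'

/-- Disjunction. -/
def or (e e' : Ex) : Ex := .le (.const 1) (.add e e')

/-- Strict comparison. -/
def lt (e e' : Ex) : Ex := (Ex.le e' e).not

/-- Bounded universal quantification of a negation. -/
def none (b : Bd) (e : Ex) : Ex := .le (.sum b e) (.const 0)

/-- Bounded existential quantification. -/
def ex (b : Bd) (e : Ex) : Ex := (Ex.none b e).not

/-- Equality of variables. -/
def eqV (v w : ℕ) : Ex := (Ex.le (.num v) (.num w)).and (Ex.le (.num w) (.num v))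

/-- The order by key, then by index. -/
def bef (key : ℕ → Ex) (v w : ℕ) : Ex :=
  ((key v).lt (key w)).or (((key v).le (key w)).and ((Ex.num v).lt (.num w)))

/-- The variable `v` is the first element of `s`. -/
def first (b : Bd) (s key : ℕ → Ex) (v w : ℕ) : Ex :=
  (s v).and (Ex.none b ((s w).and (bef key w v)))

end Ex

open Ex

/-- The sizes `m`, `n` and `k` as variables. -/
def sizes (m n k : ℕ) : ℕ → ℕ
  | 0 => m
  | 1 => n
  | 2 => k
  | _ => 0

/-! ### The rounding program -/

/-- Average connection costs. -/
def itDav : Item := ⟨10, .cli, .one, 0, .sum .fac (.mul (.get 0 6 4) (.get 4 6 4))⟩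

/-- Centers. -/
def itZ : Item := ⟨12, .cli, .one, 1, Ex.none .cli ((Ex.get 12 6 3).and
  ((bef (fun v => .get 10 v 3) 6 4).and (.le (.get 1 4 6) (.mul (.const 4) (.get 10 4 3)))))⟩

/-- Nearest centers of facilities. -/
def itCl : Item := ⟨13, .fac, .cli, 0, first .cli (fun v => .get 12 v 3) (fun v => .get 0 4 v) 5 6⟩

/-- Parts of the clients' demands served by the clusters. -/
def itPart : Item := ⟨14, .cli, .cli, 0, .sum .fac (.mul (.get 13 6 4) (.get 4 6 5))⟩

/-- Volumes of the clusters. -/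
def itVol : Item := ⟨15, .cli, .one, 0, .sum .fac (.mul (.get 13 6 4) (.get 5 6 3))⟩

/-- Demands of the clusters. -/
def itDem : Item := ⟨16, .cli, .one, 0, .sum .cli (.get 14 4 6)⟩

/-- Loads of the facilities in the fractional solution. -/
def itW : Item := ⟨17, .fac, .one, 0, .sum .cli (.get 4 4 6)⟩

/-- Moving costs of the clusters. -/
def itMov : Item :=
  ⟨18, .cli, .one, 0, .sum .fac (.mul (.get 13 6 4) (.mul (.get 0 6 4) (.get 17 6 3)))⟩

/-- Facilities near their centers. -/
def itNear : Item := ⟨19, .fac, .one, 0, Ex.none .cli ((Ex.get 13 4 6).and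
  (Ex.le (.mul (.mul (.get 0 4 6) (.get 16 6 3)) (.get 6 3 3))
    (.mul (.get 18 6 3) (.add (.const 1) (.get 6 3 3)))).not)⟩

/-- Facilities of the same cluster. -/
def itSame : Item := ⟨20, .fac, .fac, 0, Ex.ex .cli ((Ex.get 13 4 6).and (.get 13 5 6))⟩

/-- Ranks of the facilities in their clusters. -/
def itRank : Item := ⟨21, .fac, .one, 0, .sum .fac ((Ex.get 20 6 4).and
  ((Ex.get 19 6 3).and (bef (fun v => .sub (.const 0) (.get 3 v 3)) 6 4)))⟩

/-- Candidates. -/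
def itSel : Item := ⟨22, .fac, .one, 0, (Ex.get 19 4 3).and (Ex.ex .cli ((Ex.get 13 4 6).and
  ((Ex.le (.get 21 4 3) (.const 0)).or (.le (.add (.get 21 4 3) (.const 1)) (.get 15 6 3)))))⟩

/-- Largest candidates. -/
def itReps : Item := ⟨23, .fac, .one, 0, (Ex.get 19 4 3).and (.le (.get 21 4 3) (.const 0))⟩

/-- Capacities of the candidates of a cluster. -/
def itCap : Item :=
  ⟨24, .cli, .one, 0, .sum .fac (.mul ((Ex.get 22 6 3).and (.get 13 6 4)) (.get 3 6 3))⟩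

/-- Shares of the candidates. -/
def itShare : Item :=
  ⟨25, .fac, .one, 0, .sum .cli (.mul (.get 13 4 6) (.div (.get 3 4 3) (.get 24 6 3)))⟩

/-- Loads of the candidates. -/
def itLoad : Item :=
  ⟨26, .fac, .one, 0, .mul (.get 25 4 3) (.sum .cli (.mul (.get 13 4 6) (.get 16 6 3)))⟩

/-- Loads of the largest candidates. -/
def itRepLoad : Item :=
  ⟨27, .cli, .one, 0, .sum .fac (.mul ((Ex.get 23 6 3).and (.get 13 6 4)) (.get 26 6 3))⟩

/-- Sparse clusters. -/
def itSparse : Item := ⟨28, .cli, .one, 0, (Ex.get 12 4 3).and ((Ex.get 15 4 3).lt (.const 1))⟩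

/-- Nearest other centers. -/
def itSigma : Item := ⟨29, .cli, .cli, 0,
  first .cli (fun v => (Ex.get 12 v 3).and (eqV v 4).not) (fun v => .get 1 4 v) 5 6⟩

/-- Costs of closing clusters. -/
def itClose : Item :=
  ⟨31, .cli, .one, 0, .mul (.get 16 4 3) (.sum .cli (.mul (.get 29 4 6) (.get 1 4 6)))⟩

/-- Half-open clusters. -/
def itHalf : Item := ⟨32, .cli, .one, 0, (Ex.get 28 4 3).and (.le
  (.add (.sum .cli ((Ex.get 28 6 3).and (bef (fun v => .get 31 v 3) 6 4))) (.const 1))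
  (.sub (.mul (.const 2) (.sum .fac (.get 22 6 3))) (.mul (.const 2) (.num 2))))⟩

/-- Pairs of half-open clusters that may be matched. -/
def itEdge : Item := ⟨33, .cli, .cli, 0, (Ex.get 32 4 3).and ((Ex.get 32 5 3).and
  (((Ex.num 4).lt (.num 5)).and ((Ex.get 29 4 5).or ((Ex.get 29 5 4).or
    (Ex.ex .cli ((Ex.get 29 4 6).and (.get 29 5 6)))))))⟩

/-- The greedy matching. -/
def itMatch : Item := ⟨34, .cli, .cli, 2, (Ex.get 33 4 5).and (Ex.none .cli (Ex.ex .cli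
  ((Ex.get 34 6 7).and ((((Ex.num 6).lt (.num 4)).or ((eqV 6 4).and ((Ex.num 7).lt (.num 5)))).and
    ((eqV 4 6).or ((eqV 4 7).or ((eqV 5 6).or (eqV 5 7))))))))⟩

/-- Mates. -/
def itMate : Item := ⟨35, .cli, .cli, 0, (Ex.get 34 4 5).or (.get 34 5 4)⟩

/-- Matched centers. -/
def itMatched : Item := ⟨36, .cli, .one, 0, Ex.ex .cli (.get 35 4 6)⟩

/-- Matched centers nearest to unmatched ones. -/
def itAtt : Item := ⟨37, .cli, .one, 0, (Ex.get 36 4 3).and (Ex.ex .cli ((Ex.get 32 6 3).and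
  ((Ex.get 36 6 3).not.and (.get 29 6 4))))⟩

/-- Matched centers that name groups. -/
def itLab : Item :=
  ⟨38, .cli, .one, 0, (Ex.get 37 4 3).or (Ex.ex .cli ((Ex.get 34 4 6).and (Ex.get 37 6 3).not))⟩

/-- Names of groups. -/
def itGroup : Item := ⟨39, .cli, .cli, 0, ((Ex.get 32 4 3).not.and (eqV 4 5)).or
  (((Ex.get 32 4 3).and ((Ex.get 36 4 3).not.and (.get 29 4 5))).or
    (((Ex.get 36 4 3).and ((Ex.get 38 4 3).and (eqV 4 5))).or
      ((Ex.get 38 4 3).not.and (.get 35 4 5))))⟩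

/-- Centers of the same group. -/
def itSameGroup : Item :=
  ⟨40, .cli, .cli, 0, (Ex.get 12 5 3).and (Ex.ex .cli ((Ex.get 39 4 6).and (.get 39 5 6)))⟩

/-- Negated values. -/
def itVal : Item := ⟨41, .cli, .one, 0,
  .sub (.const 0) (.mul (.get 27 4 3) (.div (.add (.const 1) (.get 32 4 3)) (.const 2)))⟩

/-- Centers chosen in the groups. -/
def itRho : Item :=
  ⟨42, .cli, .cli, 0, first .cli (fun v => .get 40 4 v) (fun v => .get 41 v 3) 5 6⟩

/-- Targets of the candidates. -/
def itTarget : Item := ⟨43, .fac, .fac, 0, ((Ex.get 23 4 3).not.and (eqV 4 5)).or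
  ((Ex.get 23 4 3).and ((Ex.get 23 5 3).and (Ex.ex .cli (Ex.ex .cli
    ((Ex.get 13 4 6).and ((Ex.get 42 6 7).and (.get 13 5 7)))))))⟩

/-- Assignments to the candidates. -/
def itServe : Item := ⟨44, .fac, .cli, 0,
  .mul (.get 25 4 3) (.sum .cli (.mul (.get 13 4 6) (.get 14 6 5)))⟩

/-- The final assignment. -/
def itX : Item :=
  ⟨7, .fac, .cli, 0, .sum .fac (.mul ((Ex.get 22 6 3).and (.get 43 6 4)) (.get 44 6 5))⟩

/-- The final opening. -/
def itY : Item := ⟨8, .fac, .one, 0, Ex.ex .fac ((Ex.get 22 6 3).and (.get 43 6 4))⟩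

/-- The rounding program as a list of instructions. -/
def prog : List Item := [itDav, itZ, itCl, itPart, itVol, itDem, itW, itMov, itNear, itSame, itRank,
  itSel, itReps, itCap, itShare, itLoad, itRepLoad, itSparse, itSigma, itClose, itHalf, itEdge,
  itMatch, itMate, itMatched, itAtt, itLab, itGroup, itSameGroup, itVal, itRho, itTarget, itServe,
  itX, itY]

/-- The condition is purely syntactic in the array numbers, hence decidable by evaluation. -/
theorem prog_ssa : SSA prog := by
  unfold SSA
  decide +kernel

theorem prog_lt : ∀ it ∈ prog, it.a < 100 := by decide

theorem prog_reads : ∀ it ∈ prog, it.r = 0 → it.a ∉ it.e.reads := by decide +kernel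

end ArrayLang

namespace ArrayLang

open Finset Ex

/-! ### The arrays computed by the program -/

/-- The arrays `A` satisfy the equations of the rounding program. -/
structure Final {m n : ℕ} (I : CapMedian (Fin m) (Fin n)) (x : Fin m → Fin n → ℝ) (y : Fin m → ℝ)
    (ε : ℝ) (A : ℕ → ℕ → ℕ → ℝ) : Prop where
  inp0 : ∀ (i : Fin m) (j : Fin n), A 0 i j = I.d i j
  inp1 : ∀ j j' : Fin n, A 1 j j' = I.cc j j'
  inp3 : ∀ i : Fin m, A 3 i 0 = I.u i
  inp4 : ∀ (i : Fin m) (j : Fin n), A 4 i j = x i j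
  inp5 : ∀ i : Fin m, A 5 i 0 = y i
  inp6 : A 6 0 0 = ε
  eqn : ∀ it ∈ prog, ∀ a < it.b.val (sizes m n I.k), ∀ b < it.b'.val (sizes m n I.k),
    A it.a a b = it.e.eval A 6 (env (sizes m n I.k) a b)

/-- The form that the expression `bef` computes: equality of keys may be weakened to `≤` because the
strict case is already covered. -/
theorem bef_iff' {α : Type} [LinearOrder α] {key : α → ℝ} {a b : α} :
    Bef key a b ↔ key a < key b ∨ key a ≤ key b ∧ a < b := by
  rw [bef_iff]
  constructor
  · rintro (h | h)
    · exact Or.inl h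
    · exact Or.inr ⟨h.1.le, h.2⟩
  · rintro (h | h)
    · exact Or.inl h
    · exact h.1.lt_or_eq.imp id fun h' => ⟨h', h.2⟩

section

variable (A : ℕ → ℕ → ℕ → ℝ) (e e' : Ex) (t : ℕ) (ρ : ℕ → ℕ)

@[simp]
theorem eval_const (q : ℚ) : (Ex.const q).eval A t ρ = q := rfl

@[simp]
theorem eval_get (a v w : ℕ) : (Ex.get a v w).eval A t ρ =
    if a < 100 ∧ v < t ∧ w < t then A a (ρ v) (ρ w) else 0 := rfl

@[simp]
theorem eval_num (v : ℕ) : (Ex.num v).eval A t ρ = if v < t then (ρ v : ℝ) else 0 := rfl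

@[simp]
theorem eval_add : (Ex.add e e').eval A t ρ = e.eval A t ρ + e'.eval A t ρ := rfl

@[simp]
theorem eval_sub : (Ex.sub e e').eval A t ρ = e.eval A t ρ - e'.eval A t ρ := rfl

@[simp]
theorem eval_mul : (Ex.mul e e').eval A t ρ = e.eval A t ρ * e'.eval A t ρ := rfl

@[simp]
theorem eval_div : (Ex.div e e').eval A t ρ = e.eval A t ρ / e'.eval A t ρ := rfl

@[simp]
theorem eval_le : (Ex.le e e').eval A t ρ = ind (e.eval A t ρ ≤ e'.eval A t ρ) := rfl

@[simp]
theorem eval_sum (b : Bd) : (Ex.sum b e).eval A t ρ =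
    ∑ j ∈ range (b.val ρ), e.eval A (t + 1) (Function.update ρ t j) := rfl

@[simp]
theorem eval_not : e.not.eval A t ρ = 1 - e.eval A t ρ := by simp [Ex.not]

@[simp]
theorem eval_and : (e.and e').eval A t ρ = e.eval A t ρ * e'.eval A t ρ := rfl

@[simp]
theorem eval_or : (e.or e').eval A t ρ = ind (1 ≤ e.eval A t ρ + e'.eval A t ρ) := by
  simp [Ex.or]

@[simp]
theorem eval_lt : (e.lt e').eval A t ρ = ind (e.eval A t ρ < e'.eval A t ρ) := by
  simp [Ex.lt]

@[simp]
theorem eval_none (b : Bd) : (Ex.none b e).eval A t ρ =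
    ind (∑ j ∈ range (b.val ρ), e.eval A (t + 1) (Function.update ρ t j) ≤ 0) := by
  simp [Ex.none]

@[simp]
theorem eval_ex (b : Bd) : (Ex.ex b e).eval A t ρ =
    1 - ind (∑ j ∈ range (b.val ρ), e.eval A (t + 1) (Function.update ρ t j) ≤ 0) := by
  simp [Ex.ex]

end

namespace Final

variable {m n : ℕ} {I : CapMedian (Fin m) (Fin n)} {x : Fin m → Fin n → ℝ} {y : Fin m → ℝ}
    {ε : ℝ} {A : ℕ → ℕ → ℕ → ℝ}

theorem dav (h : Final I x y ε A) (j : Fin n) : A 10 j 0 = I.dav x j := by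
  have := h.eqn itDav (by simp [prog]) j j.2 0 one_pos
  simpa [itDav, Bd.val, env, sizes, sum_range, h.inp0, h.inp4, CapMedian.dav] using this

/-- Array 12 satisfies an equation that mentions itself; it has values 0 and 1, so its support is a
set of clients obeying the greedy rule. -/
theorem exists_centers (h : Final I x y ε A) : ∃ Z : Finset (Fin n),
    (∀ j : Fin n, A 12 j 0 = ind (j ∈ Z)) ∧
    ∀ j, j ∈ Z ↔ ∀ j' ∈ Z, Bef (I.dav x) j' j → 4 * I.dav x j < I.cc j j' := by
  classical
  obtain ⟨Z, hZ⟩ : ∃ Z : Finset (Fin n), ∀ j : Fin n, A 12 j 0 = ind (j ∈ Z) :=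
    ⟨univ.filter fun j : Fin n => A 12 j 0 ≠ 0, fun j => by
      have : A 12 j 0 = ind (A 12 j 0 ≠ 0) :=
        eq_ind_of_eq (h.eqn itZ (by simp [prog]) j j.2 0 one_pos)
      simpa using this⟩
  refine ⟨Z, hZ, fun j => ?_⟩
  have := h.eqn itZ (by simp [prog]) j j.2 0 one_pos
  simpa [itZ, bef, Bd.val, env, sizes, sum_range, h.inp1, h.dav, hZ, ← bef_iff'] using this

/-- First elements are unique since the order is total; so the test for being first is the graph of
a function. -/
theorem first_iff {α : Type} [LinearOrder α] {key : α → ℝ} {p : α → Prop} {a b : α} (ha : p a)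
    (hf : ∀ c, p c → ¬ Bef key c a) : (p b ∧ ∀ c, p c → ¬ Bef key c b) ↔ a = b := by
  constructor
  · rintro ⟨hb, hb'⟩
    by_contra hne
    rcases bef_or_bef (key := key) hne with h | h
    · exact hb' a ha h
    · exact hf b hb h
  · rintro rfl; exact ⟨ha, hf⟩

/-- A rejected client is blocked by a center within 4 times its average, which gives covering; a
client is needed for a center to exist at all. -/
theorem exists_rounding (h : Final I x y ε A) (hx : I.Feasible 1 x y) (hn : 0 < n) :
    ∃ R : I.Rounding x, (∀ j : Fin n, A 12 j 0 = ind (j ∈ R.Z)) ∧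
      (∀ (i : Fin m) (j : Fin n), A 13 i j = ind (R.cl i = j)) ∧
      (∀ j j' : Fin n, (∃ j' ∈ R.Z, j' ≠ j) → A 29 j j' = ind (R.σ j = j')) ∧
      ∀ j : Fin n, A 31 j 0 = A 16 j 0 * I.cc j (R.σ j) := by
  classical
  obtain ⟨Z, hZ, hZ'⟩ := h.exists_centers
  have hcover : ∀ j, ∃ j' ∈ Z, I.cc j j' ≤ 4 * I.dav x j := by
    intro j
    by_cases hj : j ∈ Z
    · exact ⟨j, hj, by
        rw [CapMedian.cc, I.dist_self]
        exact mul_nonneg (by norm_num) (CapMedian.dav_nonneg hx j)⟩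
    · rw [hZ'] at hj
      push Not at hj
      obtain ⟨j', h1, -, h2⟩ := hj
      exact ⟨j', h1, h2⟩
  have hZne : Z.Nonempty := by
    obtain ⟨j, hj, -⟩ := hcover ⟨0, hn⟩
    exact ⟨j, hj⟩
  choose cl hcl hcl' using fun i : Fin m => exists_first (I.d i) hZne
  -- With no other center the row of array 29 is zero. The default value `j` then makes the distance
  -- to the nearest other center 0, in agreement with the closing cost in array 31.
  have hσ : ∀ j, ∃ j', ((∃ a ∈ Z, a ≠ j) → (j' ∈ Z ∧ j' ≠ j) ∧
      ∀ c, c ∈ Z ∧ c ≠ j → ¬ Bef (I.cc j) c j') ∧ ((¬ ∃ a ∈ Z, a ≠ j) → j' = j) := by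
    intro j
    by_cases hex : ∃ a ∈ Z, a ≠ j
    · obtain ⟨a, ha, ha'⟩ := hex
      obtain ⟨j', h1, h2⟩ := exists_first (I.cc j) (s := Z.erase j)
        ⟨a, mem_erase.mpr ⟨ha', ha⟩⟩
      refine ⟨j', fun _ => ⟨⟨mem_of_mem_erase h1, ne_of_mem_erase h1⟩, fun c hc =>
        h2 c (mem_erase.mpr ⟨hc.2, hc.1⟩)⟩, fun h => absurd ⟨a, ha, ha'⟩ h⟩
    · exact ⟨j, fun h => absurd h hex, fun _ => rfl⟩
  choose σ hσ hσ' using hσ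
  have h13 : ∀ (i : Fin m) (j : Fin n), A 13 i j = ind (cl i = j) := by
    intro i j
    have := h.eqn itCl (by simp [prog]) i i.2 j j.2
    simp [itCl, first, bef, Bd.val, env, sizes, sum_range, h.inp0, hZ, ← bef_iff'] at this
    rw [this, ind_inj, ← first_iff (p := (· ∈ Z)) (hcl i) (hcl' i)]
  have h29 : ∀ j j' : Fin n, A 29 j j' =
      ind ((j' ∈ Z ∧ j' ≠ j) ∧ ∀ c, c ∈ Z ∧ c ≠ j → ¬ Bef (I.cc j) c j') := by
    intro j j'
    have := h.eqn itSigma (by simp [prog]) j j.2 j' j'.2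
    simp [itSigma, first, bef, eqV, Bd.val, env, sizes, sum_range, h.inp1, hZ, ← bef_iff'] at this
    rw [this, ind_inj]
    simp only [le_antisymm_iff, ne_eq, not_and, not_le, and_imp]
  have h29' : ∀ j j' : Fin n, (∃ j' ∈ Z, j' ≠ j) → A 29 j j' = ind (σ j = j') := by
    intro j j' hex
    rw [h29, ind_inj]
    exact first_iff (p := fun c => c ∈ Z ∧ c ≠ j) (hσ j hex).1 (hσ j hex).2
  refine ⟨⟨Z, cl, σ, ⟨?_, hcover, hcl, fun i j hj => le_of_not_bef (hcl' i j hj)⟩,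
    fun j hj hex => ⟨(hσ j hex).1.1, (hσ j hex).1.2, fun j' hj' hne =>
      le_of_not_bef ((hσ j hex).2 j' ⟨hj', hne⟩)⟩⟩, hZ, h13, h29', ?_⟩
  · intro j hj j' hj' hne
    rcases bef_or_bef (key := I.dav x) hne with hb | hb
    · have := (hZ' j').mp hj' j hj hb
      rw [I.cc_comm] at this
      linarith [hb.le]
    · exact (hZ' j).mp hj j' hj' hb
  · intro j
    have := h.eqn itClose (by simp [prog]) j j.2 0 one_pos
    simp [itClose, Bd.val, env, sizes, sum_range, h.inp1] at this
    rw [this]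
    by_cases hex : ∃ a ∈ Z, a ≠ j
    · simp only [h29' j _ hex, sum_ind_eq]
    · have h0 : ∀ j' : Fin n, A 29 j j' = 0 := by
        intro j'
        rw [h29, ind, if_neg]
        rintro ⟨h1, -⟩
        exact hex ⟨j', h1⟩
      simp only [h0, zero_mul, sum_const_zero, hσ' j hex]
      rw [CapMedian.cc, I.dist_self]

end Final

end ArrayLang

/-! ### Identification of the computed arrays with the objects of the analysis. -/

namespace ArrayLang

open Finset Ex CapMedian

/-- The arrays `A` are those of the rounding `R`. -/
structure Linked {m n : ℕ} {I : CapMedian (Fin m) (Fin n)} {x : Fin m → Fin n → ℝ}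
    (R : I.Rounding x) (y : Fin m → ℝ) (ε : ℝ) (A : ℕ → ℕ → ℕ → ℝ) : Prop where
  final : Final I x y ε A
  Z : ∀ j : Fin n, A 12 j 0 = ind (j ∈ R.Z)
  cl : ∀ (i : Fin m) (j : Fin n), A 13 i j = ind (R.cl i = j)
  σ : ∀ j j' : Fin n, (∃ j' ∈ R.Z, j' ≠ j) → A 29 j j' = ind (R.σ j = j')
  close : ∀ j : Fin n, A 31 j 0 = A 16 j 0 * I.cc j (R.σ j)

namespace Linked

variable {m n : ℕ} {I : CapMedian (Fin m) (Fin n)} {x : Fin m → Fin n → ℝ} {y : Fin m → ℝ}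
    {ε : ℝ} {A : ℕ → ℕ → ℕ → ℝ} {R : I.Rounding x}

theorem part (h : Linked R y ε A) (j c : Fin n) : A 14 j c = part x R.cl j c := by
  have := h.final.eqn itPart (by simp [prog]) j j.2 c c.2
  simpa [itPart, Bd.val, env, sizes, sum_range, h.final.inp4, h.cl, ind_mul_real,
    CapMedian.part] using this

theorem vol (h : Linked R y ε A) (j : Fin n) : A 15 j 0 = vol y R.cl j := by
  have := h.final.eqn itVol (by simp [prog]) j j.2 0 one_pos
  simpa [itVol, Bd.val, env, sizes, sum_range, h.final.inp5, h.cl, ind_mul_real,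
    CapMedian.vol] using this

theorem dem (h : Linked R y ε A) (j : Fin n) : A 16 j 0 = dem x R.cl j := by
  have := h.final.eqn itDem (by simp [prog]) j j.2 0 one_pos
  simpa [itDem, Bd.val, env, sizes, sum_range, h.part, CapMedian.dem] using this

theorem weight (h : Linked R y ε A) (i : Fin m) : A 17 i 0 = ∑ c, x i c := by
  have := h.final.eqn itW (by simp [prog]) i i.2 0 one_pos
  simpa [itW, Bd.val, env, sizes, sum_range, h.final.inp4] using this

theorem mov (h : Linked R y ε A) (j : Fin n) : A 18 j 0 = I.mov x R.cl j := by
  have := h.final.eqn itMov (by simp [prog]) j j.2 0 one_pos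
  simpa [itMov, Bd.val, env, sizes, sum_range, h.final.inp0, h.cl, h.weight, ind_mul_real,
    CapMedian.mov] using this

theorem near (h : Linked R y ε A) (i : Fin m) : A 19 i 0 = ind (i ∈ R.near ε (R.cl i)) := by
  have := h.final.eqn itNear (by simp [prog]) i i.2 0 one_pos
  simpa [itNear, Bd.val, env, sizes, sum_range, h.final.inp0, h.final.inp6, h.cl, h.dem, h.mov,
    Rounding.mem_near] using this

theorem same (h : Linked R y ε A) (i i' : Fin m) : A 20 i i' = ind (R.cl i = R.cl i') := by
  have := h.final.eqn itSame (by simp [prog]) i i.2 i' i'.2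
  simpa [itSame, Bd.val, env, sizes, sum_range, h.cl, eq_comm] using this

theorem rank (h : Linked R y ε A) (i : Fin m) : A 21 i 0 = R.rank ε i := by
  classical
  have := h.final.eqn itRank (by simp [prog]) i i.2 0 one_pos
  simp [itRank, bef, Bd.val, env, sizes, sum_range, h.final.inp3, h.same, h.near] at this
  rw [this, sum_ind_eq_card, Rounding.rank, rk]
  congr 2
  ext i'
  simp only [mem_filter, mem_univ, true_and, bef_iff', neg_lt_neg_iff, neg_le_neg_iff]
  constructor
  · rintro ⟨h1, h2, h3⟩; exact ⟨h1 ▸ h2, h3⟩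
  · rintro ⟨h1, h2⟩
    obtain h3 := (Rounding.mem_near.mp h1).1
    exact ⟨h3, h3 ▸ h1, h2⟩

/-- The machine cannot round, but comparing a natural rank with a floor needs no floor: the rank is
0, or the rank plus 1 is at most the volume. -/
theorem sel (h : Linked R y ε A) (i : Fin m) : A 22 i 0 = ind (i ∈ R.sel y ε) := by
  have := h.final.eqn itSel (by simp [prog]) i i.2 0 one_pos
  simp [itSel, Bd.val, env, sizes, sum_range, h.cl, h.near, h.rank, h.vol] at this
  rw [this, ind_inj, Rounding.mem_sel]
  refine and_congr_right fun _ => ?_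
  rw [lt_max_iff, Nat.lt_one_iff, ← Nat.add_one_le_iff, Nat.le_floor_iff' (by omega)]
  push_cast
  tauto

theorem reps (h : Linked R y ε A) (i : Fin m) : A 23 i 0 = ind (i ∈ R.reps ε) := by
  have := h.final.eqn itReps (by simp [prog]) i i.2 0 one_pos
  simpa [itReps, Bd.val, env, sizes, sum_range, h.near, h.rank, Rounding.mem_reps] using this

theorem cap (h : Linked R y ε A) (j : Fin n) : A 24 j 0 = R.cap y ε j := by
  have := h.final.eqn itCap (by simp [prog]) j j.2 0 one_pos
  simp [itCap, Bd.val, env, sizes, sum_range, h.cl, h.sel, h.final.inp3, ind_mul_real] at this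
  rw [this, Rounding.cap, ← sum_filter]

theorem share (h : Linked R y ε A) (i : Fin m) : A 25 i 0 = R.share y ε i := by
  have := h.final.eqn itShare (by simp [prog]) i i.2 0 one_pos
  simpa [itShare, Bd.val, env, sizes, sum_range, h.cl, h.cap, h.final.inp3, sum_ind_eq,
    Rounding.share] using this

theorem load (h : Linked R y ε A) (i : Fin m) : A 26 i 0 = R.load y ε i := by
  have := h.final.eqn itLoad (by simp [prog]) i i.2 0 one_pos
  simpa [itLoad, Bd.val, env, sizes, sum_range, h.cl, h.share, h.dem, sum_ind_eq,
    Rounding.load] using this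

theorem repLoad (h : Linked R y ε A) (j : Fin n) : A 27 j 0 = R.repLoad y ε j := by
  have := h.final.eqn itRepLoad (by simp [prog]) j j.2 0 one_pos
  simp [itRepLoad, Bd.val, env, sizes, sum_range, h.cl, h.reps, h.load, ind_mul_real] at this
  rw [this, Rounding.repLoad, ← sum_filter]

theorem sparse (h : Linked R y ε A) (j : Fin n) : A 28 j 0 = ind (j ∈ R.sparse y) := by
  have := h.final.eqn itSparse (by simp [prog]) j j.2 0 one_pos
  simpa [itSparse, Bd.val, env, sizes, sum_range, h.Z, h.vol, Rounding.sparse] using this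

theorem closeCost (h : Linked R y ε A) (j : Fin n) : A 31 j 0 = R.closeCost j := by
  rw [h.close, h.dem, Rounding.closeCost]

/-- The program subtracts in the reals, the definition truncates in ℕ; the tests agree since a rank
plus 1 exceeds any nonpositive number. -/
theorem half (h : Linked R y ε A) (j : Fin n) : A 32 j 0 = ind (j ∈ R.half y ε) := by
  classical
  have := h.final.eqn itHalf (by simp [prog]) j j.2 0 one_pos
  simp [itHalf, bef, Bd.val, env, sizes, sum_range, h.closeCost, h.sparse, h.sel,
    ← bef_iff'] at this
  rw [this, ind_inj, sum_ind_eq_card, sum_ind_eq_card, Rounding.half, mem_filter]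
  refine and_congr_right fun _ => ?_
  have h1 : #{i | i ∈ R.sel y ε} = #(R.sel y ε) := by simp
  have h2 : #{j' | j' ∈ R.sparse y ∧ Bef R.closeCost j' j} = rk R.closeCost (R.sparse y) j := by
    rw [rk]; congr 1; ext j'; simp
  rw [h1, h2, Nat.lt_sub_iff_add_lt, le_sub_iff_add_le]
  norm_cast
  omega

theorem exists_other (hx : I.Feasible 1 x y) {j : Fin n} (hj : j ∈ R.half y ε) :
    ∃ j' ∈ R.Z, j' ≠ j := by
  obtain ⟨hj, hv⟩ := mem_filter.mp (mem_filter.mp hj).1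
  exact CapMedian.exists_other hx R.clus hv

/-- Array 29 encodes `σ` only in rows with another center; half-open centers always have one, and
the other rows are masked. -/
theorem edge (h : Linked R y ε A) (hx : I.Feasible 1 x y) (a b : Fin n) :
    A 33 a b = ind ((R.halves ε hx).Edge a b) := by
  have := h.final.eqn itEdge (by simp [prog]) a a.2 b b.2
  by_cases ha : a ∈ R.half y ε
  · by_cases hb : b ∈ R.half y ε
    · have ha' := exists_other hx ha
      have hb' := exists_other hx hb
      simp [itEdge, Bd.val, env, sizes, sum_range, h.half, h.σ a _ ha', h.σ b _ hb', ha, hb] at this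
      simp [this, Halves.Edge, Rounding.halves, ha, hb, eq_comm]
    · simp [itEdge, Bd.val, env, sizes, sum_range, h.half, hb] at this
      simp [this, Halves.Edge, Rounding.halves, hb, ind]
  · simp [itEdge, Bd.val, env, sizes, sum_range, h.half, ha] at this
    simp [this, Halves.Edge, Rounding.halves, ha, ind]

/-- The array satisfies the greedy rule in lexicographic order of pairs: an edge is taken unless an
earlier taken edge meets it. Of two taken edges that meet, the later would have been refused; a
refused edge has a witness for maximality. -/
theorem exists_matching (h : Linked R y ε A) (hx : I.Feasible 1 x y) :
    ∃ M : Fin n → Fin n → Prop, (∀ a b : Fin n, A 34 a b = ind (M a b)) ∧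
      IsMaxMatching (R.halves ε hx).Edge M := by
  obtain ⟨M, hM⟩ : ∃ M : Fin n → Fin n → Prop, ∀ a b : Fin n, A 34 a b = ind (M a b) :=
    ⟨fun a b => A 34 a b ≠ 0, fun a b => by
      have := h.final.eqn itMatch (by simp [prog]) a a.2 b b.2
      simp [itMatch, eqV, Bd.val, env, sizes, sum_range, h.edge hx] at this
      exact eq_ind_of_eq this⟩
  have hiff : ∀ a b, M a b ↔ (R.halves ε hx).Edge a b ∧ ∀ a' b', M a' b' →
      (a' < a ∨ a' = a ∧ b' < b) → ¬ (a = a' ∨ a = b' ∨ b = a' ∨ b = b') := by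
    intro a b
    have := h.final.eqn itMatch (by simp [prog]) a a.2 b b.2
    simp [itMatch, eqV, Bd.val, env, sizes, sum_range, h.edge hx, hM, ← le_antisymm_iff] at this
    rw [this]
    refine and_congr_right fun _ => forall_congr' fun a' => forall_congr' fun b' => ?_
    simp only [Fin.val_inj, not_or]
  refine ⟨M, hM, fun a b hab => ((hiff a b).mp hab).1, fun a b a' b' h1 h2 hs => ?_,
    fun a b hE => ?_⟩
  · by_contra hne
    have hlt : (a < a' ∨ a = a' ∧ b < b') ∨ (a' < a ∨ a' = a ∧ b' < b) := by
      rcases lt_trichotomy a a' with h3 | h3 | h3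
      · exact Or.inl (Or.inl h3)
      · rcases lt_trichotomy b b' with h4 | h4 | h4
        · exact Or.inl (Or.inr ⟨h3, h4⟩)
        · exact absurd ⟨h3, h4⟩ hne
        · exact Or.inr (Or.inr ⟨h3.symm, h4⟩)
      · exact Or.inr (Or.inl h3)
    rcases hlt with hlt | hlt
    · refine ((hiff a' b').mp h2).2 a b h1 hlt ?_
      rcases hs with hs | hs | hs | hs <;> simp [hs]
    · exact ((hiff a b).mp h1).2 a' b' h2 hlt hs
  · by_cases hab : M a b
    · exact ⟨a, b, hab, Or.inl rfl⟩
    · rw [hiff] at hab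
      push Not at hab
      obtain ⟨a', b', h1, -, h2⟩ := hab hE
      exact ⟨a', b', h1, h2⟩

section

variable {hx : I.Feasible 1 x y} {M : Fin n → Fin n → Prop}

theorem mate (h : Linked R y ε A) (hM : ∀ a b : Fin n, A 34 a b = ind (M a b)) (a b : Fin n) :
    A 35 a b = ind (M a b ∨ M b a) := by
  have := h.final.eqn itMate (by simp [prog]) a a.2 b b.2
  simpa [itMate, Bd.val, env, sizes, sum_range, hM] using this

theorem matched (h : Linked R y ε A) (hM : ∀ a b : Fin n, A 34 a b = ind (M a b)) (a : Fin n) :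
    A 36 a 0 = ind (Halves.Matched M a) := by
  have := h.final.eqn itMatched (by simp [prog]) a a.2 0 one_pos
  simp [itMatched, Bd.val, env, sizes, sum_range, h.mate hM] at this
  rw [this, ind_inj, Halves.Matched]
  simp only [or_iff_not_imp_left]

/-- Nearest centers are read only under the mask of half-open centers, where `σ` is represented
faithfully. -/
theorem att (h : Linked R y ε A) (hx : I.Feasible 1 x y)
    (hM : ∀ a b : Fin n, A 34 a b = ind (M a b)) (a : Fin n) :
    A 37 a 0 = ind ((R.halves ε hx).Att M a) := by
  have hterm : ∀ j : Fin n, A 32 j 0 * ((1 - A 36 j 0) * A 29 j a) =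
      ind (j ∈ R.half y ε ∧ ¬ Halves.Matched M j ∧ R.σ j = a) := by
    intro j
    by_cases hj : j ∈ R.half y ε
    · rw [h.half, h.matched hM, h.σ j a (exists_other hx hj)]; simp
    · rw [h.half]; simp [ind, hj]
  have := h.final.eqn itAtt (by simp [prog]) a a.2 0 one_pos
  simp [itAtt, Bd.val, env, sizes, sum_range, hterm] at this
  simp [h.matched hM] at this
  rw [this, ind_inj, Halves.Att]
  rfl

theorem lab (h : Linked R y ε A) (hx : I.Feasible 1 x y)
    (hM : ∀ a b : Fin n, A 34 a b = ind (M a b)) (a : Fin n) :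
    A 38 a 0 = ind ((R.halves ε hx).Lab M a) := by
  have := h.final.eqn itLab (by simp [prog]) a a.2 0 one_pos
  simp [itLab, Bd.val, env, sizes, sum_range, h.att hx hM, hM] at this
  rw [this, ind_inj, Halves.Lab]

theorem group (h : Linked R y ε A) (hx : I.Feasible 1 x y)
    (hM : ∀ a b : Fin n, A 34 a b = ind (M a b))
    (hM' : IsMaxMatching (R.halves ε hx).Edge M) (j l : Fin n) :
    A 39 j l = ind ((R.halves ε hx).g M j = l) := by
  have hterm : A 32 j 0 * ((1 - A 36 j 0) * A 29 j l) =
      ind (j ∈ R.half y ε ∧ ¬ Halves.Matched M j ∧ R.σ j = l) := by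
    by_cases hj : j ∈ R.half y ε
    · rw [h.half, h.matched hM, h.σ j l (exists_other hx hj)]; simp
    · rw [h.half]; simp [ind, hj]
  have := h.final.eqn itGroup (by simp [prog]) j j.2 l l.2
  simp only [itGroup, eval_or, eval_and, eval_not, eval_get, eqV, eval_le, eval_num] at this
  simp [env, sizes, hterm] at this
  simp [h.lab hx hM, h.mate hM, h.half, h.matched hM, ← le_antisymm_iff] at this
  rw [this, ind_inj, Halves.g_eq_iff hM']
  rfl

theorem sameGroup (h : Linked R y ε A) (hx : I.Feasible 1 x y)
    (hM : ∀ a b : Fin n, A 34 a b = ind (M a b))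
    (hM' : IsMaxMatching (R.halves ε hx).Edge M) (j j' : Fin n) :
    A 40 j j' = ind (j' ∈ R.Z ∧ (R.halves ε hx).g M j' = (R.halves ε hx).g M j) := by
  have := h.final.eqn itSameGroup (by simp [prog]) j j.2 j' j'.2
  simpa [itSameGroup, Bd.val, env, sizes, sum_range, h.group hx hM hM', h.Z] using this

/-- The factor `(1 + indicator) / 2` is 1 for half-open and 1/2 for full centers; the sign turns the
largest value into a first element. -/
theorem val (h : Linked R y ε A) (hx : I.Feasible 1 x y) (j : Fin n) :
    A 41 j 0 = - (R.halves ε hx).val (R.repLoad y ε) j := by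
  have := h.final.eqn itVal (by simp [prog]) j j.2 0 one_pos
  simp [itVal, env, sizes, h.repLoad, h.half] at this
  rw [this, neg_inj, Halves.val]
  by_cases hj : j ∈ R.half y ε
  · have hj' : j ∈ (R.halves ε hx).H := hj
    rw [if_pos hj']; simp [ind, hj]
  · have hj' : j ∉ (R.halves ε hx).H := hj
    rw [if_neg hj']; simp [ind, hj]; rfl

theorem exists_choice (h : Linked R y ε A) (hx : I.Feasible 1 x y)
    (hM : ∀ a b : Fin n, A 34 a b = ind (M a b))
    (hM' : IsMaxMatching (R.halves ε hx).Edge M) :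
    ∃ ρ : Fin n → Fin n, (R.halves ε hx).IsChoice M (R.repLoad y ε) ρ ∧
      ∀ j ∈ R.Z, ∀ j' : Fin n, A 42 j j' = ind (ρ j = j') := by
  classical
  set S := R.halves ε hx
  set key : Fin n → ℝ := fun j => - S.val (R.repLoad y ε) j with hkey
  have hex : ∀ j, ∃ a, j ∈ R.Z → (a ∈ R.Z ∧ S.g M a = S.g M j) ∧
      ∀ c, c ∈ R.Z ∧ S.g M c = S.g M j → ¬ Bef key c a := by
    intro j
    by_cases hj : j ∈ R.Z
    · obtain ⟨a, ha, ha'⟩ := exists_first key (s := R.Z.filter fun a => S.g M a = S.g M j)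
        ⟨j, mem_filter.mpr ⟨hj, rfl⟩⟩
      exact ⟨a, fun _ => ⟨mem_filter.mp ha, fun c hc => ha' c (mem_filter.mpr hc)⟩⟩
    · exact ⟨j, fun h => absurd h hj⟩
  choose ρ hρ using hex
  refine ⟨ρ, ⟨fun j hj => (hρ j hj).1.1, fun j hj => (hρ j hj).1.2, fun j hj j' hj' hg => ?_,
    fun j hj j' hj' hg => ?_⟩, fun j hj j' => ?_⟩
  · have := le_of_not_bef ((hρ j hj).2 j' ⟨hj', hg⟩)
    simpa [hkey] using this
  · have h1 := (hρ j' hj').1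
    rw [hg] at h1
    have h2 := (hρ j' hj').2
    rw [hg] at h2
    exact (Final.first_iff (p := fun c => c ∈ R.Z ∧ S.g M c = S.g M j) h1 h2).mp (hρ j hj)
  · have := h.final.eqn itRho (by simp [prog]) j j.2 j' j'.2
    simp only [itRho, first, eval_and, eval_none, bef, eval_or, eval_lt, eval_le, eval_num,
      eval_get] at this
    simp [Bd.val, env, sizes, sum_range, h.sameGroup hx hM hM', h.val hx] at this
    rw [this, ind_inj,
      ← Final.first_iff (p := fun c => c ∈ R.Z ∧ S.g M c = S.g M j) (hρ j hj).1 (hρ j hj).2]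
    simp only [bef_iff', hkey, neg_lt_neg_iff, neg_le_neg_iff, S]
    simp

theorem exists_target (h : Linked R y ε A) (hx : I.Feasible 1 x y) (hε : 0 < ε)
    {ρ : Fin n → Fin n} (hρ : (R.halves ε hx).IsChoice M (R.repLoad y ε) ρ)
    (hρ' : ∀ j ∈ R.Z, ∀ j' : Fin n, A 42 j j' = ind (ρ j = j')) :
    ∃ τ : Fin m → Fin m, R.IsTarget ε ρ τ ∧ ∀ i i' : Fin m, A 43 i i' = ind (τ i = i') := by
  classical
  have hex : ∀ i, ∃ i', (i ∈ R.reps ε → i' ∈ R.reps ε ∧ R.cl i' = ρ (R.cl i)) ∧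
      (i ∉ R.reps ε → i' = i) := by
    intro i
    by_cases hi : i ∈ R.reps ε
    · have h1 : ρ (R.cl i) ∈ R.Z := hρ.mem _ (R.clus.mem i)
      rw [← Rounding.reps_image hx hε] at h1
      obtain ⟨i', h2, h3⟩ := mem_image.mp h1
      exact ⟨i', fun _ => ⟨h2, h3⟩, fun h => absurd hi h⟩
    · exact ⟨i, fun h => absurd h hi, fun _ => rfl⟩
  choose τ hτ hτ' using hex
  refine ⟨τ, ⟨hτ, hτ'⟩, fun i i' => ?_⟩
  have hterm : ∀ j j' : Fin n, A 13 i j * (A 42 j j' * A 13 i' j') =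
      ind (R.cl i = j ∧ ρ j = j' ∧ R.cl i' = j') := by
    intro j j'
    by_cases hj : R.cl i = j
    · rw [h.cl, h.cl, hρ' j (hj ▸ R.clus.mem i)]; simp
    · rw [h.cl]; simp [ind, hj]
  have := h.final.eqn itTarget (by simp [prog]) i i.2 i' i'.2
  simp only [itTarget, eval_or, eval_and, eval_not, eval_ex, eqV, eval_le, eval_num,
      eval_get] at this
  simp [Bd.val, env, sizes, sum_range, hterm] at this
  simp [h.reps, ← le_antisymm_iff] at this
  rw [this, ind_inj]
  by_cases hi : i ∈ R.reps ε
  · simp only [hi, not_true_eq_false, false_and, false_or, true_and]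
    constructor
    · rintro ⟨h1, h2⟩
      exact Rounding.reps_injOn (hτ i hi).1 h1 ((hτ i hi).2.trans h2.symm)
    · rintro rfl
      exact ⟨(hτ i hi).1, (hτ i hi).2⟩
  · simp [hi, hτ' i hi]

theorem output (h : Linked R y ε A) {τ : Fin m → Fin m}
    (hτ : ∀ i i' : Fin m, A 43 i i' = ind (τ i = i')) (i : Fin m) :
    (∀ c : Fin n, A 7 i c = R.xbar y ε τ i c) ∧ A 8 i 0 = R.ybar y ε τ i := by
  classical
  have hserve : ∀ (i : Fin m) (c : Fin n), A 44 i c =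
      R.share y ε i * CapMedian.part x R.cl (R.cl i) c := by
    intro i c
    have := h.final.eqn itServe (by simp [prog]) i i.2 c c.2
    simpa [itServe, Bd.val, env, sizes, sum_range, h.share, h.cl, h.part, sum_ind_eq] using this
  constructor
  · intro c
    have := h.final.eqn itX (by simp [prog]) i i.2 c c.2
    simp [itX, Bd.val, env, sizes, sum_range, h.sel, hτ, hserve, ind_mul_real] at this
    rw [this, Rounding.xbar, ← sum_filter]
  · have := h.final.eqn itY (by simp [prog]) i i.2 0 one_pos
    simp [itY, Bd.val, env, sizes, sum_range, h.sel, hτ] at this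
    rw [this, Rounding.ybar, ind]
    simp

end

end Linked

end ArrayLang

/-! ### Fixed points of the recursive instructions, and assembly of the theorem. -/

namespace ArrayLang

open Finset Ex CapMedian RealRAM

section

variable {m n : ℕ} {I : CapMedian (Fin m) (Fin n)} {x : Fin m → Fin n → ℝ} {y : Fin m → ℝ}
    {ε : ℝ}

/-- Besides the three sizes, variable 3 is 0 and serves as the column index of vectors. -/
theorem holds_input : Holds (I.input x y ε).reals (sizes m n I.k) 4 (I.input x y ε) := by
  refine ⟨fun _ _ => rfl, fun v hv => ?_⟩
  interval_cases v <;> rfl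

variable {A : ℕ → ℕ → ℕ → ℝ}

/-- Whether a client is a center depends only on clients preceding it by average cost, since other
terms carry the factor 0. Its position in that order is the rank, below `n`, so `n` rounds suffice.
-/
theorem centers_eqn {k : ℕ} : ∀ a < n, ∀ b < 1, semList (sizes m n k) prog A 12 a b =
    itZ.e.eval (semList (sizes m n k) prog A) 6 (env (sizes m n k) a b) := by
  set F := semList (sizes m n k) prog A with hF
  refine semList_fix (ρ := sizes m n k) (fun a _ => rk (fun v => F 10 v 0) (range n) a) prog A
    prog_ssa itZ (by simp [prog]) ?_ ?_
  · intro a ha b _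
    have ha : a < n := ha
    have := rk_lt_card (key := fun v => F 10 v 0) (mem_range.mpr ha)
    simpa [itZ, sizes] using this
  · intro B B' hB hB' a ha b _ hlow
    rw [← hF] at hB hB'
    simp [itZ, bef, Bd.val, env, sizes, hB 1 (by decide) (by decide),
      hB 10 (by decide) (by decide), hB' 1 (by decide) (by decide),
      hB' 10 (by decide) (by decide), ← bef_iff' (key := fun v => F 10 v 0)]
    congr! 2 with a' ha'
    by_cases hb : Bef (fun v => F 10 v 0) a' a
    · rw [show B 12 a' 0 = B' 12 a' 0 from
        hlow a' (mem_range.mp ha') 0 one_pos (rk_lt_rk ha' hb)]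
    · simp [hb, ind]

/-- A pair depends only on lexicographically earlier pairs; the rank `a * n + b` is below `n ^ 2`,
the number of rounds. -/
theorem match_eqn {k : ℕ} : ∀ a < n, ∀ b < n, semList (sizes m n k) prog A 34 a b =
    itMatch.e.eval (semList (sizes m n k) prog A) 6 (env (sizes m n k) a b) := by
  set F := semList (sizes m n k) prog A with hF
  refine semList_fix (ρ := sizes m n k) (fun a b => a * n + b) prog A
    prog_ssa itMatch (by simp [prog]) ?_ ?_
  · intro a ha b hb
    have ha : a + 1 ≤ n := ha
    have hb : b < n := hb
    have := Nat.mul_le_mul_right n ha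
    simp only [itMatch, sizes]
    rw [pow_two]
    linarith
  · intro B B' hB hB' a ha b hb hlow
    rw [← hF] at hB hB'
    simp only [itMatch, eval_and, eval_none, eval_ex, eval_get]
    refine congrArg₂ (· * ·) ?_ (congrArg (fun r => ind (r ≤ 0)) (sum_congr rfl fun a' ha' =>
      congrArg (fun r => 1 - ind (r ≤ 0)) (sum_congr rfl fun b' hb' => ?_)))
    · simp [env, hB 33 (by decide) (by decide), hB' 33 (by decide) (by decide)]
    have ha' : a' < n := mem_range.mp ha'
    have hb' : b' < n := mem_range.mp hb'
    by_cases hlt : a' < a ∨ (a' ≤ a ∧ a ≤ a') ∧ b' < b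
    · have : a' * n + b' < a * n + b := by
        rcases hlt with h | h
        · have := Nat.mul_le_mul_right n (show a' + 1 ≤ a from h)
          linarith
        · have : a' = a := le_antisymm h.1.1 h.1.2
          subst this; omega
      have h1 : B 34 a' b' = B' 34 a' b' := hlow a' ha' b' hb' this
      simp [env, eqV, h1]
    · have h0 : ¬ a' < a := fun h => hlt (Or.inl h)
      by_cases hbb : b' < b
      · have h2 : a' ≤ a → ¬ a ≤ a' := fun h h' => hlt (Or.inr ⟨⟨h, h'⟩, hbb⟩)
        by_cases h3 : a' ≤ a
        · simp [env, eqV, ind, not_le.mpr (one_pos (α := ℝ)), h0, h3, h2 h3]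
        · simp [env, eqV, ind, not_le.mpr (one_pos (α := ℝ)), h0, h3]
      · simp [env, eqV, ind, not_le.mpr (one_pos (α := ℝ)), h0, hbb]

/-- Inputs occupy arrays below 7, which no instruction assigns; only the centers and the matching
need the fixed point argument. -/
theorem final_semList : Final I x y ε (semList (sizes m n I.k) prog (I.input x y ε).reals) := by
  have hin : ∀ a < 7, semList (sizes m n I.k) prog (I.input x y ε).reals a =
      (I.input x y ε).reals a := fun a ha =>
    semList_of_not_mem _ _ (by revert a; decide)
  refine ⟨fun i j => ?_, fun j j' => ?_, fun i => ?_, fun i j => ?_, fun i => ?_, ?_, ?_⟩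
  · rw [hin 0 (by omega)]; simp [input, d]
  · rw [hin 1 (by omega)]; simp [input, cc]
  · rw [hin 3 (by omega)]; simp [input]
  · rw [hin 4 (by omega)]; simp [input]
  · rw [hin 5 (by omega)]; simp [input]
  · rw [hin 6 (by omega)]; simp [input]
  · intro it hit
    by_cases hr : it.r = 0
    · exact semList_eq _ _ prog_ssa it hit hr (prog_reads it hit hr)
    · have : it = itZ ∨ it = itMatch := by
        simp only [prog, List.mem_cons, List.not_mem_nil, or_false] at hit
        rcases hit with h | h | h | h | h | h | h | h | h | h | h | h | h | h | h | h | h | h | h |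
          h | h | h | h | h | h | h | h | h | h | h | h | h | h | h | h <;> subst h <;>
          first
          | exact Or.inl rfl
          | exact Or.inr rfl
          | exact absurd rfl hr
      rcases this with rfl | rfl
      · exact centers_eqn
      · exact match_eqn

/-- Without clients there are no centers and no clustering, but then no candidate is selected and
nothing is opened at cost 0. -/
theorem Final.outcome (h : Final I x y ε A) (hx : I.Feasible 1 x y) (hε : 0 < ε) :
    I.IsIntegralSolution (3 + 3 * ε) (fun i j => A 7 i j) (fun i => A 8 i 0) ∧
      I.cost (fun i j => A 7 i j) ≤ (93 + 15 / ε) * I.cost x := by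
  rcases Nat.eq_zero_or_pos n with rfl | hn
  · have h8 : ∀ i : Fin m, A 8 i 0 = 0 := by
      have h22 : ∀ i : Fin m, A 22 i 0 = 0 := fun i => by
        have := h.eqn itSel (by simp [prog]) i i.2 0 one_pos
        simpa [itSel, Bd.val, env, sizes, ind] using this
      intro i
      have := h.eqn itY (by simp [prog]) i i.2 0 one_pos
      simpa [itY, Bd.val, env, sizes, sum_range, h22, ind] using this
    refine ⟨⟨⟨by simp [h8], fun j => j.elim0, fun _ j => j.elim0, fun i => by simp [h8],
      fun _ j => j.elim0, fun i => by simp [h8], fun i => by simp [h8]⟩, fun i => by simp [h8]⟩, ?_⟩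
    simp [cost]
  · obtain ⟨R, hZ, hcl, hσ, hclose⟩ := h.exists_rounding hx hn
    have hL : Linked R y ε A := ⟨h, hZ, hcl, hσ, hclose⟩
    obtain ⟨M, hM, hM'⟩ := hL.exists_matching hx
    obtain ⟨ρ, hρ, hρ'⟩ := hL.exists_choice hx hM hM'
    obtain ⟨τ, hτ, hτ'⟩ := hL.exists_target hx hε hρ hρ'
    have h7 : (fun (i : Fin m) (j : Fin n) => A 7 i j) = R.xbar y ε τ := by
      funext i j; exact (hL.output hτ' i).1 j
    have h8 : (fun i : Fin m => A 8 i 0) = R.ybar y ε τ := by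
      funext i; exact (hL.output hτ' i).2
    rw [h7, h8]
    exact ⟨Rounding.isIntegralSolution hε hM' hρ hτ, Rounding.cost_xbar_le hε hM' hρ hτ⟩

theorem prog_exec (I : CapMedian (Fin m) (Fin n)) (hx : I.Feasible 1 x y) (hε : 0 < ε) :
    ∃ s t, Exec (compList prog) (I.input x y ε) s t ∧ t ≤ (listTime prog).eval (m + n) ∧
      I.IsIntegralSolution (3 + 3 * ε) (outputX m n s) (outputY m s) ∧
      I.cost (outputX m n s) ≤ (93 + 15 / ε) * I.cost x := by
  obtain ⟨s, t, he, ht, hs⟩ := compList_exec prog prog_lt _ _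
    (holds_input (I := I) (x := x) (y := y) (ε := ε))
  refine ⟨s, t, he, ht, ?_⟩
  have h := (final_semList (I := I) (x := x) (y := y) (ε := ε)).outcome hx hε
  rw [← hs.arr 7 (by omega), ← hs.arr 8 (by omega)] at h
  exact h

end

end ArrayLang

theorem mainTheorem1 :
    ∃ alg : ℕ → RealRAM.Prog,
      (∀ ℓ : ℕ, 2 ≤ ℓ →
        CapMedian.RunsInPolyTime (alg ℓ) ∧
        ∃ K : ℝ, ∀ ε : ℝ, 0 < ε → ε ≤ 1 →
          CapMedian.IsBicriteriaApprox (alg ℓ) ε (K / ε) (3 + 3 * ε)) ∧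
      ∀ ε : ℝ, 0 < ε →
        CapMedian.IsBicriteriaApprox (alg 2) ε (96 + 180 / ε) (3 + 3 * ε) := by
  have key : ∀ ε α : ℝ, 0 < ε → 93 + 15 / ε ≤ α →
      CapMedian.IsBicriteriaApprox (ArrayLang.compList ArrayLang.prog) ε α (3 + 3 * ε) := by
    intro ε α hε hα m n I x y hopt
    obtain ⟨s, t, he, -, hs, hcost⟩ := ArrayLang.prog_exec I hopt.1 hε
    exact ⟨s, t, he, hs, hcost.trans
      (mul_le_mul_of_nonneg_right hα (CapMedian.cost_nonneg hopt.1))⟩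
  -- The same program is used for all ℓ. For `ε ≤ 1` one has `93 + 15/ε ≤ (93 + 15)/ε`, whence 108.
  refine ⟨fun _ => ArrayLang.compList ArrayLang.prog, fun ℓ _ => ⟨⟨ArrayLang.listTime ArrayLang.prog,
    fun m n I x y ε hopt hε => ?_⟩, 108, fun ε hε hε1 => key ε _ hε ?_⟩, fun ε hε => key ε _ hε ?_⟩
  · obtain ⟨s, t, he, ht, -⟩ := ArrayLang.prog_exec I hopt.1 hε
    exact ⟨s, t, he, ht⟩
  · rw [le_div_iff₀ hε, add_mul, div_mul_cancel₀ _ hε.ne']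
    linarith
  · have : (15 : ℝ) / ε ≤ 180 / ε := div_le_div_of_nonneg_right (by norm_num) hε.le
    linarith
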